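/- Let $n\ge 3$ and $1<k\le n$ be integers. For a positive $C^2$ function $v$ on an open interval $(r_-,r_+)\subseteq(0,\infty)$ let $g=v^{-2}(|x|)|dx|^2$ on $\{x\in\mathbb R^n: r_-<|x|<r_+\}$, let $A_g=\frac1{n-2}\{Ric-\frac{R}{2(n-1)}g\}$ be its Weyl--Schouten tensor and $\sigma_k(A_g)$ the $k$-th elementary symmetric function of the eigenvalues of $A_g$ with respect to $g$. Put $t=\ln |x|$ and $\xi(t)=\ln v(e^t)-t$, so $g=e^{-2\xi}(dt^2+d\omega^2)$. The inversion of $v$ is $r\mapsto r^2v(1/r)$, i.e. $\xi(t)\mapsto\xi(-t)$. Consider solutions of $\sigma_k(A_g)\equiv-2^{-k}\binom nk$. Every solution extends uniquely to a maximum interval of definition $(r_-,r_+)$, $0\le r_-<r_+\le\infty$. Below, solutions are maximal; $f\sim\varphi$ means that $f/\varphi$ has a positive finite limit; "$v$ stops at an end" means that there $v$ has a positive finite limit, $v_r\to0$ and $|v_{rr}|\to\infty$; "complete (incomplete) near an end" means that all (not all) $C^1$ curves tending to that end have infinite length. Along any solution either $1-\xi_t^2>0$ everywhere or $1-\xi_t^2<0$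 everywhere, and $h=e^{(2k-n)\xi}(1-\xi_t^2)^k+e^{-n\xi}$ is constant. **Case I:** $1-\xi_t^2>0$. Then $h>0$. 1. If $2k<n$, then $0<r_-<r_+<\infty$ and $|v_{rr}|\to\infty$ at both ends. 2. If $2k=n$, then $v$ or its inversion satisfies one of: (a) $0<h<1$; the domain is $0<|x|<r_+<\infty$; $v$ stops at $r_+$; as $|x|\to0$, $v^{-2}\sim|x|^{-2(1-\sqrt{1-\sqrt[k]h})}$, and $g$ is incomplete near $0$. (b) $h=1$; the domain is $0<|x|<r_+<\infty$; $v$ stops at $r_+$; as $|x|\to0$, $v^{-2}\sim|x|^{-2}(\ln\frac1{|x|})^{-2/k}$, and $g$ is complete near $0$. (c) $h>1$; $0<r_-<r_+<\infty$ and $|v_{rr}|\to\infty$ at both ends. 3. If $2k>n$, let $h^*=\frac{2k}{2k-n}\left(\frac{2k-n}{n}\right)^{n/2k}$. For $h>0$ the maximum $M(h)=\max_{\xi\in\mathbb R}\{e^{(n-2k)\xi}h-e^{-2k\xi}\}$ exists and is strictly increasing in $h$, and $h^*$ is the unique positive number with $M(h^*)=1$. Put $\xi^*=\frac1n\ln\frac{2k}{(2k-n)h}$.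 Then $v$ or its inversion satisfies one of: (a) $h<h^*$; the domain is $0<|x|<r_+<\infty$; $v$ stops at $r_+$; for some $\rho>0$, as $|x|\to0$, $$v^{-2}(|x|)=\rho^{-2}\Big\{1-\sqrt[k]h\,\tfrac{k}{2k-n}\big(\tfrac{|x|}\rho\big)^{2-\frac nk}+o\big(|x|^{2-\frac nk}\big)\Big\};\qquad(*)$$ $\xi_t\to-1$ at both ends, with $\xi$ tending to a finite limit at $r_+$ and to $+\infty$ at $0$. (b) $h=h^*$, $\xi_{tt}<0$ everywhere; the domain is $0<|x|<r_+<\infty$; $v$ stops at $r_+$, where $\xi_t\to-1$ and $\xi$ has a finite limit; as $|x|\to0$, $|x|^2v^{-2}\to e^{-2\xi^*}$ and $(\xi,\xi_t)\to(\xi^*,0)$ ($g$ is asymptotic to a cylindrical metric). (c) $h=h^*$, $\xi_{tt}>0$ everywhere; the domain is $0<|x|<\infty$; as $|x|\to\infty$, $|x|^2v^{-2}\to e^{-2\xi^*}$ and $(\xi,\xi_t)\to(\xi^*,0)$; as $|x|\to0$, $(*)$ holds for some $\rho>0$, $\xi\to\infty$ and $\xi_t\to-1$. (d) $h=h^*$,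 $\xi_{tt}\equiv0$; the domain is $0<|x|<\infty$, $\xi\equiv\xi^*$, and $g=e^{-2\xi^*}|x|^{-2}|dx|^2$ is a cylindrical metric. (e) $h>h^*$, $\xi_{tt}<0$ everywhere; $0<r_-<r_+<\infty$; $|v_{rr}|\to\infty$ at both ends; $\xi$ has finite limits at both ends, $\xi_t\to1$ at $r_-$ and $\xi_t\to-1$ at $r_+$. (f) $h>h^*$, $\xi_{tt}>0$ everywhere; the domain is $0<|x|<\infty$; as $|x|\to0$, $(*)$ holds for $v$ and, with a possibly different $\rho$, for the inversion of $v$ (so $v$ behaves similarly as $|x|\to\infty$); $\xi\to\infty$ at both ends, with $\xi_t\to-1$ at $0$ and $\xi_t\to1$ at $\infty$. The conformal factors of $g$ and of its inversion extend across the origin as positive functions Hölder continuous of exponent $2-\frac nk$ near the origin (Lipschitz if $k=n$), so that $g$ extends to a $C^{2-\frac nk}$ metric on $\mathbb S^n$. **Case II:** $k$ odd and $1-\xi_t^2<0$. Then $g$ is in the class $\Gamma_k^-$, i.e. $(-1)^j\sigma_j(A_g)>0$ for $1\le j\le k$. For $v$ or its inversion the domain has $0\le r_-<r_+<\infty$,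 $v^{-2}(r_+-r)^2\to1$ as $r\to r_+$, and one of the following holds: 1. $h=0$, $r_-=0$ and $v^{-2}=\left(\frac{2r_+}{r_+^2-|x|^2}\right)^2$ (the hyperbolic metric on $|x|<r_+$). 2. $h>0$, $r_->0$, and $v$ stops at $r_-$. 3. $h<0$ and: (a) if $2k<n$, then $r_->0$, $v^{-2}\sim(r-r_-)^{\frac{4k}{n-2k}}$ as $r\to r_-$, and $g$ is complete near $r_+$; (b) if $2k=n$, then $r_-=0$, $v^{-2}\sim|x|^{2(\sqrt{1+\sqrt[k]{|h|}}-1)}$ as $|x|\to0$, and $g$ is complete near $r_+$; (c) if $2k>n$, then $r_-=0$ and for some $\rho>0$, as $|x|\to0$, $$v^{-2}(|x|)=\rho^{-2}\Big\{1+\sqrt[k]{|h|}\,\tfrac{k}{2k-n}\big(\tfrac{|x|}\rho\big)^{2-\frac nk}+o\big(|x|^{2-\frac nk}\big)\Big\}.\qquad(**)$$ **Case III:** $k$ even and $1-\xi_t^2<0$. Then $h>0$. For $v$ or its inversion the domain has $0\le r_-<r_+<\infty$, $v$ stops at $r_+$ (so $v$ and $v_r$ stay bounded and $v_{rr}$ blows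 up there), and: 1. if $2k<n$, then $r_->0$ and $v^{-2}\sim(r-r_-)^{\frac{4k}{n-2k}}$ as $r\to r_-$; 2. if $2k=n$, then $r_-=0$ and $v^{-2}\sim|x|^{2(\sqrt{1+\sqrt[k]h}-1)}$ as $|x|\to0$; 3. if $2k>n$, then $r_-=0$ and $(**)$ holds as $|x|\to0$ for some $\rho>0$; if moreover $k<n$, then $|v_{rr}|\to\infty$ also as $|x|\to0$. -/

import Mathlib

open Set Filter Topology MeasureTheory Asymptotics

noncomputable section

namespace SigmaK

/-- Euclidean space `ℝⁿ`. -/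
abbrev E (n : ℕ) : Type := EuclideanSpace ℝ (Fin n)

/-- The `i`-th partial derivative of a function on `ℝⁿ`. -/
def pd {n : ℕ} (i : Fin n) (f : E n → ℝ) (x : E n) : ℝ :=
  fderiv ℝ f x (EuclideanSpace.single i (1 : ℝ))

/-! ### Curvature of a metric `g = (g_ij)` given in coordinates -/

/-- Christoffel symbol `Γ^m_ij`. -/
def christoffel {n : ℕ} (g : E n → Matrix (Fin n) (Fin n) ℝ) (m i j : Fin n) (x : E n) : ℝ :=
  (1 / 2) * ∑ l, (g x)⁻¹ m l *
    (pd i (fun y => g y j l) x + pd j (fun y => g y i l) x - pd l (fun y => g y i j) x)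

/-- Ricci tensor
`Ric_ij = ∂_m Γ^m_ij - ∂_j Γ^m_im + Γ^m_ml Γ^l_ij - Γ^m_jl Γ^l_im` (positive on round spheres). -/
def ricci {n : ℕ} (g : E n → Matrix (Fin n) (Fin n) ℝ) (x : E n) : Matrix (Fin n) (Fin n) ℝ :=
  Matrix.of fun i j =>
    (∑ m, (pd m (christoffel g m i j) x - pd j (christoffel g m i m) x)) +
      ∑ m, ∑ l, (christoffel g m m l x * christoffel g l i j x -
        christoffel g m j l x * christoffel g l i m x)

/-- Scalar curvature. -/
def scalarCurv {n : ℕ} (g : E n → Matrix (Fin n) (Fin n) ℝ) (x : E n) : ℝ :=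
  ∑ i, ∑ j, (g x)⁻¹ i j * ricci g x i j

/-- The Weyl-Schouten tensor `A_g = (Ric - R / (2 (n - 1)) g) / (n - 2)`. -/
def schouten {n : ℕ} (g : E n → Matrix (Fin n) (Fin n) ℝ) (x : E n) :
    Matrix (Fin n) (Fin n) ℝ :=
  (1 / ((n : ℝ) - 2)) • (ricci g x - (scalarCurv g x / (2 * ((n : ℝ) - 1))) • g x)

/-- `σ_k(A_g)`: the `k`-th elementary symmetric function of the eigenvalues (with multiplicity)
of `A_g` with respect to `g`, i.e. of the matrix `g⁻¹ A_g`. -/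
def sigmaCurv {n : ℕ} (k : ℕ) (g : E n → Matrix (Fin n) (Fin n) ℝ) (x : E n) : ℝ :=
  ((g x)⁻¹ * schouten g x).charpoly.roots.esymm k

/-- The radial conformally flat metric `g = v(|x|)⁻² |dx|²`. -/
def radialMetric (n : ℕ) (v : ℝ → ℝ) (x : E n) : Matrix (Fin n) (Fin n) ℝ :=
  ((v ‖x‖) ^ 2)⁻¹ • (1 : Matrix (Fin n) (Fin n) ℝ)

/-! ### Radial solutions -/

/-- `v` is a `C²` positive function on the nonempty open interval `S ⊆ (0, ∞)`, and
`g = v(|x|)⁻² |dx|²` satisfies `σ_k(A_g) = -2⁻ᵏ (n choose k)` on the annular domain `|x| ∈ S`. -/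
structure IsRadialSolution (n k : ℕ) (v : ℝ → ℝ) (S : Set ℝ) : Prop where
  isOpen : IsOpen S
  ordConnected : S.OrdConnected
  nonempty : S.Nonempty
  subset_pos : S ⊆ Ioi 0
  contDiffOn : ContDiffOn ℝ 2 v S
  pos : ∀ r ∈ S, 0 < v r
  eqn : ∀ x : E n, ‖x‖ ∈ S → sigmaCurv k (radialMetric n v) x = -((2 : ℝ) ^ k)⁻¹ * (n.choose k : ℝ)

/-- `S` is the maximal domain of definition of the solution `v`. -/
def IsMaximalRadialSolution (n k : ℕ) (v : ℝ → ℝ) (S : Set ℝ) : Prop :=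
  IsRadialSolution n k v S ∧
    ∀ (w : ℝ → ℝ) (T : Set ℝ), IsRadialSolution n k w T → S ⊆ T → EqOn v w S → T = S

/-- The class `Γ_k^-` on the annular domain `|x| ∈ S`. -/
def InGammaMinus (n k : ℕ) (v : ℝ → ℝ) (S : Set ℝ) : Prop :=
  ∀ x : E n, ‖x‖ ∈ S → ∀ j : ℕ, 1 ≤ j → j ≤ k →
    0 < (-1 : ℝ) ^ j * sigmaCurv j (radialMetric n v) x

/-- The logarithmic variable `ξ(t)`: `v(eᵗ) = exp (ξ(t) + t)`. -/
def xi (v : ℝ → ℝ) (t : ℝ) : ℝ := Real.log (v (Real.exp t)) - t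

/-- `ξ_t`. -/
def xit (v : ℝ → ℝ) (t : ℝ) : ℝ := deriv (xi v) t

/-- `ξ_tt`. -/
def xitt (v : ℝ → ℝ) (t : ℝ) : ℝ := deriv (xit v) t

/-- `e^{(2k-n)ξ} (1 - ξ_t²)^k + e^{-nξ}`. -/
def firstIntegral (n k : ℕ) (v : ℝ → ℝ) (t : ℝ) : ℝ :=
  Real.exp ((2 * (k : ℝ) - n) * xi v t) * (1 - xit v t ^ 2) ^ k + Real.exp (-(n : ℝ) * xi v t)

/-- The metric `v(|x|)⁻²|dx|²` pulled back by the inversion `x ↦ x/|x|²` is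
`(inv v)(|x|)⁻²|dx|²`; in the variable `t = ln |x|` this is `ξ(t) ↦ ξ(-t)`. -/
def inversion (v : ℝ → ℝ) (r : ℝ) : ℝ := r ^ 2 * v r⁻¹

/-- `v` on `S`, or its inversion on the inverted interval, has the property `P`. -/
def UpToInversion (P : (ℝ → ℝ) → Set ℝ → Prop) (v : ℝ → ℝ) (S : Set ℝ) : Prop :=
  P v S ∨ P (inversion v) {r : ℝ | r⁻¹ ∈ S}

/-! ### Behaviour at an end of the domain -/

/-- `v_rr` blows up along the filter `l`. -/
def SecondDerivBlowsUp (v : ℝ → ℝ) (l : Filter ℝ) : Prop :=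
  Tendsto (fun r => |deriv (deriv v) r|) l atTop

/-- `v` has a positive finite limit and `v_r → 0`, but `v_rr` blows up. -/
def StopsAt (v : ℝ → ℝ) (l : Filter ℝ) : Prop :=
  (∃ L : ℝ, 0 < L ∧ Tendsto v l (𝓝 L)) ∧ Tendsto (deriv v) l (𝓝 0) ∧ SecondDerivBlowsUp v l

/-- `f` is asymptotic to a positive constant multiple of `φ` along `l`. -/
def AsympMultiple (f φ : ℝ → ℝ) (l : Filter ℝ) : Prop :=
  ∃ C : ℝ, 0 < C ∧ Tendsto (fun r => f r / φ r) l (𝓝 C)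

/-- The conformal factor `v⁻²`. -/
def confFactor (v : ℝ → ℝ) (r : ℝ) : ℝ := ((v r) ^ 2)⁻¹

/-- Expansion
`v⁻²(|x|) = ρ⁻² {1 + c · k/(2k-n) · (|x|/ρ)^{2-n/k} + o(|x|^{2-n/k})}` as `|x| → 0`,
for some `ρ > 0`. -/
def HasExpansionAtZero (n k : ℕ) (c : ℝ) (v : ℝ → ℝ) : Prop :=
  ∃ ρ : ℝ, 0 < ρ ∧
    (fun r : ℝ => confFactor v r -
      (ρ ^ 2)⁻¹ * (1 + c * ((k : ℝ) / (2 * (k : ℝ) - n)) * (r / ρ) ^ (2 - (n : ℝ) / k)))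
      =o[𝓝[>] 0] (fun r : ℝ => r ^ (2 - (n : ℝ) / k))

/-- The metric `v(|x|)⁻²|dx|²` on `|x| ∈ S` is complete as `|x| → c`: every `C¹` curve
`[0,1) → {|x| ∈ S}` along which `|x| → c` has infinite length. -/
def CompleteToward (n : ℕ) (v : ℝ → ℝ) (S : Set ℝ) (c : ℝ) : Prop :=
  ∀ γ : ℝ → E n, ContDiffOn ℝ 1 γ (Ico 0 1) → (∀ s ∈ Ico (0 : ℝ) 1, ‖γ s‖ ∈ S) →
    Tendsto (fun s => ‖γ s‖) (𝓝[<] 1) (𝓝 c) →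
      ∫⁻ s in Ioo (0 : ℝ) 1, ENNReal.ofReal (‖deriv γ s‖ / v ‖γ s‖) = ⊤

/-- The conformal factor `v(|x|)⁻²` extends across the origin of `ℝⁿ` to a positive function that
is Hölder continuous of exponent `α` near the origin (Lipschitz if `α = 1`). -/
def ExtendsHolderAtOrigin (n : ℕ) (α : ℝ) (v : ℝ → ℝ) : Prop :=
  ∃ W : E n → ℝ, 0 < W 0 ∧ (∀ x, x ≠ 0 → W x = confFactor v ‖x‖) ∧
    ∃ ε : ℝ, 0 < ε ∧ ∃ C : ℝ, ∀ x y : E n, ‖x‖ < ε → ‖y‖ < ε → |W x - W y| ≤ C * ‖x - y‖ ^ α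

/-- The phase curve `(ξ, ξ_t)` reaches the line `ξ_t = c` at a finite `ξ` along `l`. -/
def InterceptsLine (v : ℝ → ℝ) (l : Filter ℝ) (c : ℝ) : Prop :=
  (∃ x : ℝ, Tendsto (xi v) l (𝓝 x)) ∧ Tendsto (xit v) l (𝓝 c)

/-- The phase curve `(ξ, ξ_t)` is asymptotic to the line `ξ_t = c`, with `ξ → ∞`, along `l`. -/
def AsymptoticToLine (v : ℝ → ℝ) (l : Filter ℝ) (c : ℝ) : Prop :=
  Tendsto (xi v) l atTop ∧ Tendsto (xit v) l (𝓝 c)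

/-- The phase curve `(ξ, ξ_t)` tends to the point `(x, 0)` along `l`. -/
def TendsToEquilibrium (v : ℝ → ℝ) (l : Filter ℝ) (x : ℝ) : Prop :=
  Tendsto (xi v) l (𝓝 x) ∧ Tendsto (xit v) l (𝓝 0)

/-- `S = (r₋, r₊)` with `0 < r₋ < r₊ < ∞`, and `v_rr` blows up at both ends. -/
def AnnulusBlowUp (v : ℝ → ℝ) (S : Set ℝ) : Prop :=
  ∃ a b : ℝ, 0 < a ∧ a < b ∧ S = Ioo a b ∧
    SecondDerivBlowsUp v (𝓝[>] a) ∧ SecondDerivBlowsUp v (𝓝[<] b)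

/-! ### The catalog -/

/-- `h* = (2k/(2k-n)) ((2k-n)/n)^{n/(2k)}` (used for `2k > n`). -/
def hStar (n k : ℕ) : ℝ :=
  (2 * (k : ℝ)) / (2 * k - n) * ((2 * (k : ℝ) - n) / n) ^ ((n : ℝ) / (2 * k))

/-- `ξ* = (1/n) ln (2k/((2k-n)h))`. -/
def xiStar (n k : ℕ) (h : ℝ) : ℝ :=
  (1 / (n : ℝ)) * Real.log ((2 * (k : ℝ)) / ((2 * k - n) * h))

/-- `|h|^{1/k}`. -/
def kthRoot (k : ℕ) (h : ℝ) : ℝ := |h| ^ (1 / (k : ℝ))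

/-- Solutions with `1 - ξ_t² > 0` when `2k = n`. -/
def CaseIEq (n k : ℕ) (h : ℝ) (v : ℝ → ℝ) (S : Set ℝ) : Prop :=
  (0 < h ∧ h < 1 ∧ ∃ R : ℝ, 0 < R ∧ S = Ioo 0 R ∧ StopsAt v (𝓝[<] R) ∧
    AsympMultiple (confFactor v)
      (fun r => r ^ (-2 * (1 - Real.sqrt (1 - kthRoot k h)))) (𝓝[>] 0) ∧
    ¬ CompleteToward n v S 0) ∨
  (h = 1 ∧ ∃ R : ℝ, 0 < R ∧ S = Ioo 0 R ∧ StopsAt v (𝓝[<] R) ∧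
    AsympMultiple (confFactor v)
      (fun r => r ^ (-2 : ℝ) * (Real.log (1 / r)) ^ (-(2 / (k : ℝ)))) (𝓝[>] 0) ∧
    CompleteToward n v S 0) ∨
  (1 < h ∧ AnnulusBlowUp v S)

/-- Solutions with `1 - ξ_t² > 0` when `2k > n`. -/
def CaseIGt (n k : ℕ) (h : ℝ) (v : ℝ → ℝ) (S : Set ℝ) : Prop :=
  -- (a)
  (h < hStar n k ∧ ∃ R : ℝ, 0 < R ∧ S = Ioo 0 R ∧ StopsAt v (𝓝[<] R) ∧
    HasExpansionAtZero n k (-kthRoot k h) v ∧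
    InterceptsLine v (𝓝[<] (Real.log R)) (-1) ∧ AsymptoticToLine v atBot (-1)) ∨
  -- (b)
  (h = hStar n k ∧ (∀ t, Real.exp t ∈ S → xitt v t < 0) ∧
    ∃ R : ℝ, 0 < R ∧ S = Ioo 0 R ∧ StopsAt v (𝓝[<] R) ∧
    Tendsto (fun r => confFactor v r / r ^ (-2 : ℝ)) (𝓝[>] 0)
      (𝓝 (Real.exp (-2 * xiStar n k h))) ∧
    TendsToEquilibrium v atBot (xiStar n k h) ∧ InterceptsLine v (𝓝[<] (Real.log R)) (-1)) ∨
  -- (c)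
  (h = hStar n k ∧ (∀ t, Real.exp t ∈ S → 0 < xitt v t) ∧ S = Ioi 0 ∧
    Tendsto (fun r => confFactor v r / r ^ (-2 : ℝ)) atTop
      (𝓝 (Real.exp (-2 * xiStar n k h))) ∧
    HasExpansionAtZero n k (-kthRoot k h) v ∧
    TendsToEquilibrium v atTop (xiStar n k h) ∧ AsymptoticToLine v atBot (-1)) ∨
  -- (d)
  (h = hStar n k ∧ (∀ t, Real.exp t ∈ S → xitt v t = 0) ∧ S = Ioi 0 ∧
    (∀ t, xi v t = xiStar n k h) ∧
    ∀ r : ℝ, 0 < r → confFactor v r = Real.exp (-2 * xiStar n k h) * r ^ (-2 : ℝ)) ∨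
  -- (e)
  (hStar n k < h ∧ (∀ t, Real.exp t ∈ S → xitt v t < 0) ∧
    ∃ a b : ℝ, 0 < a ∧ a < b ∧ S = Ioo a b ∧
    SecondDerivBlowsUp v (𝓝[>] a) ∧ SecondDerivBlowsUp v (𝓝[<] b) ∧
    InterceptsLine v (𝓝[>] (Real.log a)) 1 ∧ InterceptsLine v (𝓝[<] (Real.log b)) (-1)) ∨
  -- (f)
  (hStar n k < h ∧ (∀ t, Real.exp t ∈ S → 0 < xitt v t) ∧ S = Ioi 0 ∧
    HasExpansionAtZero n k (-kthRoot k h) v ∧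
    HasExpansionAtZero n k (-kthRoot k h) (inversion v) ∧
    ExtendsHolderAtOrigin n (2 - (n : ℝ) / k) v ∧
    ExtendsHolderAtOrigin n (2 - (n : ℝ) / k) (inversion v) ∧
    AsymptoticToLine v atBot (-1) ∧ AsymptoticToLine v atTop 1)

/-- Solutions with `1 - ξ_t² < 0`, `k` odd. -/
def CaseII (n k : ℕ) (h : ℝ) (v : ℝ → ℝ) (S : Set ℝ) : Prop :=
  ∃ a R : ℝ, 0 ≤ a ∧ a < R ∧ S = Ioo a R ∧
    Tendsto (fun r => confFactor v r / (R - r) ^ (-2 : ℝ)) (𝓝[<] R) (𝓝 1) ∧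
    ( -- the hyperbolic metric of the ball of radius `R`
      (h = 0 ∧ a = 0 ∧ ∀ r ∈ S, confFactor v r = (2 * R / (R ^ 2 - r ^ 2)) ^ 2) ∨
      (0 < h ∧ 0 < a ∧ StopsAt v (𝓝[>] a)) ∨
      (h < 0 ∧
        ((2 * k < n ∧ 0 < a ∧
            AsympMultiple (confFactor v)
              (fun r => (r - a) ^ (4 * (k : ℝ) / (n - 2 * k))) (𝓝[>] a) ∧
            CompleteToward n v S R) ∨
          (2 * k = n ∧ a = 0 ∧
            AsympMultiple (confFactor v)
              (fun r => r ^ (2 * (Real.sqrt (1 + kthRoot k h) - 1))) (𝓝[>] 0) ∧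
            CompleteToward n v S R) ∨
          (n < 2 * k ∧ a = 0 ∧ HasExpansionAtZero n k (kthRoot k h) v))))

/-- Solutions with `1 - ξ_t² < 0`, `k` even. -/
def CaseIII (n k : ℕ) (h : ℝ) (v : ℝ → ℝ) (S : Set ℝ) : Prop :=
  ∃ a R : ℝ, 0 ≤ a ∧ a < R ∧ S = Ioo a R ∧ StopsAt v (𝓝[<] R) ∧
    ((2 * k < n ∧ 0 < a ∧
        AsympMultiple (confFactor v)
          (fun r => (r - a) ^ (4 * (k : ℝ) / (n - 2 * k))) (𝓝[>] a)) ∨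
      (2 * k = n ∧ a = 0 ∧
        AsympMultiple (confFactor v)
          (fun r => r ^ (2 * (Real.sqrt (1 + kthRoot k h) - 1))) (𝓝[>] 0)) ∨
      (n < 2 * k ∧ a = 0 ∧ HasExpansionAtZero n k (kthRoot k h) v ∧
        (k < n → SecondDerivBlowsUp v (𝓝[>] 0))))

end SigmaK

end

open SigmaK

/-!
In the variable `t = ln |x|`, `ξ(t) = ln v(eᵗ) - t`, the tensor `A_g` of the radial metric
`g = v⁻²|dx|²` has, with respect to `g`, the eigenvalue `e^{2ξ}(1 - ξ_t²)/2` with multiplicity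
`n - 1` and one more eigenvalue `e^{2ξ}(ξ_tt - (1 - ξ_t²)/2)`. This is obtained from the coordinate
definition of the Ricci tensor (`schouten_conformal`, `sigmaCurv_log_variable`). The right hand side
being nonzero, `σ_k(A_g) = -2⁻ᵏ C(n, k)` becomes the autonomous equation `ξ_tt = accel n k ξ ξ_t` on
the complement of the two lines `ξ_t = ±1` of the phase plane (`sigma_equation_iff`). Hence the sign
of `1 - ξ_t²` is constant, and, the vector field being smooth off these lines, solutions are unique
and have a greatest extension (`IsPhaseCurve.exists_greatest_extension`).

The quantity `h` of the theorem is constant along solutions, so that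
`(1 - ξ_t²)ᵏ = F(ξ)` with `F(x) = e^{(n-2k)x} h - e^{-2kx}`. Everything is read off this relation:

* A branch on which `ξ` is monotone and bounded has a limit `x`. By maximality it either lasts for
  infinite time, and then `ξ_t → 0` and `F(x) = 1`, or it ends in finite time at the singular lines,
  where `ξ_t → ±1` and `F(x) = 0` (`Trajectory.limit_right`). In the second case `F'(x) ≠ 0` and
  `ξ_tt = -F'(ξ) / (2k (1 - ξ_t²)^{k-1})` show that `v_rr` blows up, while for `ξ_t → -1` the
  derivative `v_r = (1 + ξ_t) e^ξ` tends to `0` (`RadialTrajectory.stopsAt`).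
* A branch on which `ξ → ±∞` has the asymptotics of the separable first order equation
  `ξ_t = -√(1 - s |F(ξ)|^{1/k})`, where `s` is the sign of `1 - ξ_t²`; this gives the various
  expansions of `v⁻²` and also the completeness or incompleteness of `g`.

What remains is the discussion of the shape of `F`. For `1 - ξ_t² > 0` one has `0 < F(ξ) ≤ 1`, so the
relation of `1` to the values of `F` decides whether `ξ` can turn around. For `2k ≤ n` the function
`F` is increasing; for `2k > n` it has a unique maximum at `ξ*`, with value `(h/h*)^{2k/n}`
(`potential_xiStar`), which is why the threshold `h*` separates the cases. For `1 - ξ_t² < 0` the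
function `ξ` is always monotone. Replacing `v` by its inversion changes the direction of `t`, so
monotone solutions may be assumed decreasing (`RadialTrajectory.upToInversion`).
-/

/-! ### Linear algebra and partial derivatives -/

theorem esymm_cons_succ (s : Multiset ℝ) (a : ℝ) (j : ℕ) :
    (a ::ₘ s).esymm (j + 1) = s.esymm (j + 1) + a * s.esymm j := by
  simp [Multiset.esymm, Multiset.powersetCard_cons, Multiset.map_map,
    Multiset.sum_map_mul_left]

theorem esymm_replicate (m : ℕ) (b : ℝ) (j : ℕ) :
    (Multiset.replicate m b).esymm j = m.choose j * b ^ j := by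
  induction m generalizing j with
  | zero => cases j <;> simp [Multiset.esymm, Multiset.powersetCard_zero_right]
  | succ m ih =>
    cases j with
    | zero => simp [Multiset.esymm]
    | succ j =>
      rw [Multiset.replicate_succ, esymm_cons_succ, ih, ih, Nat.choose_succ_succ]
      push_cast
      ring

/-- The spectrum of a rank one perturbation of a scalar matrix. -/
theorem roots_charpoly_scalar_add_vecMulVec {n : ℕ} (hn : 1 ≤ n) (a : ℝ) (u w : Fin n → ℝ) :
    (a • (1 : Matrix (Fin n) (Fin n) ℝ) + Matrix.vecMulVec u w).charpoly.roots =
      (a + u ⬝ᵥ w) ::ₘ Multiset.replicate (n - 1) a := by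
  have h := Matrix.charpoly_sub_scalar (Matrix.vecMulVec u w) (-a)
  rw [Matrix.charpoly_vecMulVec] at h
  have e : Matrix.vecMulVec u w - Matrix.scalar (Fin n) (-a) =
      a • (1 : Matrix (Fin n) (Fin n) ℝ) + Matrix.vecMulVec u w := by
    rw [map_neg, sub_neg_eq_add, add_comm]
    congr 1
    ext i j
    simp [Matrix.scalar_apply, Matrix.diagonal_apply, Matrix.one_apply]
  rw [e] at h
  obtain ⟨m, rfl⟩ : ∃ m, n = m + 1 := ⟨n - 1, by omega⟩
  have h2 : (a • (1 : Matrix (Fin (m + 1)) (Fin (m + 1)) ℝ) + Matrix.vecMulVec u w).charpoly =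
      (Polynomial.X - Polynomial.C (a + u ⬝ᵥ w)) * (Polynomial.X - Polynomial.C a) ^ m := by
    rw [h]
    simp [Polynomial.smul_eq_C_mul]
    ring
  rw [h2, Polynomial.roots_mul (mul_ne_zero (Polynomial.X_sub_C_ne_zero _)
    (pow_ne_zero _ (Polynomial.X_sub_C_ne_zero _)))]
  rw [Polynomial.roots_pow, Polynomial.roots_X_sub_C, Polynomial.roots_X_sub_C,
    Multiset.nsmul_singleton]
  rfl

theorem pd_eq {n : ℕ} {f : E n → ℝ} {f' : E n →L[ℝ] ℝ} {x : E n} (h : HasFDerivAt f f' x)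
    (i : Fin n) : pd i f x = f' (EuclideanSpace.single i 1) := by
  rw [pd, h.fderiv]

theorem pd_congr {n : ℕ} {f g : E n → ℝ} {x : E n} (h : f =ᶠ[𝓝 x] g) (i : Fin n) :
    pd i f x = pd i g x := by
  rw [pd, pd, h.fderiv_eq]

/-- The Christoffel symbols of `w⁻²|dx|²` in terms of the gradient of `ln w`. -/
theorem christoffel_conformal {n : ℕ} {w : E n → ℝ} {x : E n} (hw : DifferentiableAt ℝ w x)
    (h0 : w x ≠ 0) (m i j : Fin n) :
    christoffel (fun y => ((w y) ^ 2)⁻¹ • (1 : Matrix (Fin n) (Fin n) ℝ)) m i j x =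
      -(pd i w x / w x * (if j = m then 1 else 0) + pd j w x / w x * (if i = m then 1 else 0)
        - pd m w x / w x * (if i = j then 1 else 0)) := by
  have hp : ∀ i a b : Fin n, pd i (fun y => (((w y) ^ 2)⁻¹ • (1 : Matrix (Fin n) (Fin n) ℝ)) a b) x
      = -2 * (w x ^ 3)⁻¹ * pd i w x * (if a = b then 1 else 0) := by
    intro i a b
    have h1 : HasFDerivAt (fun y => ((w y) ^ 2)⁻¹ * (if a = b then (1 : ℝ) else 0))
        ((if a = b then (1 : ℝ) else 0) • (-((w x ^ 2) ^ 2)⁻¹ • ((2 * w x) • fderiv ℝ w x))) x := by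
      have h2 := (hw.hasFDerivAt.pow 2)
      have h3 := (hasDerivAt_inv (pow_ne_zero 2 h0)).comp_hasFDerivAt x h2
      have h4 := h3.mul_const (if a = b then (1 : ℝ) else 0)
      convert! h4 using 2
      simp
    have h5 := pd_eq h1 i
    simp only [Matrix.smul_apply, Matrix.one_apply, smul_eq_mul]
    rw [h5]
    simp only [FunLike.coe_smul, Pi.smul_apply, smul_eq_mul, pd]
    by_cases hab : a = b
    · simp only [hab, if_true]
      field_simp
    · simp [hab]
  have hinv : ((((w x) ^ 2)⁻¹ • (1 : Matrix (Fin n) (Fin n) ℝ))⁻¹) =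
      (w x ^ 2) • (1 : Matrix (Fin n) (Fin n) ℝ) := by
    apply Matrix.inv_eq_right_inv
    rw [Matrix.smul_mul, Matrix.mul_smul, smul_smul, Matrix.mul_one,
      inv_mul_cancel₀ (pow_ne_zero 2 h0), one_smul]
  unfold christoffel
  simp only [hp]
  simp only [hinv, Matrix.smul_apply, Matrix.one_apply, smul_eq_mul, mul_ite, mul_one, mul_zero,
    ite_mul, zero_mul, Finset.sum_ite_eq, Finset.mem_univ, if_true]
  split_ifs <;> field_simp <;> ring

/-! ### The Ricci tensor of a conformally flat metric -/

/-- The Ricci tensor of `w⁻²|dx|²`. The gradient of `ln w` enters as a vector field `a` of its own, so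
that second derivatives of `w` appear only through those of `a`. -/
theorem ricci_conformal {n : ℕ} {w : E n → ℝ} {x : E n} {a : Fin n → E n → ℝ}
    (hw : ∀ᶠ y in 𝓝 x, DifferentiableAt ℝ w y ∧ w y ≠ 0 ∧ ∀ i, pd i w y / w y = a i y)
    (ha : ∀ i, DifferentiableAt ℝ (a i) x) (hsymm : ∀ i j, pd j (a i) x = pd i (a j) x)
    (i j : Fin n) :
    ricci (fun y => ((w y) ^ 2)⁻¹ • (1 : Matrix (Fin n) (Fin n) ℝ)) x i j =
      ((n : ℝ) - 2) * (pd j (a i) x + a i x * a j x) +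
        (if i = j then 1 else 0) * (∑ m, pd m (a m) x - ((n : ℝ) - 2) * ∑ m, a m x ^ 2) := by
  have hG : ∀ m i j : Fin n, christoffel (fun y => ((w y) ^ 2)⁻¹ • (1 : Matrix (Fin n) (Fin n) ℝ))
      m i j =ᶠ[𝓝 x] fun y => -(a i y * (if j = m then 1 else 0) + a j y * (if i = m then 1 else 0)
        - a m y * (if i = j then 1 else 0)) := by
    intro m i j
    filter_upwards [hw] with y hy
    rw [christoffel_conformal hy.1 hy.2.1, hy.2.2, hy.2.2, hy.2.2]
  have hpG : ∀ l m i j : Fin n,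
      pd l (christoffel (fun y => ((w y) ^ 2)⁻¹ • (1 : Matrix (Fin n) (Fin n) ℝ)) m i j) x =
      -(pd l (a i) x * (if j = m then 1 else 0) + pd l (a j) x * (if i = m then 1 else 0)
        - pd l (a m) x * (if i = j then 1 else 0)) := by
    intro l m i j
    rw [pd_congr (hG m i j)]
    have h := ((((ha i).hasFDerivAt.mul_const (if j = m then (1 : ℝ) else 0)).add
      ((ha j).hasFDerivAt.mul_const (if i = m then (1 : ℝ) else 0))).sub
      ((ha m).hasFDerivAt.mul_const (if i = j then (1 : ℝ) else 0))).neg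
    refine (pd_eq h l).trans ?_
    simp only [pd, FunLike.coe_neg, Pi.neg_apply, FunLike.coe_sub, Pi.sub_apply, FunLike.coe_add,
      Pi.add_apply, FunLike.coe_smul, Pi.smul_apply, smul_eq_mul]
    ring
  have hGx : ∀ m i j : Fin n, christoffel (fun y => ((w y) ^ 2)⁻¹ •
      (1 : Matrix (Fin n) (Fin n) ℝ)) m i j x = -(a i x * (if j = m then 1 else 0) +
        a j x * (if i = m then 1 else 0) - a m x * (if i = j then 1 else 0)) :=
    fun m i j => (hG m i j).eq_of_nhds
  simp only [ricci, Matrix.of_apply, hpG, hGx]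
  simp only [mul_ite, mul_one, mul_zero, ite_mul, zero_mul, one_mul,
    add_mul, mul_add, sub_mul, mul_sub, Finset.sum_add_distrib, Finset.sum_sub_distrib,
    neg_sub, Finset.sum_ite_eq, Finset.sum_ite_eq',
    Finset.mem_univ, if_true, Finset.sum_const, Finset.card_univ, Fintype.card_fin, nsmul_eq_mul,
    sq]
  rw [hsymm j i]
  by_cases hij : i = j
  · subst hij
    simp [Finset.sum_add_distrib]
    ring
  · have hji : j ≠ i := fun h => hij h.symm
    simp [hij, hji, Finset.sum_add_distrib]
    ring

theorem hasFDerivAt_norm_of_ne_zero {n : ℕ} {x : E n} (hx : x ≠ 0) :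
    HasFDerivAt (fun y : E n => ‖y‖) ((‖x‖⁻¹) • innerSL ℝ x) x := by
  have h := (hasStrictFDerivAt_norm_sq x).hasFDerivAt.sqrt
    (pow_ne_zero 2 (norm_ne_zero_iff.mpr hx))
  simp only [Real.sqrt_sq (norm_nonneg _)] at h
  convert! h using 1
  ext y
  simp
  field_simp

theorem hasFDerivAt_radial {n : ℕ} {f : ℝ → ℝ} {f' : ℝ} {x : E n} (hx : x ≠ 0)
    (hf : HasDerivAt f f' ‖x‖) :
    HasFDerivAt (fun y : E n => f ‖y‖) ((f' * ‖x‖⁻¹) • innerSL ℝ x) x := by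
  have h := hf.comp_hasFDerivAt x (hasFDerivAt_norm_of_ne_zero hx)
  rwa [smul_smul] at h

theorem pd_radial {n : ℕ} {f : ℝ → ℝ} {f' : ℝ} {x : E n} (hx : x ≠ 0)
    (hf : HasDerivAt f f' ‖x‖) (i : Fin n) : pd i (fun y : E n => f ‖y‖) x = f' / ‖x‖ * x i := by
  rw [pd_eq (hasFDerivAt_radial hx hf)]
  simp only [FunLike.coe_smul, Pi.smul_apply, smul_eq_mul, innerSL_apply_apply,
    EuclideanSpace.inner_single_right]
  simp [div_eq_mul_inv]

/-! ### The Schouten tensor of a radial conformally flat metric -/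

/-- The Weyl-Schouten tensor of `w⁻²|dx|²` is `w⁻¹ ∇²w - w⁻² |∇w|² I / 2`; here `a = ∇ ln w`, hence
`w⁻¹ ∂ᵢ∂ⱼw = ∂ⱼaᵢ + aᵢaⱼ`. -/
theorem schouten_conformal {n : ℕ} (hn : 3 ≤ n) {w : E n → ℝ} {x : E n} {a : Fin n → E n → ℝ}
    (hw : ∀ᶠ y in 𝓝 x, DifferentiableAt ℝ w y ∧ w y ≠ 0 ∧ ∀ i, pd i w y / w y = a i y)
    (ha : ∀ i, DifferentiableAt ℝ (a i) x) (hsymm : ∀ i j, pd j (a i) x = pd i (a j) x)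
    (i j : Fin n) :
    schouten (fun y => ((w y) ^ 2)⁻¹ • (1 : Matrix (Fin n) (Fin n) ℝ)) x i j =
      pd j (a i) x + a i x * a j x - (if i = j then 1 else 0) * (∑ m, a m x ^ 2) / 2 := by
  have h0 : w x ≠ 0 := hw.self_of_nhds.2.1
  have hinv : ((((w x) ^ 2)⁻¹ • (1 : Matrix (Fin n) (Fin n) ℝ))⁻¹) =
      (w x ^ 2) • (1 : Matrix (Fin n) (Fin n) ℝ) := by
    apply Matrix.inv_eq_right_inv
    rw [Matrix.smul_mul, Matrix.mul_smul, smul_smul, Matrix.mul_one,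
      inv_mul_cancel₀ (pow_ne_zero 2 h0), one_smul]
  have hR : scalarCurv (fun y => ((w y) ^ 2)⁻¹ • (1 : Matrix (Fin n) (Fin n) ℝ)) x =
      w x ^ 2 * (2 * ((n : ℝ) - 1) * ∑ m, pd m (a m) x -
        ((n : ℝ) - 2) * ((n : ℝ) - 1) * ∑ m, a m x ^ 2) := by
    simp only [scalarCurv, ricci_conformal hw ha hsymm, hinv, Matrix.smul_apply, Matrix.one_apply,
      smul_eq_mul, mul_ite, ite_mul, zero_mul, mul_zero, mul_one, Finset.sum_ite_eq,
      Finset.mem_univ, if_true, one_mul]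
    rw [← Finset.mul_sum]
    congr 1
    rw [Finset.sum_add_distrib, ← Finset.mul_sum, Finset.sum_add_distrib, Finset.sum_const]
    simp only [← sq, Finset.card_univ, Fintype.card_fin, nsmul_eq_mul]
    ring
  have hn2 : (n : ℝ) - 2 ≠ 0 := by
    have : (3 : ℝ) ≤ n := by exact_mod_cast hn
    linarith
  have hn1 : (n : ℝ) - 1 ≠ 0 := by
    have : (3 : ℝ) ≤ n := by exact_mod_cast hn
    linarith
  simp only [schouten, Matrix.smul_apply, Matrix.sub_apply, ricci_conformal hw ha hsymm, hR,
    Matrix.one_apply, smul_eq_mul]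
  split_ifs
  · field_simp
    ring
  · field_simp
    ring

/-- The eigenvalue of `g⁻¹ A_g` on the tangent space of the sphere `|x| = r`, for
`g = v(|x|)⁻² |dx|²`, in terms of `v` and `v_r`. -/
noncomputable def tangentialEigenvalue (r v v₁ : ℝ) : ℝ := v * v₁ / r - v₁ ^ 2 / 2

/-- The eigenvalue of `g⁻¹ A_g` in the radial direction, for `g = v(|x|)⁻² |dx|²`, in terms of
`v`, `v_r` and `v_rr`. -/
noncomputable def radialEigenvalue (v v₁ v₂ : ℝ) : ℝ := v * v₂ - v₁ ^ 2 / 2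

/-- For a radial metric `g⁻¹ A_g` is a multiple of the identity plus a multiple of `x xᵀ`; it has a
tangential eigenvalue of multiplicity `n - 1` and a simple radial one. -/
theorem sigmaCurv_radialMetric {n : ℕ} (hn : 3 ≤ n) {v v₁ v₂ : ℝ → ℝ} {S : Set ℝ} (hS : IsOpen S)
    (hS0 : S ⊆ Ioi 0) (hpos : ∀ r ∈ S, 0 < v r) (h1 : ∀ r ∈ S, HasDerivAt v (v₁ r) r)
    (h2 : ∀ r ∈ S, HasDerivAt v₁ (v₂ r) r) {x : E n} (hx : ‖x‖ ∈ S) (j : ℕ) :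
    sigmaCurv (j + 1) (radialMetric n v) x =
      (n - 1).choose (j + 1) * tangentialEigenvalue ‖x‖ (v ‖x‖) (v₁ ‖x‖) ^ (j + 1) +
      radialEigenvalue (v ‖x‖) (v₁ ‖x‖) (v₂ ‖x‖) *
        ((n - 1).choose j * tangentialEigenvalue ‖x‖ (v ‖x‖) (v₁ ‖x‖) ^ j) := by
  have hr : 0 < ‖x‖ := hS0 hx
  have hx0 : ∀ y : E n, ‖y‖ ∈ S → y ≠ 0 := fun y hy => norm_pos_iff.mp (hS0 hy)
  have hnear : ∀ᶠ y in 𝓝 x, ‖y‖ ∈ S :=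
    (continuous_norm.continuousAt (x := x)).eventually (hS.mem_nhds hx)
  set a : Fin n → E n → ℝ := fun i y => (v₁ ‖y‖ / (v ‖y‖ * ‖y‖)) * y i with ha_def
  have hw : ∀ᶠ y in 𝓝 x, DifferentiableAt ℝ (fun y : E n => v ‖y‖) y ∧ v ‖y‖ ≠ 0 ∧
      ∀ i, pd i (fun y : E n => v ‖y‖) y / v ‖y‖ = a i y := by
    filter_upwards [hnear] with y hy
    refine ⟨(hasFDerivAt_radial (hx0 y hy) (h1 _ hy)).differentiableAt, (hpos _ hy).ne',
      fun i => ?_⟩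
    rw [pd_radial (hx0 y hy) (h1 _ hy)]
    simp only [ha_def]
    field_simp
  set r := ‖x‖ with hr_def
  have hv := hpos r hx
  set c' : ℝ := (v₂ r * (v r * r) - v₁ r * (v₁ r * r + v r)) / (v r * r) ^ 2 with hc'
  have hc : HasDerivAt (fun s => v₁ s / (v s * s)) c' r := by
    have h3 := (h2 r hx).div ((h1 r hx).mul (hasDerivAt_id r)) (mul_pos hv hr).ne'
    convert! h3 using 1
    simp [hc']
  have hda : ∀ i, HasFDerivAt (a i) ((v₁ r / (v r * r)) • (EuclideanSpace.proj (𝕜 := ℝ) i) +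
      (x i) • ((c' * r⁻¹) • innerSL ℝ x)) x := by
    intro i
    exact (hasFDerivAt_radial (hx0 x hx) hc).mul
      ((EuclideanSpace.proj (𝕜 := ℝ) i : E n →L[ℝ] ℝ).hasFDerivAt (x := x))
  have hpda : ∀ i j, pd j (a i) x = v₁ r / (v r * r) * (if i = j then 1 else 0) +
      c' / r * x i * x j := by
    intro i j
    rw [pd_eq (hda i)]
    simp only [FunLike.coe_smul, FunLike.coe_add, Pi.add_apply, Pi.smul_apply, smul_eq_mul,
      innerSL_apply_apply, EuclideanSpace.inner_single_right, PiLp.proj_apply]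
    simp
    ring
  have hsymm : ∀ i j, pd j (a i) x = pd i (a j) x := by
    intro i j
    rw [hpda, hpda]
    simp only [eq_comm (a := i) (b := j)]
    ring
  have hsum : ∑ m, (x m) ^ 2 = r ^ 2 := (EuclideanSpace.real_norm_sq_eq x).symm
  have hsa : ∑ m, a m x ^ 2 = (v₁ r / v r) ^ 2 := by
    simp only [ha_def, mul_pow]
    rw [← Finset.mul_sum, hsum]
    simp only [← hr_def]
    field_simp
  have hinv : ((((v r) ^ 2)⁻¹ • (1 : Matrix (Fin n) (Fin n) ℝ))⁻¹) =
      (v r ^ 2) • (1 : Matrix (Fin n) (Fin n) ℝ) := by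
    apply Matrix.inv_eq_right_inv
    rw [Matrix.smul_mul, Matrix.mul_smul, smul_smul, Matrix.mul_one,
      inv_mul_cancel₀ (pow_ne_zero 2 hv.ne'), one_smul]
  set b : ℝ := v r ^ 2 * (c' / r + (v₁ r / (v r * r)) ^ 2) with hb
  have hmat : (radialMetric n v x)⁻¹ * schouten (radialMetric n v) x =
      (tangentialEigenvalue r (v r) (v₁ r)) • (1 : Matrix (Fin n) (Fin n) ℝ) +
        Matrix.vecMulVec (fun i => b * x i) (fun i => x i) := by
    have e : (radialMetric n v x)⁻¹ = (v r ^ 2) • (1 : Matrix (Fin n) (Fin n) ℝ) := hinv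
    rw [e, Matrix.smul_mul, Matrix.one_mul]
    ext i j
    have := schouten_conformal hn hw (fun i => (hda i).differentiableAt) hsymm i j
    rw [Matrix.smul_apply, smul_eq_mul]
    erw [this]
    rw [hpda, hsa]
    simp only [ha_def, ← hr_def, Matrix.add_apply, Matrix.smul_apply, Matrix.one_apply,
      Matrix.vecMulVec_apply, smul_eq_mul, tangentialEigenvalue, hb]
    split_ifs <;> field_simp <;> ring
  rw [sigmaCurv, hmat, roots_charpoly_scalar_add_vecMulVec (by omega), esymm_cons_succ,
    esymm_replicate, esymm_replicate]
  congr 2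
  have hdot : (fun i => b * x i) ⬝ᵥ (fun i => x i) = b * r ^ 2 := by
    rw [← hsum, Finset.mul_sum]
    simp only [dotProduct]
    exact Finset.sum_congr rfl fun i _ => by ring
  rw [hdot, hb, hc', tangentialEigenvalue, radialEigenvalue]
  field_simp
  ring

/-! ### The equation in the logarithmic variable -/

/-- The acceleration `ξ_tt` that the equation `σ_k(A_g) = -2⁻ᵏ (n choose k)` prescribes at the phase
point `(ξ, ξ_t) = (x, y)`; it is singular on the two lines `y = ±1`. -/
noncomputable def accel (n k : ℕ) (x y : ℝ) : ℝ :=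
  (2 * k - n) / (2 * k) * (1 - y ^ 2) -
    n / (2 * k) * (Real.exp (-(2 * k) * x) / (1 - y ^ 2) ^ (k - 1))

/-- `t ↦ (ξ t, p t)` is a phase curve of the radial equation over the open interval `T`. -/
structure IsPhaseCurve (n k : ℕ) (ξ p : ℝ → ℝ) (T : Set ℝ) : Prop where
  isOpen : IsOpen T
  ordConnected : T.OrdConnected
  nonempty : T.Nonempty
  hasDerivAt_fst : ∀ t ∈ T, HasDerivAt ξ (p t) t
  hasDerivAt_snd : ∀ t ∈ T, HasDerivAt p (accel n k (ξ t) (p t)) t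
  sq_ne_one : ∀ t ∈ T, 1 - p t ^ 2 ≠ 0

theorem contDiffOn_two_of_hasDerivAt {v v₁ v₂ : ℝ → ℝ} {S : Set ℝ} (hS : IsOpen S)
    (h1 : ∀ r ∈ S, HasDerivAt v (v₁ r) r) (h2 : ∀ r ∈ S, HasDerivAt v₁ (v₂ r) r)
    (hc : ContinuousOn v₂ S) : ContDiffOn ℝ 2 v S := by
  have hd1 : EqOn (deriv v) v₁ S := fun r hr => (h1 r hr).deriv
  have hd2 : EqOn (deriv v₁) v₂ S := fun r hr => (h2 r hr).deriv
  have hv₁ : ContDiffOn ℝ 1 v₁ S := by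
    have := (contDiffOn_succ_iff_deriv_of_isOpen (𝕜 := ℝ) (n := 0) (f := v₁) hS).2
      ⟨fun r hr => (h2 r hr).differentiableAt.differentiableWithinAt, by simp,
        contDiffOn_zero.2 (hc.congr hd2)⟩
    simpa using this
  have := (contDiffOn_succ_iff_deriv_of_isOpen (𝕜 := ℝ) (n := 1) (f := v) hS).2
      ⟨fun r hr => (h1 r hr).differentiableAt.differentiableWithinAt, by simp, hv₁.congr hd1⟩
  rw [one_add_one_eq_two] at this
  exact this

theorem ContDiffOn.hasDerivAt_deriv_two {v : ℝ → ℝ} {S : Set ℝ} (hS : IsOpen S)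
    (h : ContDiffOn ℝ 2 v S) {r : ℝ} (hr : r ∈ S) :
    HasDerivAt v (deriv v r) r ∧ HasDerivAt (deriv v) (deriv (deriv v) r) r := by
  have h1 : ContDiffOn ℝ 1 (deriv v) S := h.deriv_of_isOpen hS (by norm_num [one_add_one_eq_two])
  exact ⟨((h.differentiableOn (by norm_num)).differentiableAt (hS.mem_nhds hr)).hasDerivAt,
    ((h1.differentiableOn (by norm_num)).differentiableAt (hS.mem_nhds hr)).hasDerivAt⟩

section Substitution

variable {ξ p a v : ℝ → ℝ} {T S : Set ℝ}

theorem hasDerivAt_of_log_variable (hT : IsOpen T) (hS : ∀ r, r ∈ S ↔ 0 < r ∧ Real.log r ∈ T)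
    (hξ : ∀ t ∈ T, HasDerivAt ξ (p t) t) (hv : ∀ r ∈ S, v r = r * Real.exp (ξ (Real.log r)))
    {r : ℝ} (hr : r ∈ S) :
    HasDerivAt v ((1 + p (Real.log r)) * Real.exp (ξ (Real.log r))) r := by
  have hr0 : 0 < r := ((hS r).1 hr).1
  have hSo : S ∈ 𝓝 r := by
    have h1 : ∀ᶠ s in 𝓝 r, 0 < s := lt_mem_nhds hr0
    have h2 : ∀ᶠ s in 𝓝 r, Real.log s ∈ T :=
      (Real.continuousAt_log hr0.ne').eventually (hT.mem_nhds ((hS r).1 hr).2)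
    filter_upwards [h1, h2] with s hs1 hs2 using (hS s).2 ⟨hs1, hs2⟩
  have h := (hasDerivAt_id r).mul
    (((hξ _ ((hS r).1 hr).2).comp r (Real.hasDerivAt_log hr0.ne')).exp)
  have h2 := h.congr_of_eventuallyEq (f₁ := v) (by
    filter_upwards [hSo] with s hs using hv s hs)
  convert! h2 using 1
  simp
  field_simp

theorem hasDerivAt_deriv_of_log_variable (hξ : ∀ t ∈ T, HasDerivAt ξ (p t) t)
    (hp : ∀ t ∈ T, HasDerivAt p (a t) t) {r : ℝ} (hr0 : 0 < r) (hr : Real.log r ∈ T) :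
    HasDerivAt (fun r => (1 + p (Real.log r)) * Real.exp (ξ (Real.log r)))
      ((a (Real.log r) + (1 + p (Real.log r)) * p (Real.log r)) *
        Real.exp (ξ (Real.log r) - Real.log r)) r := by
  have h := (((hp _ hr).comp r (Real.hasDerivAt_log hr0.ne')).const_add 1).mul
    (((hξ _ hr).comp r (Real.hasDerivAt_log hr0.ne')).exp)
  convert! h using 1
  rw [Real.exp_sub, Real.exp_log hr0]
  simp
  field_simp

/-- In terms of `ξ(t)` the eigenvalues of `g⁻¹ A_g` are `e^{2ξ}(1 - ξ_t²)/2` (tangential) and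
`e^{2ξ}(ξ_tt - (1 - ξ_t²)/2)` (radial). -/
theorem sigmaCurv_log_variable {n : ℕ} (hn : 3 ≤ n) (hT : IsOpen T)
    (hS : ∀ r, r ∈ S ↔ 0 < r ∧ Real.log r ∈ T)
    (hξ : ∀ t ∈ T, HasDerivAt ξ (p t) t) (hp : ∀ t ∈ T, HasDerivAt p (a t) t)
    (hv : ∀ r ∈ S, v r = r * Real.exp (ξ (Real.log r))) {x : E n} (hx : ‖x‖ ∈ S) {t : ℝ}
    (ht : t = Real.log ‖x‖) (j : ℕ) :
    sigmaCurv (j + 1) (radialMetric n v) x =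
      (n - 1).choose (j + 1) * (Real.exp (2 * ξ t) * (1 - p t ^ 2) / 2) ^ (j + 1) +
      Real.exp (2 * ξ t) * (a t - (1 - p t ^ 2) / 2) *
        ((n - 1).choose j * (Real.exp (2 * ξ t) * (1 - p t ^ 2) / 2) ^ j) := by
  have hSo : IsOpen S := by
    rw [isOpen_iff_mem_nhds]
    intro r hr
    have h1 : ∀ᶠ s in 𝓝 r, 0 < s := lt_mem_nhds ((hS r).1 hr).1
    have h2 : ∀ᶠ s in 𝓝 r, Real.log s ∈ T :=
      (Real.continuousAt_log ((hS r).1 hr).1.ne').eventually (hT.mem_nhds ((hS r).1 hr).2)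
    filter_upwards [h1, h2] with s hs1 hs2 using (hS s).2 ⟨hs1, hs2⟩
  have hr0 := ((hS _).1 hx).1
  rw [sigmaCurv_radialMetric hn hSo (fun r hr => ((hS r).1 hr).1)
    (fun r hr => by rw [hv r hr]; exact mul_pos ((hS r).1 hr).1 (Real.exp_pos _))
    (fun r hr => hasDerivAt_of_log_variable hT hS hξ hv hr)
    (fun r hr => hasDerivAt_deriv_of_log_variable hξ hp ((hS r).1 hr).1 ((hS r).1 hr).2) hx]
  have e1 : tangentialEigenvalue ‖x‖ (v ‖x‖) ((1 + p (Real.log ‖x‖)) * Real.exp (ξ (Real.log ‖x‖)))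
      = Real.exp (2 * ξ t) * (1 - p t ^ 2) / 2 := by
    rw [tangentialEigenvalue, hv _ hx, ← ht, two_mul, Real.exp_add]
    field_simp
    ring
  have e2 : radialEigenvalue (v ‖x‖) ((1 + p (Real.log ‖x‖)) * Real.exp (ξ (Real.log ‖x‖)))
      ((a (Real.log ‖x‖) + (1 + p (Real.log ‖x‖)) * p (Real.log ‖x‖)) *
        Real.exp (ξ (Real.log ‖x‖) - Real.log ‖x‖))
      = Real.exp (2 * ξ t) * (a t - (1 - p t ^ 2) / 2) := by
    rw [radialEigenvalue, hv _ hx, Real.exp_sub, Real.exp_log hr0, ← ht, two_mul, Real.exp_add]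
    field_simp
    ring
  rw [e1, e2]

end Substitution

theorem natCast_mul_choose_pred {n j : ℕ} (hn : 1 ≤ n) :
    (n : ℝ) * (n - 1).choose j = (j + 1) * n.choose (j + 1) ∧
    (n : ℝ) * (n - 1).choose (j + 1) = (n - (j + 1)) * n.choose (j + 1) := by
  obtain ⟨m, rfl⟩ : ∃ m, n = m + 1 := ⟨n - 1, by omega⟩
  have h1 : ((m + 1 : ℕ) : ℝ) * m.choose j = ((m + 1).choose (j + 1) : ℕ) * ((j + 1 : ℕ) : ℝ) := by
    exact_mod_cast Nat.add_one_mul_choose_eq m j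
  have h2 : (((m + 1).choose (j + 1) : ℕ) : ℝ) = m.choose j + m.choose (j + 1) := by
    exact_mod_cast Nat.choose_succ_succ m j
  simp only [Nat.add_sub_cancel]
  push_cast at *
  constructor
  · linarith
  · rw [h2] at h1 ⊢
    linarith

/-- The equation `σ_k = -2⁻ᵏ (n choose k)` in the variables `q = 1 - ξ_t²` and `a = ξ_tt`. The
factor `q ^ (k - 1)` cannot vanish because `k > 1`. -/
theorem sigma_equation_iff {n k : ℕ} (hn : 3 ≤ n) (hk : 1 < k) (hkn : k ≤ n) (x y a : ℝ) :
    ((n - 1).choose k * (Real.exp (2 * x) * (1 - y ^ 2) / 2) ^ k +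
      Real.exp (2 * x) * (a - (1 - y ^ 2) / 2) *
        ((n - 1).choose (k - 1) * (Real.exp (2 * x) * (1 - y ^ 2) / 2) ^ (k - 1)) =
      -((2 : ℝ) ^ k)⁻¹ * (n.choose k : ℝ)) ↔ 1 - y ^ 2 ≠ 0 ∧ a = accel n k x y := by
  obtain ⟨j, rfl⟩ : ∃ j, k = j + 1 := ⟨k - 1, by omega⟩
  have hj : j ≠ 0 := by omega
  obtain ⟨c1, c2⟩ := natCast_mul_choose_pred (n := n) (j := j) (by omega)
  have hC : (0 : ℝ) < n.choose (j + 1) := by exact_mod_cast Nat.choose_pos hkn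
  have hN : (0 : ℝ) < n := by exact_mod_cast (by omega : 0 < n)
  have hJ : (0 : ℝ) < (j : ℝ) + 1 := by positivity
  simp only [Nat.add_sub_cancel, accel]
  generalize 1 - y ^ 2 = q
  set e := Real.exp (2 * x) with he
  have hepos : 0 < e := Real.exp_pos _
  have hexp : Real.exp (-(2 * ((j + 1 : ℕ) : ℝ)) * x) = (e ^ (j + 1))⁻¹ := by
    rw [he, ← Real.exp_nat_mul, ← Real.exp_neg]
    congr 1
    push_cast
    ring
  have d1 : ((n - 1).choose j : ℝ) = (j + 1) * n.choose (j + 1) / n := by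
    field_simp; linarith
  have d2 : ((n - 1).choose (j + 1) : ℝ) = (n - (j + 1)) * n.choose (j + 1) / n := by
    field_simp; linarith
  have key : ((n - 1).choose (j + 1) * (e * q / 2) ^ (j + 1) + e * (a - q / 2) *
        ((n - 1).choose j * (e * q / 2) ^ j)) =
      ((2 : ℝ) ^ (j + 1))⁻¹ * n.choose (j + 1) *
        (e ^ (j + 1) * q ^ j * ((n - 2 * (j + 1)) * q + 2 * (j + 1) * a) / n) := by
    rw [d1, d2]
    simp only [div_pow, mul_pow, pow_succ]
    field_simp
    ring
  rw [key, hexp]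
  have h2 : (0 : ℝ) < ((2 : ℝ) ^ (j + 1))⁻¹ := by positivity
  have : -((2 : ℝ) ^ (j + 1))⁻¹ * (n.choose (j + 1) : ℝ) =
    ((2 : ℝ) ^ (j + 1))⁻¹ * n.choose (j + 1) * (-1) := by ring
  rw [this, mul_right_inj' (mul_pos h2 hC).ne']
  constructor
  · intro h
    have hq : q ≠ 0 := by
      intro h0
      rw [h0, zero_pow hj] at h
      simp at h
    refine ⟨hq, ?_⟩
    push_cast
    have hqj : q ^ j ≠ 0 := pow_ne_zero _ hq
    have hej : e ^ (j + 1) ≠ 0 := pow_ne_zero _ hepos.ne'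
    field_simp at h ⊢
    linear_combination h
  · rintro ⟨hq, ha⟩
    rw [ha]
    have hqj : q ^ j ≠ 0 := pow_ne_zero _ hq
    have hej : e ^ (j + 1) ≠ 0 := pow_ne_zero _ hepos.ne'
    push_cast
    field_simp
    ring

/-! ### Radial solutions and phase curves -/

/-- The set of radii `r = eᵗ`, `t ∈ T`. -/
def radii (T : Set ℝ) : Set ℝ := {r | 0 < r ∧ Real.log r ∈ T}

theorem mem_radii {T : Set ℝ} {r : ℝ} : r ∈ radii T ↔ 0 < r ∧ Real.log r ∈ T := Iff.rfl

theorem exp_mem_radii {T : Set ℝ} {t : ℝ} : Real.exp t ∈ radii T ↔ t ∈ T := by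
  simp [radii, Real.exp_pos]

theorem radii_preimage_exp {S : Set ℝ} (hS : S ⊆ Ioi 0) : radii (Real.exp ⁻¹' S) = S := by
  ext r
  constructor
  · rintro ⟨h0, h⟩
    rwa [mem_preimage, Real.exp_log h0] at h
  · intro h
    have h0 : 0 < r := hS h
    exact ⟨h0, by rwa [mem_preimage, Real.exp_log h0]⟩

theorem isOpen_radii {T : Set ℝ} (hT : IsOpen T) : IsOpen (radii T) := by
  rw [isOpen_iff_mem_nhds]
  intro r hr
  have h1 : ∀ᶠ s in 𝓝 r, 0 < s := lt_mem_nhds hr.1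
  have h2 : ∀ᶠ s in 𝓝 r, Real.log s ∈ T :=
    (Real.continuousAt_log hr.1.ne').eventually (hT.mem_nhds hr.2)
  filter_upwards [h1, h2] with s hs1 hs2 using ⟨hs1, hs2⟩

theorem ordConnected_radii {T : Set ℝ} (hT : T.OrdConnected) : (radii T).OrdConnected := by
  refine ⟨fun a ha b hb r hr => ?_⟩
  have hr0 : 0 < r := ha.1.trans_le hr.1
  exact ⟨hr0, hT.out ha.2 hb.2 ⟨Real.log_le_log ha.1 hr.1, Real.log_le_log hr0 hr.2⟩⟩

theorem eq_mul_exp_xi {v : ℝ → ℝ} {r : ℝ} (hr : 0 < r) (hv : 0 < v r) :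
    v r = r * Real.exp (xi v (Real.log r)) := by
  rw [xi, Real.exp_log hr, Real.exp_sub, Real.exp_log hr, Real.exp_log hv]
  field_simp

theorem exists_euclidean_norm_eq {n : ℕ} (hn : 3 ≤ n) {r : ℝ} (hr : 0 < r) : ∃ x : E n, ‖x‖ = r :=
  ⟨EuclideanSpace.single ⟨0, by omega⟩ r, by simp [abs_of_pos hr]⟩

theorem hasDerivAt_xi {v : ℝ → ℝ} {S : Set ℝ} (hS : IsOpen S) (hv : ContDiffOn ℝ 2 v S)
    (hpos : ∀ r ∈ S, 0 < v r) {t : ℝ} (ht : Real.exp t ∈ S) :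
    HasDerivAt (xi v) (xit v t) t ∧ HasDerivAt (xit v) (xitt v t) t := by
  have h1 : ∀ t, Real.exp t ∈ S →
      HasDerivAt (xi v) (deriv v (Real.exp t) * Real.exp t / v (Real.exp t) - 1) t := by
    intro t ht
    exact (((ContDiffOn.hasDerivAt_deriv_two hS hv ht).1.comp t (Real.hasDerivAt_exp t)).log
      (hpos _ ht).ne').sub (hasDerivAt_id t)
  have h2 : xit v =ᶠ[𝓝 t] fun t => deriv v (Real.exp t) * Real.exp t / v (Real.exp t) - 1 := by
    have : ∀ᶠ s in 𝓝 t, Real.exp s ∈ S :=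
      Real.continuous_exp.continuousAt.eventually (hS.mem_nhds ht)
    filter_upwards [this] with s hs using (h1 s hs).deriv
  have hd := ContDiffOn.hasDerivAt_deriv_two hS hv ht
  have h3 : DifferentiableAt ℝ (xit v) t := by
    refine DifferentiableAt.congr_of_eventuallyEq ?_ h2
    have ha := (hd.2.comp t (Real.hasDerivAt_exp t)).differentiableAt
    have hb := (hd.1.comp t (Real.hasDerivAt_exp t)).differentiableAt
    exact ((ha.mul Real.differentiableAt_exp).div hb (hpos _ ht).ne').sub_const 1
  exact ⟨(h1 t ht).differentiableAt.hasDerivAt, h3.hasDerivAt⟩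

section

variable {n k : ℕ} {v ξ p : ℝ → ℝ} {S T : Set ℝ}

/-- Radial solutions give phase curves; the converse is `IsPhaseCurve.isRadialSolution`. -/
theorem isPhaseCurve_of_isRadialSolution (hn : 3 ≤ n) (hk : 1 < k) (hkn : k ≤ n)
    (h : IsRadialSolution n k v S) : IsPhaseCurve n k (xi v) (xit v) (Real.exp ⁻¹' S) := by
  have hT : IsOpen (Real.exp ⁻¹' S) := h.isOpen.preimage Real.continuous_exp
  have hd := fun t (ht : t ∈ Real.exp ⁻¹' S) => hasDerivAt_xi h.isOpen h.contDiffOn h.pos ht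
  have key : ∀ t ∈ Real.exp ⁻¹' S, 1 - xit v t ^ 2 ≠ 0 ∧
      xitt v t = accel n k (xi v t) (xit v t) := by
    intro t ht
    obtain ⟨x, hx⟩ := exists_euclidean_norm_eq hn (Real.exp_pos t)
    have hxS : ‖x‖ ∈ S := by rw [hx]; exact ht
    rw [← sigma_equation_iff hn hk hkn, ← h.eqn x hxS]
    obtain ⟨j, rfl⟩ : ∃ j, k = j + 1 := ⟨k - 1, by omega⟩
    rw [sigmaCurv_log_variable (S := S) hn hT (fun r => by rw [← mem_radii,
      radii_preimage_exp h.subset_pos]) (fun t ht => (hd t ht).1) (fun t ht => (hd t ht).2)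
      (fun r hr => eq_mul_exp_xi (h.subset_pos hr) (h.pos r hr)) hxS (t := t)
      (by rw [hx, Real.log_exp]) j]
    rfl
  refine ⟨hT, h.ordConnected.preimage_mono Real.exp_monotone, ?_, fun t ht => (hd t ht).1,
    fun t ht => ?_, fun t ht => (key t ht).1⟩
  · obtain ⟨r, hr⟩ := h.nonempty
    exact ⟨Real.log r, by rwa [mem_preimage, Real.exp_log (h.subset_pos hr)]⟩
  · rw [← (key t ht).2]
    exact (hd t ht).2

theorem IsPhaseCurve.continuousOn_accel (h : IsPhaseCurve n k ξ p T) :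
    ContinuousOn (fun t => accel n k (ξ t) (p t)) T := by
  have h1 : ContinuousOn ξ T := fun t ht => (h.hasDerivAt_fst t ht).continuousAt.continuousWithinAt
  have h2 : ContinuousOn p T := fun t ht => (h.hasDerivAt_snd t ht).continuousAt.continuousWithinAt
  unfold accel
  have h3 : ContinuousOn (fun t => 1 - p t ^ 2) T := continuousOn_const.sub (h2.pow 2)
  exact (continuousOn_const.mul h3).sub (continuousOn_const.mul
    ((continuousOn_const.mul h1).rexp.div (h3.pow _)
      fun t ht => pow_ne_zero _ (h.sq_ne_one t ht)))

theorem IsPhaseCurve.isRadialSolution (hn : 3 ≤ n) (hk : 1 < k) (hkn : k ≤ n)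
    (h : IsPhaseCurve n k ξ p T) (hv : ∀ r ∈ radii T, v r = r * Real.exp (ξ (Real.log r))) :
    IsRadialSolution n k v (radii T) := by
  refine ⟨isOpen_radii h.isOpen, ordConnected_radii h.ordConnected, ?_, fun r hr => hr.1, ?_, ?_,
    ?_⟩
  · obtain ⟨t, ht⟩ := h.nonempty
    exact ⟨Real.exp t, exp_mem_radii.2 ht⟩
  · refine contDiffOn_two_of_hasDerivAt (isOpen_radii h.isOpen)
      (fun r hr => hasDerivAt_of_log_variable h.isOpen (fun r => mem_radii) h.hasDerivAt_fst hv hr)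
      (fun r hr => hasDerivAt_deriv_of_log_variable h.hasDerivAt_fst h.hasDerivAt_snd hr.1 hr.2) ?_
    have hl : ContinuousOn Real.log (radii T) := fun r hr =>
      (Real.continuousAt_log hr.1.ne').continuousWithinAt
    have hm : MapsTo Real.log (radii T) T := fun r hr => hr.2
    have h1 : ContinuousOn ξ T :=
      fun t ht => (h.hasDerivAt_fst t ht).continuousAt.continuousWithinAt
    have h2 : ContinuousOn p T :=
      fun t ht => (h.hasDerivAt_snd t ht).continuousAt.continuousWithinAt
    have h3 := h.continuousOn_accel.comp hl hm
    have h4 := h1.comp hl hm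
    have h5 := h2.comp hl hm
    exact (h3.add ((continuousOn_const.add h5).mul h5)).mul (h4.sub hl).rexp
  · intro r hr
    rw [hv r hr]
    exact mul_pos hr.1 (Real.exp_pos _)
  · intro x hx
    obtain ⟨j, rfl⟩ : ∃ j, k = j + 1 := ⟨k - 1, by omega⟩
    rw [sigmaCurv_log_variable hn h.isOpen (fun r => mem_radii) h.hasDerivAt_fst h.hasDerivAt_snd hv
      hx rfl]
    exact (sigma_equation_iff hn hk hkn _ _ _).2 ⟨h.sq_ne_one _ hx.2, rfl⟩

theorem accel_neg (x y : ℝ) : accel n k x (-y) = accel n k x y := by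
  simp [accel]

theorem IsPhaseCurve.reflect (h : IsPhaseCurve n k ξ p T) :
    IsPhaseCurve n k (fun t => ξ (-t)) (fun t => -p (-t)) (Neg.neg ⁻¹' T) := by
  refine ⟨h.isOpen.preimage continuous_neg, ⟨fun a ha b hb t ht => ?_⟩, ?_, fun t ht => ?_,
    fun t ht => ?_, fun t ht => ?_⟩
  · exact h.ordConnected.out hb ha ⟨neg_le_neg ht.2, neg_le_neg ht.1⟩
  · obtain ⟨t, ht⟩ := h.nonempty
    exact ⟨-t, by simpa using ht⟩
  · have := (h.hasDerivAt_fst _ ht).comp t (hasDerivAt_neg t)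
    rwa [mul_neg_one] at this
  · have := ((h.hasDerivAt_snd _ ht).comp t (hasDerivAt_neg t)).neg
    rwa [mul_neg_one, neg_neg, ← accel_neg] at this
  · have := h.sq_ne_one _ ht
    simpa using this

/-- A phase curve that admits no extension to a larger interval. -/
def IsMaximalPhaseCurve (n k : ℕ) (ξ p : ℝ → ℝ) (T : Set ℝ) : Prop :=
  IsPhaseCurve n k ξ p T ∧
    ∀ (η ρ : ℝ → ℝ) (U : Set ℝ), IsPhaseCurve n k η ρ U → T ⊆ U → EqOn ξ η T → U = T

theorem preimage_neg_preimage_neg (T : Set ℝ) : Neg.neg ⁻¹' (Neg.neg ⁻¹' T) = T := by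
  ext t; simp

theorem IsMaximalPhaseCurve.reflect (h : IsMaximalPhaseCurve n k ξ p T) :
    IsMaximalPhaseCurve n k (fun t => ξ (-t)) (fun t => -p (-t)) (Neg.neg ⁻¹' T) := by
  refine ⟨h.1.reflect, fun η ρ U hU hTU hEq => ?_⟩
  have := h.2 _ _ _ hU.reflect (fun t ht => hTU (by simpa using ht)) (fun t ht => by
    have := hEq (x := -t) (by simpa using ht)
    simpa using this)
  rw [← this, preimage_neg_preimage_neg]

theorem isMaximalPhaseCurve_of_isMaximalRadialSolution (hn : 3 ≤ n) (hk : 1 < k) (hkn : k ≤ n)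
    (h : IsMaximalRadialSolution n k v S) :
    IsMaximalPhaseCurve n k (xi v) (xit v) (Real.exp ⁻¹' S) := by
  refine ⟨isPhaseCurve_of_isRadialSolution hn hk hkn h.1, fun η ρ U hU hTU hEq => ?_⟩
  have hsol := hU.isRadialSolution (v := fun r => r * Real.exp (η (Real.log r))) hn hk hkn
    (fun r _ => rfl)
  have hSU : S ⊆ radii U := by
    rw [← radii_preimage_exp h.1.subset_pos]
    exact fun r hr => ⟨hr.1, hTU hr.2⟩
  have := h.2 _ _ hsol hSU (fun r hr => by
    have hr0 := h.1.subset_pos hr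
    rw [eq_mul_exp_xi hr0 (h.1.pos r hr), hEq (x := Real.log r) (by
      rwa [mem_preimage, Real.exp_log hr0])])
  rw [← this]
  ext t
  exact exp_mem_radii.symm

theorem xi_inversion {v : ℝ → ℝ} {t : ℝ} (h : 0 < v (Real.exp (-t))) :
    xi (inversion v) t = xi v (-t) := by
  rw [xi, xi, inversion, ← Real.exp_neg, Real.log_mul (by positivity) h.ne', Real.log_pow,
    Real.log_exp]
  push_cast
  ring

theorem IsRadialSolution.inversion (hn : 3 ≤ n) (hk : 1 < k) (hkn : k ≤ n)
    (h : IsRadialSolution n k v S) :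
    IsRadialSolution n k (inversion v) {r : ℝ | r⁻¹ ∈ S} := by
  have h1 := (isPhaseCurve_of_isRadialSolution hn hk hkn h).reflect
  have e : radii (Neg.neg ⁻¹' (Real.exp ⁻¹' S)) = {r : ℝ | r⁻¹ ∈ S} := by
    ext r
    constructor
    · rintro ⟨h0, hr⟩
      rwa [mem_preimage, mem_preimage, Real.exp_neg, Real.exp_log h0] at hr
    · intro hr
      have h0 : 0 < r := inv_pos.1 (h.subset_pos hr)
      exact ⟨h0, by rwa [mem_preimage, mem_preimage, Real.exp_neg, Real.exp_log h0]⟩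
  rw [← e]
  refine h1.isRadialSolution hn hk hkn fun r hr => ?_
  rw [e] at hr
  have h0 : 0 < r := inv_pos.1 (h.subset_pos hr)
  rw [SigmaK.inversion, eq_mul_exp_xi (h.subset_pos hr) (h.pos _ hr), Real.log_inv]
  field_simp

theorem IsMaximalRadialSolution.inversion (hn : 3 ≤ n) (hk : 1 < k) (hkn : k ≤ n)
    (h : IsMaximalRadialSolution n k v S) :
    IsMaximalRadialSolution n k (inversion v) {r : ℝ | r⁻¹ ∈ S} := by
  refine ⟨IsRadialSolution.inversion hn hk hkn h.1, fun w U hU hSU hEq => ?_⟩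
  have := h.2 _ _ (IsRadialSolution.inversion hn hk hkn hU)
    (fun r hr => hSU (by simpa using hr)) (fun r hr => by
      have hr0 : 0 < r := h.1.subset_pos hr
      have h1 := hEq (x := r⁻¹) (by simpa using hr)
      rw [SigmaK.inversion, ← h1, SigmaK.inversion, inv_inv]
      field_simp)
  rw [← this]
  ext r
  simp

end

/-! ### Uniqueness and greatest extensions of phase curves -/

/-- The vector field on the phase plane whose integral curves are the phase curves. -/
noncomputable def phaseField (n k : ℕ) (z : ℝ × ℝ) : ℝ × ℝ := (z.2, accel n k z.1 z.2)

theorem contDiffAt_phaseField (n k : ℕ) {z : ℝ × ℝ} (hz : 1 - z.2 ^ 2 ≠ 0) :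
    ContDiffAt ℝ 1 (phaseField n k) z := by
  unfold phaseField accel
  have h : ContDiffAt ℝ 1 (fun z : ℝ × ℝ => 1 - z.2 ^ 2) z := by fun_prop
  refine contDiffAt_snd.prodMk (ContDiffAt.sub (by fun_prop) (contDiffAt_const.mul
    (ContDiffAt.div (by fun_prop) (h.pow _) (pow_ne_zero _ hz))))

section

variable {n k : ℕ} {ξ p η ρ : ℝ → ℝ} {T U : Set ℝ}

theorem IsPhaseCurve.hasDerivAt_prod (h : IsPhaseCurve n k ξ p T) {t : ℝ} (ht : t ∈ T) :
    HasDerivAt (fun t => (ξ t, p t)) (phaseField n k (ξ t, p t)) t :=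
  (h.hasDerivAt_fst t ht).prodMk (h.hasDerivAt_snd t ht)

/-- Uniqueness: phase curves that agree at one time agree as long as both exist. -/
theorem IsPhaseCurve.eqOn_inter (h₁ : IsPhaseCurve n k ξ p T) (h₂ : IsPhaseCurve n k η ρ U) {t₀ : ℝ}
    (ht₀ : t₀ ∈ T ∩ U) (hξ : ξ t₀ = η t₀) (hp : p t₀ = ρ t₀) :
    EqOn ξ η (T ∩ U) ∧ EqOn p ρ (T ∩ U) := by
  have hpre : IsPreconnected (T ∩ U) := (h₁.ordConnected.inter h₂.ordConnected).isPreconnected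
  have hopen : IsOpen (T ∩ U) := h₁.isOpen.inter h₂.isOpen
  have hu : IsOpen {t | t ∈ T ∩ U ∧ (ξ t, p t) = (η t, ρ t)} := by
    rw [isOpen_iff_mem_nhds]
    rintro t ⟨ht, he⟩
    obtain ⟨K, s, hs, hL⟩ := (contDiffAt_phaseField n k (z := (ξ t, p t))
      (h₁.sq_ne_one t ht.1)).exists_lipschitzOnWith
    have e1 : ∀ᶠ r in 𝓝 t, r ∈ T ∩ U := hopen.mem_nhds ht
    have e2 : ∀ᶠ r in 𝓝 t, (ξ r, p r) ∈ s :=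
      (h₁.hasDerivAt_prod ht.1).continuousAt.eventually hs
    have e3 : ∀ᶠ r in 𝓝 t, (η r, ρ r) ∈ s :=
      (h₂.hasDerivAt_prod ht.2).continuousAt.eventually (show ∀ᶠ y in 𝓝 (η t, ρ t), y ∈ s by
        rw [← he]; exact hs)
    have := ODE_solution_unique_of_eventually (v := fun _ => phaseField n k) (s := fun _ => s)
      (K := K) (f := fun t => (ξ t, p t)) (g := fun t => (η t, ρ t)) (t₀ := t)
      (Eventually.of_forall fun _ => hL)
      (by filter_upwards [e1, e2] with r h1 h2 using ⟨h₁.hasDerivAt_prod h1.1, h2⟩)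
      (by filter_upwards [e1, e3] with r h1 h2 using ⟨h₂.hasDerivAt_prod h1.2, h2⟩) he
    filter_upwards [e1, this] with r h1 h2 using ⟨h1, h2⟩
  have hv : IsOpen {t | t ∈ T ∩ U ∧ (ξ t, p t) ≠ (η t, ρ t)} := by
    rw [isOpen_iff_mem_nhds]
    rintro t ⟨ht, he⟩
    have hc := ((h₁.hasDerivAt_prod ht.1).continuousAt.sub
      (h₂.hasDerivAt_prod ht.2).continuousAt).eventually_ne (sub_ne_zero.2 he)
    filter_upwards [hopen.mem_nhds ht, hc] with r h1 h2 using ⟨h1, sub_ne_zero.1 h2⟩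
  have hsub := hpre.subset_left_of_subset_union hu hv
    (by rw [Set.disjoint_left]; rintro t ⟨_, h1⟩ ⟨_, h2⟩; exact h2 h1)
    (fun t ht => by
      by_cases h : (ξ t, p t) = (η t, ρ t)
      · exact Or.inl ⟨ht, h⟩
      · exact Or.inr ⟨ht, h⟩)
    ⟨t₀, ht₀, ht₀, by rw [hξ, hp]⟩
  exact ⟨fun t ht => (Prod.mk.inj (hsub ht).2).1, fun t ht => (Prod.mk.inj (hsub ht).2).2⟩

theorem IsPhaseCurve.eqOn_snd (h₁ : IsPhaseCurve n k ξ p T) (h₂ : IsPhaseCurve n k η ρ U)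
    (hTU : T ⊆ U) (h : EqOn ξ η T) : EqOn p ρ T := fun t ht =>
  ((h₁.hasDerivAt_fst t ht).congr_of_eventuallyEq (by
    filter_upwards [h₁.isOpen.mem_nhds ht] with s hs using (h hs).symm)).unique
    (h₂.hasDerivAt_fst t (hTU ht))

/-- The union of all extensions of a phase curve is its greatest extension. -/
theorem IsPhaseCurve.exists_greatest_extension (h : IsPhaseCurve n k ξ p T) :
    ∃ (η ρ : ℝ → ℝ) (U : Set ℝ), IsPhaseCurve n k η ρ U ∧ T ⊆ U ∧ EqOn ξ η T ∧
      ∀ (η' ρ' : ℝ → ℝ) (U' : Set ℝ), IsPhaseCurve n k η' ρ' U' → T ⊆ U' → EqOn ξ η' T →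
        U' ⊆ U ∧ EqOn η' η U' := by
  classical
  let F : Set ((ℝ → ℝ) × (ℝ → ℝ) × Set ℝ) :=
    {x | IsPhaseCurve n k x.1 x.2.1 x.2.2 ∧ T ⊆ x.2.2 ∧ EqOn ξ x.1 T}
  obtain ⟨t₀, ht₀⟩ := h.nonempty
  have agree : ∀ x ∈ F, ∀ y ∈ F, ∀ t ∈ x.2.2, t ∈ y.2.2 → x.1 t = y.1 t ∧ x.2.1 t = y.2.1 t := by
    intro x hx y hy t htx hty
    have := hx.1.eqOn_inter hy.1 ⟨hx.2.1 ht₀, hy.2.1 ht₀⟩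
      ((hx.2.2 ht₀).symm.trans (hy.2.2 ht₀))
      ((h.eqOn_snd hx.1 hx.2.1 hx.2.2 ht₀).symm.trans (h.eqOn_snd hy.1 hy.2.1 hy.2.2 ht₀))
    exact ⟨this.1 ⟨htx, hty⟩, this.2 ⟨htx, hty⟩⟩
  have hself : (ξ, p, T) ∈ F := ⟨h, Subset.rfl, fun _ _ => rfl⟩
  let η : ℝ → ℝ := fun t => if ht : ∃ x ∈ F, t ∈ x.2.2 then ht.choose.1 t else 0
  let ρ : ℝ → ℝ := fun t => if ht : ∃ x ∈ F, t ∈ x.2.2 then ht.choose.2.1 t else 0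
  have hval : ∀ x ∈ F, ∀ t ∈ x.2.2, x.1 t = η t ∧ x.2.1 t = ρ t := by
    intro x hx t ht
    have hex : ∃ x ∈ F, t ∈ x.2.2 := ⟨x, hx, ht⟩
    have := agree x hx _ hex.choose_spec.1 t ht hex.choose_spec.2
    simp only [η, ρ, dif_pos hex]
    exact this
  have hpre : IsPreconnected (⋃ x ∈ F, x.2.2) := by
    have := isPreconnected_sUnion t₀ ((fun x : (ℝ → ℝ) × (ℝ → ℝ) × Set ℝ => x.2.2) '' F)
      (by rintro _ ⟨x, hx, rfl⟩; exact hx.2.1 ht₀)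
      (by rintro _ ⟨x, hx, rfl⟩; exact hx.1.ordConnected.isPreconnected)
    rwa [sUnion_image] at this
  refine ⟨η, ρ, ⋃ x ∈ F, x.2.2, ⟨isOpen_biUnion fun x hx => hx.1.isOpen, hpre.ordConnected,
    ⟨t₀, mem_biUnion hself ht₀⟩, ?_, ?_, ?_⟩, fun t ht => mem_biUnion hself ht,
    fun t ht => (hval _ hself t ht).1, ?_⟩
  · intro t ht
    obtain ⟨x, hx, htx⟩ := mem_iUnion₂.1 ht
    have := (hx.1.hasDerivAt_fst t htx).congr_of_eventuallyEq (f₁ := η) (by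
      filter_upwards [hx.1.isOpen.mem_nhds htx] with s hs using (hval x hx s hs).1.symm)
    rwa [(hval x hx t htx).2] at this
  · intro t ht
    obtain ⟨x, hx, htx⟩ := mem_iUnion₂.1 ht
    have := (hx.1.hasDerivAt_snd t htx).congr_of_eventuallyEq (f₁ := ρ) (by
      filter_upwards [hx.1.isOpen.mem_nhds htx] with s hs using (hval x hx s hs).2.symm)
    rwa [(hval x hx t htx).2, (hval x hx t htx).1] at this
  · intro t ht
    obtain ⟨x, hx, htx⟩ := mem_iUnion₂.1 ht
    rw [← (hval x hx t htx).2]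
    exact hx.1.sq_ne_one t htx
  · intro η' ρ' U' hU' hT hE
    have hm : (η', ρ', U') ∈ F := ⟨hU', hT, hE⟩
    exact ⟨fun t ht => mem_biUnion hm ht, fun t ht => (hval _ hm t ht).1⟩

/-- Two differentiable functions glue to a differentiable one if their values and derivatives match
in the limit. -/
theorem hasDerivAt_piecewise {f f' g : ℝ → ℝ} {a b e : ℝ} (hab : a < b)
    (hf : ∀ t ∈ Ioo a b, HasDerivAt f (f' t) t) (hfb : Tendsto f (𝓝[<] b) (𝓝 (g b)))
    (hf' : Tendsto f' (𝓝[<] b) (𝓝 e)) (hg : HasDerivAt g e b) :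
    HasDerivAt (fun t => if t < b then f t else g t) e b := by
  have hev : ∀ t ∈ Ioo a b, (fun t => if t < b then f t else g t) =ᶠ[𝓝 t] f := by
    intro t ht
    filter_upwards [Iio_mem_nhds ht.2] with s hs
    exact if_pos hs
  have hd : ∀ t ∈ Ioo a b, HasDerivAt (fun t => if t < b then f t else g t) (f' t) t :=
    fun t ht => (hf t ht).congr_of_eventuallyEq (hev t ht)
  have hIoo : Ioo a b ∈ 𝓝[<] b := Ioo_mem_nhdsLT hab
  have h1 : HasDerivWithinAt (fun t => if t < b then f t else g t) e (Iic b) b := by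
    refine hasDerivWithinAt_Iic_of_tendsto_deriv (s := Ioo a b)
      (fun t ht => (hd t ht).differentiableAt.differentiableWithinAt) ?_ hIoo ?_
    · have : Tendsto (fun t => if t < b then f t else g t) (𝓝[<] b) (𝓝 (g b)) := by
        refine hfb.congr' ?_
        filter_upwards [self_mem_nhdsWithin] with t ht
        exact (if_pos ht).symm
      rw [ContinuousWithinAt, if_neg (lt_irrefl b)]
      exact this.mono_left (nhdsWithin_mono _ fun t ht => ht.2)
    · refine hf'.congr' ?_
      filter_upwards [hIoo] with t ht using (hd t ht).deriv.symm
  have h2 : HasDerivWithinAt (fun t => if t < b then f t else g t) e (Ici b) b :=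
    hg.hasDerivWithinAt.congr (fun t ht => if_neg (not_lt.2 ht)) (if_neg (lt_irrefl b))
  have := h1.union h2
  rwa [Iic_union_Ici, hasDerivWithinAt_univ] at this

/-- A maximal phase curve cannot converge to a regular point of the phase plane at a finite end. -/
theorem IsMaximalPhaseCurve.mem_of_tendsto_nhdsLT (h : IsMaximalPhaseCurve n k ξ p T)
    {a b x y : ℝ} (hab : a < b) (hT : Ioo a b ⊆ T) (hξ : Tendsto ξ (𝓝[<] b) (𝓝 x))
    (hp : Tendsto p (𝓝[<] b) (𝓝 y)) (hy : 1 - y ^ 2 ≠ 0) : b ∈ T := by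
  by_contra hb
  have hTb : ∀ t ∈ T, t < b := by
    intro t ht
    by_contra hlt
    have hm : (a + b) / 2 ∈ T := hT ⟨by linarith, by linarith⟩
    exact hb (h.1.ordConnected.out hm ht ⟨by linarith, not_lt.1 hlt⟩)
  -- The curve would be continued by the integral curve `α` through the limit point `(x, y)`.
  obtain ⟨α, hα0, ε, hε, hα⟩ := (contDiffAt_phaseField n k (z := (x, y))
    hy).exists_forall_mem_closedBall_exists_eq_forall_mem_Ioo_hasDerivAt₀ b
  have hα1 : ∀ t ∈ Ioo (b - ε) (b + ε), HasDerivAt (fun t => (α t).1) (α t).2 t := fun t ht =>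
    (hasFDerivAt_fst (𝕜 := ℝ) (p := α t)).comp_hasDerivAt t (hα t ht)
  have hα2 : ∀ t ∈ Ioo (b - ε) (b + ε),
      HasDerivAt (fun t => (α t).2) (accel n k (α t).1 (α t).2) t := fun t ht =>
    (hasFDerivAt_snd (𝕜 := ℝ) (p := α t)).comp_hasDerivAt t (hα t ht)
  have hbm : b ∈ Ioo (b - ε) (b + ε) := ⟨by linarith, by linarith⟩
  have hreg : ∀ᶠ t in 𝓝 b, 1 - (α t).2 ^ 2 ≠ 0 := by
    have : ContinuousAt (fun t => 1 - (α t).2 ^ 2) b :=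
      continuousAt_const.sub ((hα2 b hbm).continuousAt.pow 2)
    exact this.eventually_ne (by rw [hα0]; exact hy)
  obtain ⟨δ, hδ, hδr⟩ := Metric.eventually_nhds_iff.1 hreg
  set r := min (min δ ε) (b - a) with hr_def
  have hr : 0 < r := lt_min (lt_min hδ hε) (by linarith)
  have hrδ : r ≤ δ := (min_le_left _ _).trans (min_le_left _ _)
  have hrε : r ≤ ε := (min_le_left _ _).trans (min_le_right _ _)
  have hra : r ≤ b - a := min_le_right _ _
  set η : ℝ → ℝ := fun t => if t < b then ξ t else (α t).1 with hη
  set ρ : ℝ → ℝ := fun t => if t < b then p t else (α t).2 with hρ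
  have hlt1 : ∀ t, t < b → η t = ξ t ∧ ρ t = p t := fun t ht => ⟨if_pos ht, if_pos ht⟩
  have hge1 : ∀ t, b ≤ t → η t = (α t).1 ∧ ρ t = (α t).2 :=
    fun t ht => ⟨if_neg (not_lt.2 ht), if_neg (not_lt.2 ht)⟩
  have hmemT : ∀ t ∈ T ∪ Ioo (b - r) (b + r), t < b → t ∈ T := by
    rintro t (ht | ht) htb
    · exact ht
    · exact hT ⟨by linarith [ht.1], htb⟩
  have hmem2 : ∀ t ∈ T ∪ Ioo (b - r) (b + r), b ≤ t → t ∈ Ioo (b - r) (b + r) := by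
    rintro t (ht | ht) htb
    · exact absurd (hTb t ht) (not_lt.2 htb)
    · exact ht
  have hξd : ∀ t ∈ Ioo a b, HasDerivAt ξ (p t) t := fun t ht => h.1.hasDerivAt_fst t (hT ht)
  have hpd : ∀ t ∈ Ioo a b, HasDerivAt p (accel n k (ξ t) (p t)) t :=
    fun t ht => h.1.hasDerivAt_snd t (hT ht)
  have hacc : Tendsto (fun t => accel n k (ξ t) (p t)) (𝓝[<] b) (𝓝 (accel n k x y)) := by
    have := ((contDiffAt_phaseField n k (z := (x, y)) hy).continuousAt.tendsto.comp
      (hξ.prodMk_nhds hp)).snd_nhds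
    exact this
  have hcurve : IsPhaseCurve n k η ρ (T ∪ Ioo (b - r) (b + r)) := by
    refine ⟨h.1.isOpen.union isOpen_Ioo, ?_, h.1.nonempty.mono subset_union_left, ?_, ?_, ?_⟩
    · have h1 : b - r / 2 ∈ Ioo a b := ⟨by linarith, by linarith⟩
      have h2 : b - r / 2 ∈ Ioo (b - r) (b + r) := ⟨by linarith, by linarith⟩
      refine (IsPreconnected.union (b - r / 2) (hT h1) h2
        h.1.ordConnected.isPreconnected isPreconnected_Ioo).ordConnected
    · intro t ht
      rcases lt_trichotomy t b with htb | rfl | htb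
      · rw [(hlt1 t htb).2]
        refine (h.1.hasDerivAt_fst t (hmemT t ht htb)).congr_of_eventuallyEq ?_
        filter_upwards [Iio_mem_nhds htb] with s hs using (hlt1 s hs).1
      · rw [(hge1 t le_rfl).2, hα0]
        have h1 := hα1 t hbm
        rw [hα0] at h1
        exact hasDerivAt_piecewise hab hξd (by rw [hα0]; exact hξ) hp h1
      · rw [(hge1 t htb.le).2]
        have := hmem2 t ht htb.le
        refine (hα1 t ⟨by linarith [this.1], by linarith [this.2]⟩).congr_of_eventuallyEq ?_
        filter_upwards [Ioi_mem_nhds htb] with s hs using (hge1 s (le_of_lt hs)).1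
    · intro t ht
      rcases lt_trichotomy t b with htb | rfl | htb
      · rw [(hlt1 t htb).2, (hlt1 t htb).1]
        refine (h.1.hasDerivAt_snd t (hmemT t ht htb)).congr_of_eventuallyEq ?_
        filter_upwards [Iio_mem_nhds htb] with s hs using (hlt1 s hs).2
      · rw [(hge1 t le_rfl).2, (hge1 t le_rfl).1, hα0]
        have h1 := hα2 t hbm
        rw [hα0] at h1
        exact hasDerivAt_piecewise hab hpd (by rw [hα0]; exact hp) hacc h1
      · rw [(hge1 t htb.le).2, (hge1 t htb.le).1]
        have := hmem2 t ht htb.le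
        refine (hα2 t ⟨by linarith [this.1], by linarith [this.2]⟩).congr_of_eventuallyEq ?_
        filter_upwards [Ioi_mem_nhds htb] with s hs using (hge1 s (le_of_lt hs)).2
    · intro t ht
      rcases lt_or_ge t b with htb | htb
      · rw [(hlt1 t htb).2]
        exact h.1.sq_ne_one t (hmemT t ht htb)
      · rw [(hge1 t htb).2]
        have := hmem2 t ht htb
        refine hδr ?_
        rw [Real.dist_eq, abs_lt]
        constructor <;> linarith [this.1, this.2]
  have := h.2 η ρ _ hcurve subset_union_left fun t ht => (hlt1 t (hTb t ht)).1.symm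
  have hbr : b ∈ Ioo (b - r) (b + r) := ⟨by linarith, by linarith⟩
  exact hb (this.subset (Or.inr hbr))

end

/-! ### Ends of an interval and limits along them -/

/-- `l` is the filter of neighbourhoods of the right end of the interval `T`: `atTop` if `T` is
unbounded above and `𝓝[<] b` if `b = sup T` is finite and not in `T`. -/
def IsRightEnd (T : Set ℝ) (l : Filter ℝ) : Prop :=
  (l = atTop ∧ ∀ t ∈ T, Ici t ⊆ T) ∨ ∃ b, l = 𝓝[<] b ∧ ∀ t ∈ T, t < b ∧ Ico t b ⊆ T

/-- `l` is the filter of neighbourhoods of the left end of the interval `T`. -/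
def IsLeftEnd (T : Set ℝ) (l : Filter ℝ) : Prop :=
  (l = atBot ∧ ∀ t ∈ T, Iic t ⊆ T) ∨ ∃ a, l = 𝓝[>] a ∧ ∀ t ∈ T, a < t ∧ Ioc a t ⊆ T

section

variable {T : Set ℝ} {l : Filter ℝ}

theorem exists_isRightEnd (hT : IsOpen T) (hc : T.OrdConnected) (hne : T.Nonempty) :
    ∃ l, IsRightEnd T l := by
  by_cases hb : BddAbove T
  · refine ⟨𝓝[<] (sSup T), Or.inr ⟨sSup T, rfl, fun t ht => ?_⟩⟩
    have hlt : ∀ t ∈ T, t < sSup T := by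
      intro t ht
      obtain ⟨ε, hε, hball⟩ := Metric.isOpen_iff.1 hT t ht
      have : t + ε / 2 ∈ T := hball (by
        rw [Metric.mem_ball, Real.dist_eq, abs_lt]; constructor <;> linarith)
      have := le_csSup hb this
      linarith
    refine ⟨hlt t ht, fun s hs => ?_⟩
    obtain ⟨u, hu, hsu⟩ := exists_lt_of_lt_csSup hne hs.2
    exact hc.out ht hu ⟨hs.1, hsu.le⟩
  · refine ⟨atTop, Or.inl ⟨rfl, fun t ht s hs => ?_⟩⟩
    obtain ⟨u, hu, hsu⟩ := not_bddAbove_iff.1 hb s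
    exact hc.out ht hu ⟨hs, hsu.le⟩

theorem IsRightEnd.neBot (h : IsRightEnd T l) : l.NeBot := by
  rcases h with ⟨rfl, _⟩ | ⟨b, rfl, _⟩ <;> infer_instance

theorem IsRightEnd.eventually (h : IsRightEnd T l) {t₁ : ℝ} (ht₁ : t₁ ∈ T) :
    ∀ᶠ t in l, t ∈ T ∧ t₁ ≤ t := by
  rcases h with ⟨rfl, h⟩ | ⟨b, rfl, h⟩
  · filter_upwards [eventually_ge_atTop t₁] with t ht using ⟨h t₁ ht₁ ht, ht⟩
  · filter_upwards [Ico_mem_nhdsLT (h t₁ ht₁).1] with t ht using ⟨(h t₁ ht₁).2 ht, ht.1⟩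

/-- Reflection exchanges left and right ends; it transfers statements from one to the other. -/
theorem isRightEnd_preimage_neg_iff : IsRightEnd (Neg.neg ⁻¹' T) (l.map Neg.neg) ↔
    IsLeftEnd T l := by
  have key : ∀ l' : Filter ℝ, l.map Neg.neg = l' ↔ l = l'.map Neg.neg := by
    intro l'
    constructor
    · rintro rfl
      rw [Filter.map_map]; simp
    · rintro rfl
      rw [Filter.map_map]; simp
  unfold IsRightEnd IsLeftEnd
  refine or_congr (and_congr ?_ ?_) ?_
  · rw [key, Filter.map_neg_atTop]
  · constructor
    · intro h t ht s hs
      simpa using h (-t) (by simpa using ht) (mem_Ici.2 (neg_le_neg (mem_Iic.1 hs)))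
    · intro h t ht s hs
      exact h (-t) ht (mem_Iic.2 (neg_le_neg (mem_Ici.1 hs)))
  · constructor
    · rintro ⟨b, hb, h⟩
      refine ⟨-b, ?_, fun t ht => ?_⟩
      · rw [(key _).1 hb]
        simp
      · have := h (-t) (by simpa using ht)
        refine ⟨by linarith [this.1], fun s hs => ?_⟩
        have h2 := this.2 (show -s ∈ Ico (-t) b from ⟨neg_le_neg hs.2, by linarith [hs.1]⟩)
        simpa using h2
    · rintro ⟨b, hb, h⟩
      refine ⟨-b, ?_, fun t ht => ?_⟩
      · rw [key, hb]
        simp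
      · have := h (-t) ht
        refine ⟨by linarith [this.1], fun s hs => ?_⟩
        exact this.2 (show -s ∈ Ioc b (-t) from ⟨by linarith [hs.2], neg_le_neg hs.1⟩)

theorem exists_isLeftEnd (hT : IsOpen T) (hc : T.OrdConnected) (hne : T.Nonempty) :
    ∃ l, IsLeftEnd T l := by
  obtain ⟨l, hl⟩ := exists_isRightEnd (T := Neg.neg ⁻¹' T) (hT.preimage continuous_neg)
    ⟨fun a ha b hb t ht => hc.out hb ha ⟨neg_le_neg ht.2, neg_le_neg ht.1⟩⟩
    (by obtain ⟨t, ht⟩ := hne; exact ⟨-t, by simpa using ht⟩)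
  refine ⟨l.map Neg.neg, isRightEnd_preimage_neg_iff.1 ?_⟩
  rw [Filter.map_map]
  simpa using hl

theorem IsLeftEnd.neBot (h : IsLeftEnd T l) : l.NeBot := by
  rcases h with ⟨rfl, _⟩ | ⟨b, rfl, _⟩ <;> infer_instance

theorem IsLeftEnd.eventually (h : IsLeftEnd T l) {t₁ : ℝ} (ht₁ : t₁ ∈ T) :
    ∀ᶠ t in l, t ∈ T ∧ t ≤ t₁ := by
  rcases h with ⟨rfl, h⟩ | ⟨b, rfl, h⟩
  · filter_upwards [eventually_le_atBot t₁] with t ht using ⟨h t₁ ht₁ ht, ht⟩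
  · filter_upwards [Ioc_mem_nhdsGT (h t₁ ht₁).1] with t ht using ⟨(h t₁ ht₁).2 ht, ht.2⟩

theorem tendsto_of_monotoneOn_of_bounded {f : ℝ → ℝ} {t₀ m : ℝ}
    (hl : ∀ t₁ ∈ T, ∀ᶠ t in l, t ∈ T ∧ t₁ ≤ t) (ht₀ : t₀ ∈ T) (hf : MonotoneOn f (T ∩ Ici t₀))
    (hb : ∀ t ∈ T, t₀ ≤ t → f t ≤ m) :
    ∃ x, Tendsto f l (𝓝 x) ∧ ∀ t ∈ T, t₀ ≤ t → f t ≤ x := by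
  have hbdd : BddAbove (f '' (T ∩ Ici t₀)) := ⟨m, by rintro _ ⟨t, ht, rfl⟩; exact hb t ht.1 ht.2⟩
  have hle : ∀ t ∈ T, t₀ ≤ t → f t ≤ sSup (f '' (T ∩ Ici t₀)) := fun t ht h =>
    le_csSup hbdd ⟨t, ⟨ht, h⟩, rfl⟩
  refine ⟨_, ?_, hle⟩
  rw [tendsto_order]
  constructor
  · intro a ha
    obtain ⟨_, ⟨t₁, ht₁, rfl⟩, h⟩ := exists_lt_of_lt_csSup (Set.Nonempty.image f
      (s := T ∩ Ici t₀) ⟨t₀, ht₀, mem_Ici.2 le_rfl⟩) ha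
    filter_upwards [hl t₁ ht₁.1] with t ht
    exact h.trans_le (hf ht₁ ⟨ht.1, le_trans (mem_Ici.1 ht₁.2) ht.2⟩ ht.2)
  · intro a ha
    filter_upwards [hl t₀ ht₀] with t ht
    exact (hle t ht.1 ht.2).trans_lt ha

theorem tendsto_atTop_of_monotoneOn_of_unbounded {f : ℝ → ℝ} {t₀ : ℝ}
    (hl : ∀ t₁ ∈ T, ∀ᶠ t in l, t ∈ T ∧ t₁ ≤ t) (hf : MonotoneOn f (T ∩ Ici t₀))
    (hb : ∀ m, ∃ t ∈ T, t₀ ≤ t ∧ m < f t) : Tendsto f l atTop := by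
  rw [tendsto_atTop]
  intro m
  obtain ⟨t₁, ht₁, h0, h⟩ := hb m
  filter_upwards [hl t₁ ht₁] with t ht
  exact h.le.trans (hf ⟨ht₁, h0⟩ ⟨ht.1, h0.trans ht.2⟩ ht.2)

end

/-- If `f` and its derivative both converge at `+∞`, the derivative tends to `0`. -/
theorem eq_zero_of_tendsto_of_tendsto_deriv {f f' : ℝ → ℝ} {x y : ℝ}
    (hd : ∀ᶠ t in atTop, HasDerivAt f (f' t) t) (hf : Tendsto f atTop (𝓝 x))
    (hf' : Tendsto f' atTop (𝓝 y)) : y = 0 := by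
  obtain ⟨t₀, ht₀⟩ := eventually_atTop.1 hd
  have hex : ∀ t, ∃ c, t₀ ≤ t → t < c ∧ f' c = f (t + 1) - f t := by
    intro t
    by_cases ht : t₀ ≤ t
    · obtain ⟨c, hc, he⟩ := exists_hasDerivAt_eq_slope f f' (show t < t + 1 by linarith)
        (fun s hs => (ht₀ s (ht.trans hs.1)).continuousAt.continuousWithinAt)
        (fun s hs => ht₀ s (ht.trans hs.1.le))
      refine ⟨c, fun _ => ⟨hc.1, ?_⟩⟩
      rw [he]; simp
    · exact ⟨0, fun h => absurd h ht⟩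
  choose c hc using hex
  have hct : Tendsto c atTop atTop := by
    refine tendsto_atTop_mono' _ ?_ tendsto_id
    filter_upwards [eventually_ge_atTop t₀] with t ht using (hc t ht).1.le
  have h1 : Tendsto (fun t => f (t + 1) - f t) atTop (𝓝 (x - x)) :=
    (hf.comp (tendsto_atTop_add_const_right _ 1 tendsto_id)).sub hf
  have h2 : Tendsto (fun t => f (t + 1) - f t) atTop (𝓝 y) := by
    refine (hf'.comp hct).congr' ?_
    filter_upwards [eventually_ge_atTop t₀] with t ht using (hc t ht).2
  rw [tendsto_nhds_unique h2 h1, sub_self]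

/-! ### The first integral and the potential -/

/-- The function `F` of `ξ` with `(1 - ξ_t²)ᵏ = F(ξ)` along the solutions with first integral `h`. -/
noncomputable def potential (n k : ℕ) (h x : ℝ) : ℝ :=
  Real.exp (((n : ℝ) - 2 * k) * x) * h - Real.exp (-(2 * (k : ℝ)) * x)

/-- The derivative of `potential n k h`. -/
noncomputable def potentialDeriv (n k : ℕ) (h x : ℝ) : ℝ :=
  ((n : ℝ) - 2 * k) * Real.exp (((n : ℝ) - 2 * k) * x) * h +
    2 * k * Real.exp (-(2 * (k : ℝ)) * x)

/-- The value of `1 - ξ_t²` as a function of `ξ`, on solutions with first integral `h` along which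
`1 - ξ_t²` has the sign `s`. -/
noncomputable def profile (n k : ℕ) (h s x : ℝ) : ℝ := s * |potential n k h x| ^ (1 / (k : ℝ))

section

variable {n k : ℕ} {h s : ℝ} {ξ p : ℝ → ℝ} {T : Set ℝ} {l : Filter ℝ}

theorem potential_eq (x : ℝ) :
    potential n k h x = Real.exp (-(2 * (k : ℝ)) * x) * (h * Real.exp (n * x) - 1) := by
  rw [potential, mul_sub, mul_one, mul_left_comm, ← Real.exp_add]
  ring_nf

theorem potential_eq' (x : ℝ) :
    potential n k h x = Real.exp (((n : ℝ) - 2 * k) * x) * (h - Real.exp (-(n * x))) := by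
  rw [potential, mul_sub, ← Real.exp_add]
  ring_nf

theorem hasDerivAt_potential (x : ℝ) :
    HasDerivAt (potential n k h) (potentialDeriv n k h x) x := by
  have h1 := (((hasDerivAt_id x).const_mul ((n : ℝ) - 2 * k)).exp.mul_const h).sub
    (((hasDerivAt_id x).const_mul (-(2 * (k : ℝ)))).exp)
  convert! h1 using 1
  simp only [potentialDeriv, id]
  ring

theorem continuous_potential : Continuous (potential n k h) := by
  unfold potential; fun_prop

theorem continuous_potentialDeriv : Continuous (potentialDeriv n k h) := by
  unfold potentialDeriv; fun_prop

theorem continuous_profile : Continuous (profile n k h s) :=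
  continuous_const.mul (continuous_potential.abs.rpow_const fun _ => Or.inr (by positivity))

theorem potential_pos_iff {x : ℝ} : 0 < potential n k h x ↔ 1 < h * Real.exp (n * x) := by
  rw [potential_eq, mul_pos_iff_of_pos_left (Real.exp_pos _), sub_pos]

theorem potential_neg_iff {x : ℝ} : potential n k h x < 0 ↔ h * Real.exp (n * x) < 1 := by
  rw [potential_eq, mul_neg_iff]
  constructor
  · rintro (⟨_, h1⟩ | ⟨h1, _⟩)
    · linarith
    · exact absurd h1 (not_lt.2 (Real.exp_pos _).le)
  · intro h1
    exact Or.inl ⟨Real.exp_pos _, by linarith⟩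

theorem potential_eq_zero_iff {x : ℝ} : potential n k h x = 0 ↔ h * Real.exp (n * x) = 1 := by
  rw [potential_eq, mul_eq_zero, or_iff_right (Real.exp_pos _).ne', sub_eq_zero]

theorem potentialDeriv_of_potential_eq_zero {x : ℝ} (hx : potential n k h x = 0) :
    potentialDeriv n k h x = n * Real.exp (-(2 * (k : ℝ)) * x) := by
  rw [potential, sub_eq_zero] at hx
  rw [potentialDeriv, mul_assoc, hx]
  ring

/-- A maximal phase curve together with its first integral `h` and the sign `s` of `1 - ξ_t²`. -/
structure Trajectory (n k : ℕ) (h s : ℝ) (ξ p : ℝ → ℝ) (T : Set ℝ) : Prop where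
  maximal : IsMaximalPhaseCurve n k ξ p T
  energy : ∀ t ∈ T, (1 - p t ^ 2) ^ k = potential n k h (ξ t)
  sign_eq : s = 1 ∨ s = -1
  sign_pos : ∀ t ∈ T, 0 < s * (1 - p t ^ 2)

/-- The equation `ξ_tt = accel n k ξ ξ_t` makes `h = e^{(2k-n)ξ}(1-ξ_t²)ᵏ + e^{-nξ}` constant. -/
theorem IsPhaseCurve.exists_firstIntegral (hk : 1 < k) (hc : IsPhaseCurve n k ξ p T) :
    ∃ h, ∀ t ∈ T, Real.exp ((2 * (k : ℝ) - n) * ξ t) * (1 - p t ^ 2) ^ k +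
      Real.exp (-(n : ℝ) * ξ t) = h := by
  have hk0 : (k : ℝ) ≠ 0 := by positivity
  have hd : ∀ t ∈ T, HasDerivAt (fun t => Real.exp ((2 * (k : ℝ) - n) * ξ t) * (1 - p t ^ 2) ^ k +
      Real.exp (-(n : ℝ) * ξ t)) 0 t := by
    intro t ht
    have h1 := hc.hasDerivAt_fst t ht
    have h2 := hc.hasDerivAt_snd t ht
    have h3 := (((h1.const_mul (2 * (k : ℝ) - n)).exp.mul (((h2.pow 2).const_sub 1).pow k))).add
      (h1.const_mul (-(n : ℝ))).exp
    convert! h3 using 1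
    have hq := hc.sq_ne_one t ht
    obtain ⟨j, rfl⟩ : ∃ j, k = j + 1 := ⟨k - 1, by omega⟩
    have e1 : Real.exp (-(2 * ((j + 1 : ℕ) : ℝ)) * ξ t) =
        Real.exp (-(n : ℝ) * ξ t) / Real.exp ((2 * ((j + 1 : ℕ) : ℝ) - n) * ξ t) := by
      rw [← Real.exp_sub]; ring_nf
    simp only [accel, e1, Nat.add_sub_cancel, Pi.pow_apply]
    have hE := (Real.exp_pos ((2 * ((j + 1 : ℕ) : ℝ) - n) * ξ t)).ne'
    generalize Real.exp ((2 * ((j + 1 : ℕ) : ℝ) - n) * ξ t) = A at *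
    generalize Real.exp (-(n : ℝ) * ξ t) = B at *
    generalize hQ : 1 - p t ^ 2 = q at *
    have hqj : q ^ j ≠ 0 := pow_ne_zero _ hq
    push_cast at *
    field_simp
    ring
  obtain ⟨t₀, ht₀⟩ := hc.nonempty
  refine ⟨Real.exp ((2 * (k : ℝ) - n) * ξ t₀) * (1 - p t₀ ^ 2) ^ k +
    Real.exp (-(n : ℝ) * ξ t₀), fun t ht => ?_⟩
  exact hc.isOpen.is_const_of_deriv_eq_zero hc.ordConnected.isPreconnected
    (fun s hs => (hd s hs).differentiableAt.differentiableWithinAt)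
    (fun s hs => (hd s hs).deriv) ht ht₀

theorem one_sub_sq_pow_eq_potential {x y : ℝ} (he : Real.exp ((2 * (k : ℝ) - n) * x) *
    (1 - y ^ 2) ^ k + Real.exp (-(n : ℝ) * x) = h) : (1 - y ^ 2) ^ k = potential n k h x := by
  rw [← he, potential_eq', ← neg_mul, add_sub_cancel_right, ← mul_assoc, ← Real.exp_add]
  ring_nf
  simp

theorem IsPhaseCurve.sign_dichotomy (hc : IsPhaseCurve n k ξ p T) :
    (∀ t ∈ T, 0 < 1 - p t ^ 2) ∨ (∀ t ∈ T, 1 - p t ^ 2 < 0) := by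
  have hcont : ContinuousOn (fun t => 1 - p t ^ 2) T := fun t ht =>
    (continuousAt_const.sub ((hc.hasDerivAt_snd t ht).continuousAt.pow 2)).continuousWithinAt
  by_contra hcon
  push Not at hcon
  obtain ⟨⟨a, ha, ha'⟩, b, hb, hb'⟩ := hcon
  obtain ⟨c, hcT, hc0⟩ := hc.ordConnected.isPreconnected.intermediate_value ha hb hcont ⟨ha', hb'⟩
  exact hc.sq_ne_one c hcT hc0

/-- On a `C¹` curve along which `p ≠ 0`, the sign of `p` is constant. -/
theorem IsPhaseCurve.velocity_dichotomy (hc : IsPhaseCurve n k ξ p T) (h0 : ∀ t ∈ T, p t ≠ 0) :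
    (∀ t ∈ T, p t < 0) ∨ (∀ t ∈ T, 0 < p t) := by
  have hcont : ContinuousOn p T := fun t ht =>
    (hc.hasDerivAt_snd t ht).continuousAt.continuousWithinAt
  by_contra hcon
  push Not at hcon
  obtain ⟨⟨a, ha, ha'⟩, b, hb, hb'⟩ := hcon
  obtain ⟨c, hcT, hc0⟩ := hc.ordConnected.isPreconnected.intermediate_value hb ha hcont ⟨hb', ha'⟩
  exact h0 c hcT hc0

namespace Trajectory

theorem curve (tr : Trajectory n k h s ξ p T) : IsPhaseCurve n k ξ p T := tr.maximal.1

theorem reflect (tr : Trajectory n k h s ξ p T) :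
    Trajectory n k h s (fun t => ξ (-t)) (fun t => -p (-t)) (Neg.neg ⁻¹' T) := by
  refine ⟨tr.maximal.reflect, fun t ht => ?_, tr.sign_eq, fun t ht => ?_⟩
  · have := tr.energy _ ht
    simpa using this
  · have := tr.sign_pos _ ht
    simpa using this

theorem potential_ne_zero (tr : Trajectory n k h s ξ p T) {t : ℝ} (ht : t ∈ T) :
    potential n k h (ξ t) ≠ 0 := by
  rw [← tr.energy t ht]
  exact pow_ne_zero _ (tr.curve.sq_ne_one t ht)

theorem one_sub_sq (hk : 1 < k) (tr : Trajectory n k h s ξ p T) {t : ℝ} (ht : t ∈ T) :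
    1 - p t ^ 2 = profile n k h s (ξ t) := by
  have hss : s * s = 1 := by rcases tr.sign_eq with rfl | rfl <;> norm_num
  have hs1 : |s| = 1 := by rcases tr.sign_eq with rfl | rfl <;> norm_num
  have h1 : |1 - p t ^ 2| = s * (1 - p t ^ 2) := by
    rw [← abs_of_pos (tr.sign_pos t ht), abs_mul, hs1, one_mul]
  rw [profile, ← tr.energy t ht, abs_pow, one_div, Real.pow_rpow_inv_natCast (abs_nonneg _) (by omega),
    h1, ← mul_assoc, hss, one_mul]

/-- The derivative of the relation `(1 - ξ_t²)ᵏ = F(ξ)`, solved for `ξ_tt`. -/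
theorem accel_eq (hk : 1 < k) (tr : Trajectory n k h s ξ p T) {t : ℝ} (ht : t ∈ T) :
    accel n k (ξ t) (p t) =
      -potentialDeriv n k h (ξ t) / (2 * k * (1 - p t ^ 2) ^ (k - 1)) := by
  have hq := tr.curve.sq_ne_one t ht
  have he := tr.energy t ht
  obtain ⟨j, rfl⟩ : ∃ j, k = j + 1 := ⟨k - 1, by omega⟩
  simp only [accel, Nat.add_sub_cancel, potentialDeriv, potential] at *
  generalize Real.exp (((n : ℝ) - 2 * ((j + 1 : ℕ) : ℝ)) * ξ t) = A at *
  generalize Real.exp (-(2 * ((j + 1 : ℕ) : ℝ)) * ξ t) = B at *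
  generalize 1 - p t ^ 2 = q at *
  have hqj : q ^ j ≠ 0 := pow_ne_zero _ hq
  have hA : A * h = q ^ (j + 1) + B := by linarith
  have : (0 : ℝ) < (j : ℝ) + 1 := by positivity
  push_cast at *
  field_simp
  linear_combination ((n : ℝ) - 2 * (j + 1)) * hA

theorem monotoneOn (tr : Trajectory n k h s ξ p T) {ε t₀ : ℝ}
    (hp : ∀ t ∈ T, t₀ ≤ t → 0 ≤ ε * p t) : MonotoneOn (fun t => ε * ξ t) (T ∩ Ici t₀) := by
  have hconv : Convex ℝ (T ∩ Ici t₀) :=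
    (tr.curve.ordConnected.inter ordConnected_Ici).convex
  refine monotoneOn_of_hasDerivWithinAt_nonneg hconv (f' := fun t => ε * p t) ?_ ?_ ?_
  · exact fun t ht => ((tr.curve.hasDerivAt_fst t ht.1).const_mul ε).continuousAt.continuousWithinAt
  · exact fun t ht => ((tr.curve.hasDerivAt_fst t
      (interior_subset ht).1).const_mul ε).hasDerivWithinAt
  · exact fun t ht => hp t (interior_subset ht).1 (interior_subset ht).2

/-- A bounded monotone branch of a maximal solution either reaches the singular set `ξ_t² = 1` in
finite time, at a zero of the potential, or tends in infinite time to an equilibrium. -/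
theorem limit_right (hk : 1 < k) (tr : Trajectory n k h s ξ p T) (hl : IsRightEnd T l)
    {t₀ ε m : ℝ} (ht₀ : t₀ ∈ T) (hε : ε = 1 ∨ ε = -1) (hp : ∀ t ∈ T, t₀ ≤ t → 0 ≤ ε * p t)
    (hb : ∀ t ∈ T, t₀ ≤ t → ε * ξ t ≤ m) :
    ∃ x, Tendsto ξ l (𝓝 x) ∧ (∀ t ∈ T, t₀ ≤ t → ε * ξ t ≤ ε * x) ∧
      ((l = atTop ∧ Tendsto p l (𝓝 0) ∧ potential n k h x = 1) ∨
        ((∃ b, l = 𝓝[<] b) ∧ Tendsto p l (𝓝 ε) ∧ potential n k h x = 0)) := by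
  have hεε : ε * ε = 1 := by rcases hε with rfl | rfl <;> norm_num
  have := hl.neBot
  obtain ⟨x', hx', hle⟩ := tendsto_of_monotoneOn_of_bounded (fun t₁ ht₁ => hl.eventually ht₁) ht₀
    (tr.monotoneOn hp) hb
  have hξ : Tendsto ξ l (𝓝 (ε * x')) := by
    have := hx'.const_mul ε
    refine this.congr fun t => ?_
    rw [← mul_assoc, hεε, one_mul]
  set x := ε * x' with hx
  have hex : ε * x = x' := by rw [hx, ← mul_assoc, hεε, one_mul]
  -- The sign of `p` being known, `1 - p² = profile (ξ)` determines `p` and hence its limit `y`.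
  have hpt : Tendsto p l (𝓝 (ε * Real.sqrt (1 - profile n k h s x))) := by
    have h1 : Tendsto (fun t => ε * Real.sqrt (1 - profile n k h s (ξ t))) l
        (𝓝 (ε * Real.sqrt (1 - profile n k h s x))) :=
      (((continuous_profile.tendsto x).comp hξ).const_sub 1).sqrt.const_mul ε
    refine h1.congr' ?_
    filter_upwards [hl.eventually ht₀] with t ht
    rw [← tr.one_sub_sq hk ht.1]
    have h2 : 1 - (1 - p t ^ 2) = (ε * p t) ^ 2 := by
      rw [mul_pow, sq ε, hεε]; ring
    rw [h2, Real.sqrt_sq (hp t ht.1 ht.2), ← mul_assoc, hεε, one_mul]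
  set y := ε * Real.sqrt (1 - profile n k h s x) with hy
  have hεy : 0 ≤ ε * y := by
    rw [hy, ← mul_assoc, hεε, one_mul]; exact Real.sqrt_nonneg _
  have hen : (1 - y ^ 2) ^ k = potential n k h x := by
    have h1 : Tendsto (fun t => (1 - p t ^ 2) ^ k) l (𝓝 ((1 - y ^ 2) ^ k)) :=
      ((hpt.pow 2).const_sub 1).pow k
    refine tendsto_nhds_unique h1 (((continuous_potential.tendsto x).comp hξ).congr' ?_)
    filter_upwards [hl.eventually ht₀] with t ht using (tr.energy t ht.1).symm
  refine ⟨x, hξ, fun t ht h => by rw [hex]; exact hle t ht h, ?_⟩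
  have hl' := hl
  rcases hl with ⟨rfl, hT⟩ | ⟨b, rfl, hT⟩
  · have hy0 : y = 0 := eq_zero_of_tendsto_of_tendsto_deriv
      (by filter_upwards [hl'.eventually ht₀] with t ht using tr.curve.hasDerivAt_fst t ht.1) hξ hpt
    refine Or.inl ⟨rfl, by rwa [hy0] at hpt, ?_⟩
    rw [← hen, hy0]; simp
  · have hy1 : 1 - y ^ 2 = 0 := by
      by_contra hne
      have hbT := tr.maximal.mem_of_tendsto_nhdsLT (hT t₀ ht₀).1
        (fun t ht => (hT t₀ ht₀).2 ⟨ht.1.le, ht.2⟩) hξ hpt hne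
      exact lt_irrefl _ (hT b hbT).1
    -- By maximality the limit point is singular, `y² = 1`, and the sign of `y` is that of `ε`.
    have hyε : y = ε := by
      have h1 : (ε * y) ^ 2 = 1 := by rw [mul_pow, sq ε, hεε]; linarith
      have h2 : ε * y = 1 := by nlinarith
      calc y = ε * (ε * y) := by rw [← mul_assoc, hεε, one_mul]
        _ = ε := by rw [h2, mul_one]
    refine Or.inr ⟨⟨b, rfl⟩, by rwa [hyε] at hpt, ?_⟩
    rw [← hen, hy1, zero_pow (by omega)]

/-- The mirror image of `Trajectory.limit_right` at the left end. -/
theorem limit_left (hk : 1 < k) (tr : Trajectory n k h s ξ p T) (hl : IsLeftEnd T l)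
    {t₀ ε m : ℝ} (ht₀ : t₀ ∈ T) (hε : ε = 1 ∨ ε = -1) (hp : ∀ t ∈ T, t ≤ t₀ → ε * p t ≤ 0)
    (hb : ∀ t ∈ T, t ≤ t₀ → ε * ξ t ≤ m) :
    ∃ x, Tendsto ξ l (𝓝 x) ∧ (∀ t ∈ T, t ≤ t₀ → ε * ξ t ≤ ε * x) ∧
      ((l = atBot ∧ Tendsto p l (𝓝 0) ∧ potential n k h x = 1) ∨
        ((∃ a, l = 𝓝[>] a) ∧ Tendsto p l (𝓝 (-ε)) ∧ potential n k h x = 0)) := by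
  obtain ⟨x, h1, h2, h3⟩ := tr.reflect.limit_right hk (isRightEnd_preimage_neg_iff.2 hl)
    (t₀ := -t₀) (ε := ε) (m := m) (by simpa using ht₀) hε
    (fun t ht h => by have := hp (-t) ht (by linarith); linarith)
    (fun t ht h => hb (-t) ht (by linarith))
  have hnn : ∀ f : ℝ → ℝ, (fun t => f (-t)) ∘ Neg.neg = f := fun f => by ext t; simp
  refine ⟨x, ?_, fun t ht h => ?_, ?_⟩
  · rwa [tendsto_map'_iff, hnn] at h1
  · have := h2 (-t) (by simpa using ht) (by linarith)
    simpa using this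
  · have hpp : ∀ y, Tendsto (fun t => -p (-t)) (map Neg.neg l) (𝓝 y) → Tendsto p l (𝓝 (-y)) := by
      intro y hy
      rw [tendsto_map'_iff, hnn fun t => -p t] at hy
      simpa using hy.neg
    have hfl : map Neg.neg (map Neg.neg l) = l := by rw [Filter.map_map]; simp
    rcases h3 with ⟨e, hp0, he⟩ | ⟨⟨b, e⟩, hp0, he⟩
    · refine Or.inl ⟨?_, by simpa using hpp _ hp0, he⟩
      rw [← hfl, e, Filter.map_neg_atTop]
    · refine Or.inr ⟨⟨-b, ?_⟩, hpp _ hp0, he⟩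
      rw [← hfl, e]; simp

theorem tendsto_right_of_unbounded (tr : Trajectory n k h s ξ p T) (hl : IsRightEnd T l)
    {t₀ ε : ℝ} (hp : ∀ t ∈ T, t₀ ≤ t → 0 ≤ ε * p t)
    (hb : ¬ ∃ m, ∀ t ∈ T, t₀ ≤ t → ε * ξ t ≤ m) : Tendsto (fun t => ε * ξ t) l atTop := by
  push Not at hb
  exact tendsto_atTop_of_monotoneOn_of_unbounded (fun t₁ ht₁ => hl.eventually ht₁)
    (tr.monotoneOn hp) hb

theorem tendsto_left_of_unbounded (tr : Trajectory n k h s ξ p T) (hl : IsLeftEnd T l)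
    {t₀ ε : ℝ} (hp : ∀ t ∈ T, t ≤ t₀ → ε * p t ≤ 0)
    (hb : ¬ ∃ m, ∀ t ∈ T, t ≤ t₀ → ε * ξ t ≤ m) : Tendsto (fun t => ε * ξ t) l atTop := by
  have := tr.reflect.tendsto_right_of_unbounded (isRightEnd_preimage_neg_iff.2 hl)
    (t₀ := -t₀) (ε := ε)
    (fun t ht h => by have := hp (-t) ht (by linarith); linarith)
    (fun ⟨m, hm⟩ => hb ⟨m, fun t ht h => by
      have := hm (-t) (by simpa using ht) (by linarith)
      simpa using this⟩)
  rw [tendsto_map'_iff] at this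
  simpa [Function.comp_def] using this

/-- With bounded velocity, `ξ` does not become infinite in finite time. -/
theorem eq_atTop_of_unbounded (tr : Trajectory n k h s ξ p T) (hl : IsRightEnd T l)
    {t₀ ε C : ℝ} (ht₀ : t₀ ∈ T) (hp : ∀ t ∈ T, t₀ ≤ t → ε * p t ≤ C)
    (hξ : Tendsto (fun t => ε * ξ t) l atTop) : l = atTop := by
  have hl' := hl
  rcases hl with ⟨rfl, hT⟩ | ⟨b, rfl, hT⟩
  · rfl
  exfalso
  have hev := hl'.eventually ht₀
  have := hl'.neBot
  have hC : ∀ t ∈ T, t₀ ≤ t → ε * ξ t ≤ ε * ξ t₀ + |C| * (b - t₀) := by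
    intro t ht h
    have hsub : Icc t₀ t ⊆ T := fun r hr => tr.curve.ordConnected.out ht₀ ht hr
    have h1 := image_le_of_deriv_right_le_deriv_boundary (f := fun r => ε * ξ r)
      (f' := fun r => ε * p r) (a := t₀) (b := t) (B := fun r => ε * ξ t₀ + |C| * (r - t₀))
      (B' := fun _ => |C|)
      (fun r hr => ((tr.curve.hasDerivAt_fst r (hsub hr)).const_mul ε).continuousAt.continuousWithinAt)
      (fun r hr => ((tr.curve.hasDerivAt_fst r (hsub (Ico_subset_Icc_self hr))).const_mul
        ε).hasDerivWithinAt) (by simp) (by fun_prop)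
      (fun r hr => by
        have := (((hasDerivAt_id r).sub_const t₀).const_mul |C|).const_add (ε * ξ t₀)
        simpa using this.hasDerivWithinAt)
      (fun r hr => (hp r (hsub (Ico_subset_Icc_self hr)) hr.1).trans (le_abs_self C))
    have h2 := h1 (show t ∈ Icc t₀ t from ⟨h, le_rfl⟩)
    have h3 : |C| * (t - t₀) ≤ |C| * (b - t₀) :=
      mul_le_mul_of_nonneg_left (by linarith [(hT t ht).1]) (abs_nonneg _)
    linarith
  obtain ⟨t, ht, h⟩ := (hev.and (hξ.eventually_gt_atTop (ε * ξ t₀ + |C| * (b - t₀)))).exists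
  exact absurd (hC t ht.1 ht.2) (not_le.2 h)

theorem eq_atBot_of_unbounded (tr : Trajectory n k h s ξ p T) (hl : IsLeftEnd T l)
    {t₀ ε C : ℝ} (ht₀ : t₀ ∈ T) (hp : ∀ t ∈ T, t ≤ t₀ → -C ≤ ε * p t)
    (hξ : Tendsto (fun t => ε * ξ t) l atTop) : l = atBot := by
  have := tr.reflect.eq_atTop_of_unbounded (isRightEnd_preimage_neg_iff.2 hl)
    (t₀ := -t₀) (ε := ε) (C := C) (by simpa using ht₀)
    (fun t ht h => by have := hp (-t) ht (by linarith); linarith)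
    (by rw [tendsto_map'_iff]; simpa [Function.comp_def] using hξ)
  have hfl : map Neg.neg (map Neg.neg l) = l := by rw [Filter.map_map]; simp
  rw [← hfl, this, Filter.map_neg_atTop]

end Trajectory

end

/-! ### Concave and convex solutions -/

namespace Trajectory

variable {n k : ℕ} {h s : ℝ} {ξ p : ℝ → ℝ} {T : Set ℝ} {l : Filter ℝ}

theorem velocity_sq_lt_one (tr : Trajectory n k h 1 ξ p T) {t : ℝ} (ht : t ∈ T) :
    -1 < p t ∧ p t < 1 := by
  have := tr.sign_pos t ht
  constructor <;> nlinarith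

theorem potential_pos (tr : Trajectory n k h 1 ξ p T) {t : ℝ} (ht : t ∈ T) :
    0 < potential n k h (ξ t) := by
  rw [← tr.energy t ht]
  have := tr.sign_pos t ht
  rw [one_mul] at this
  positivity

theorem potential_le_one (tr : Trajectory n k h 1 ξ p T) {t : ℝ} (ht : t ∈ T) :
    potential n k h (ξ t) ≤ 1 := by
  rw [← tr.energy t ht]
  have := tr.sign_pos t ht
  exact pow_le_one₀ (by linarith) (by nlinarith [sq_nonneg (p t)])

theorem h_pos_of_potential_pos {x : ℝ} (hx : 0 < potential n k h x) : 0 < h := by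
  rw [potential_pos_iff] at hx
  by_contra hh
  nlinarith [Real.exp_pos (n * x)]

theorem lower_bound_of_potential_pos (hn : 3 ≤ n) {x : ℝ} (hx : 0 < potential n k h x) :
    -Real.log h / n < x := by
  have hh := h_pos_of_potential_pos hx
  rw [potential_pos_iff] at hx
  have hn0 : (0 : ℝ) < n := by positivity
  have h1 := Real.log_pos hx
  rw [Real.log_mul hh.ne' (Real.exp_pos _).ne', Real.log_exp] at h1
  rw [div_lt_iff₀ hn0]
  linarith

theorem monotoneOn_velocity (tr : Trajectory n k h s ξ p T)
    (ha : ∀ t ∈ T, 0 ≤ accel n k (ξ t) (p t)) : MonotoneOn p T :=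
  monotoneOn_of_hasDerivWithinAt_nonneg tr.curve.ordConnected.convex
    (fun t ht => (tr.curve.hasDerivAt_snd t ht).continuousAt.continuousWithinAt)
    (fun t ht => (tr.curve.hasDerivAt_snd t (interior_subset ht)).hasDerivWithinAt)
    (fun t ht => ha t (interior_subset ht))

theorem antitoneOn_velocity (tr : Trajectory n k h s ξ p T)
    (ha : ∀ t ∈ T, accel n k (ξ t) (p t) ≤ 0) : AntitoneOn p T :=
  antitoneOn_of_hasDerivWithinAt_nonpos tr.curve.ordConnected.convex
    (fun t ht => (tr.curve.hasDerivAt_snd t ht).continuousAt.continuousWithinAt)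
    (fun t ht => (tr.curve.hasDerivAt_snd t (interior_subset ht)).hasDerivWithinAt)
    (fun t ht => ha t (interior_subset ht))

theorem accel_neg_of_potentialDeriv_pos (hk : 1 < k) (tr : Trajectory n k h 1 ξ p T) {t : ℝ}
    (ht : t ∈ T) (hd : 0 < potentialDeriv n k h (ξ t)) : accel n k (ξ t) (p t) < 0 := by
  rw [tr.accel_eq hk ht]
  have h1 := tr.sign_pos t ht
  rw [one_mul] at h1
  have : (0 : ℝ) < k := by positivity
  exact div_neg_of_neg_of_pos (neg_neg_of_pos hd) (by positivity)

theorem accel_pos_of_potentialDeriv_neg (hk : 1 < k) (tr : Trajectory n k h 1 ξ p T) {t : ℝ}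
    (ht : t ∈ T) (hd : potentialDeriv n k h (ξ t) < 0) : 0 < accel n k (ξ t) (p t) := by
  rw [tr.accel_eq hk ht]
  have h1 := tr.sign_pos t ht
  rw [one_mul] at h1
  have : (0 : ℝ) < k := by positivity
  exact div_pos (neg_pos.2 hd) (by positivity)

/-- A global solution that converges to a point of the axis `p = 0` converges to a critical point
of the potential. -/
theorem potentialDeriv_eq_zero_of_tendsto (hk : 1 < k) (tr : Trajectory n k h s ξ p T)
    (hl : IsRightEnd T atTop) {x : ℝ} (hξ : Tendsto ξ atTop (𝓝 x)) (hp : Tendsto p atTop (𝓝 0)) :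
    potentialDeriv n k h x = 0 := by
  obtain ⟨t₀, ht₀⟩ := tr.curve.nonempty
  have hk0 : (k : ℝ) ≠ 0 := by positivity
  have hev := hl.eventually ht₀
  have h1 : Tendsto (fun t => accel n k (ξ t) (p t)) atTop
      (𝓝 (-potentialDeriv n k h x / (2 * k * (1 - (0 : ℝ) ^ 2) ^ (k - 1)))) := by
    have h2 : Tendsto (fun t => -potentialDeriv n k h (ξ t) / (2 * k * (1 - p t ^ 2) ^ (k - 1)))
        atTop (𝓝 (-potentialDeriv n k h x / (2 * k * (1 - (0 : ℝ) ^ 2) ^ (k - 1)))) :=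
      ((continuous_potentialDeriv.tendsto x).comp hξ).neg.div
        ((((hp.pow 2).const_sub 1).pow (k - 1)).const_mul (2 * (k : ℝ))) (by simp [hk0])
    refine h2.congr' ?_
    filter_upwards [hev] with t ht using (tr.accel_eq hk ht.1).symm
  have h2 := eq_zero_of_tendsto_of_tendsto_deriv
    (by filter_upwards [hev] with t ht using tr.curve.hasDerivAt_snd t ht.1) hp h1
  rw [div_eq_zero_iff, neg_eq_zero] at h2
  rcases h2 with h2 | h2
  · exact h2
  · simp [hk0] at h2

/-- A concave solution stops at its right end: it turns around, if necessary, and falls to the zero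
of the potential. -/
theorem concave_right (hn : 3 ≤ n) (hk : 1 < k) (tr : Trajectory n k h 1 ξ p T)
    (hl : IsRightEnd T l) {x₁ : ℝ} (hx₁ : ∀ t ∈ T, ξ t ≤ x₁)
    (hF : ∀ x ≤ x₁, 0 < potentialDeriv n k h x) :
    ∃ x, (∃ b, l = 𝓝[<] b) ∧ Tendsto ξ l (𝓝 x) ∧ Tendsto p l (𝓝 (-1)) ∧ potential n k h x = 0 := by
  have hanti := tr.antitoneOn_velocity fun t ht =>
    (tr.accel_neg_of_potentialDeriv_pos hk ht (hF _ (hx₁ t ht))).le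
  have hne := hl.neBot
  have hneg : ∃ t₁ ∈ T, p t₁ < 0 := by
    by_contra hcon
    push Not at hcon
    obtain ⟨t₀, ht₀⟩ := tr.curve.nonempty
    obtain ⟨x, hξ, hle, (⟨rfl, hp0, -⟩ | ⟨-, hp1, -⟩)⟩ := tr.limit_right hk hl ht₀ (Or.inl rfl)
      (m := x₁) (fun t ht _ => by linarith [hcon t ht]) (fun t ht _ => by linarith [hx₁ t ht])
    · have h1 := tr.potentialDeriv_eq_zero_of_tendsto hk hl hξ hp0
      have h2 : x ≤ x₁ := le_of_tendsto hξ (by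
        filter_upwards [hl.eventually ht₀] with t ht using hx₁ t ht.1)
      exact (hF x h2).ne' h1
    · have h1 : (1 : ℝ) ≤ p t₀ := le_of_tendsto hp1 (by
        filter_upwards [hl.eventually ht₀] with t ht using hanti ht₀ ht.1 ht.2)
      linarith [(tr.velocity_sq_lt_one ht₀).2]
  obtain ⟨t₁, ht₁, hpt₁⟩ := hneg
  obtain ⟨x, hξ, hle, (⟨rfl, hp0, -⟩ | ⟨hb, hp1, hx⟩)⟩ := tr.limit_right hk hl ht₁ (Or.inr rfl)
    (m := Real.log h / n)
    (fun t ht h => by linarith [hanti ht₁ ht h])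
    (fun t ht _ => by
      have := lower_bound_of_potential_pos hn (tr.potential_pos ht)
      rw [neg_div] at this
      linarith)
  · have h1 : (0 : ℝ) ≤ p t₁ := le_of_tendsto hp0 (by
      filter_upwards [hl.eventually ht₁] with t ht using hanti ht₁ ht.1 ht.2)
    linarith
  · exact ⟨x, hb, hξ, hp1, hx⟩

/-- A convex solution exists for all times to the right, and there `ξ → ∞`. -/
theorem convex_right (hk : 1 < k) (tr : Trajectory n k h 1 ξ p T)
    (hl : IsRightEnd T l) {x₁ : ℝ} (hx₁ : ∀ t ∈ T, x₁ ≤ ξ t)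
    (hF : ∀ x, x₁ ≤ x → potentialDeriv n k h x < 0 ∧ 0 < potential n k h x) :
    l = atTop ∧ Tendsto ξ l atTop ∧ ∀ᶠ t in l, 0 < p t := by
  have hmono := tr.monotoneOn_velocity fun t ht =>
    (tr.accel_pos_of_potentialDeriv_neg hk ht (hF _ (hx₁ t ht)).1).le
  have hne := hl.neBot
  have hpos : ∃ t₁ ∈ T, 0 < p t₁ := by
    by_contra hcon
    push Not at hcon
    obtain ⟨t₀, ht₀⟩ := tr.curve.nonempty
    obtain ⟨x, hξ, hle, (⟨rfl, hp0, -⟩ | ⟨-, hp1, -⟩)⟩ := tr.limit_right hk hl ht₀ (Or.inr rfl)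
      (m := -x₁)
      (fun t ht _ => by linarith [hcon t ht]) (fun t ht _ => by linarith [hx₁ t ht])
    · have h1 := tr.potentialDeriv_eq_zero_of_tendsto hk hl hξ hp0
      have h2 : x₁ ≤ x := ge_of_tendsto hξ (by
        filter_upwards [hl.eventually ht₀] with t ht using hx₁ t ht.1)
      exact (hF x h2).1.ne h1
    · have h1 : p t₀ ≤ -1 := ge_of_tendsto hp1 (by
        filter_upwards [hl.eventually ht₀] with t ht using hmono ht₀ ht.1 ht.2)
      linarith [(tr.velocity_sq_lt_one ht₀).1]
  obtain ⟨t₁, ht₁, hpt₁⟩ := hpos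
  have hp : ∀ t ∈ T, t₁ ≤ t → 0 ≤ 1 * p t := fun t ht h => by linarith [hmono ht₁ ht h]
  have hunb : ¬ ∃ m, ∀ t ∈ T, t₁ ≤ t → 1 * ξ t ≤ m := by
    rintro ⟨m, hm⟩
    obtain ⟨x, hξ, hle, (⟨rfl, hp0, -⟩ | ⟨-, -, hx⟩)⟩ := tr.limit_right hk hl ht₁ (Or.inl rfl) hp hm
    · have h1 : p t₁ ≤ 0 := ge_of_tendsto hp0 (by
        filter_upwards [hl.eventually ht₁] with t ht using hmono ht₁ ht.1 ht.2)
      linarith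
    · have h2 : x₁ ≤ x := ge_of_tendsto hξ (by
        filter_upwards [hl.eventually ht₁] with t ht using hx₁ t ht.1)
      exact (hF x h2).2.ne' hx
  have hinf := tr.tendsto_right_of_unbounded hl hp hunb
  refine ⟨tr.eq_atTop_of_unbounded hl ht₁ (C := 1)
    (fun t ht _ => by linarith [(tr.velocity_sq_lt_one ht).2]) hinf, by simpa using hinf, ?_⟩
  filter_upwards [hl.eventually ht₁] with t ht using hpt₁.trans_le (hmono ht₁ ht.1 ht.2)

theorem map_neg_map_neg (l : Filter ℝ) : map Neg.neg (map Neg.neg l) = l := by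
  rw [Filter.map_map]; simp

theorem concave_left (hn : 3 ≤ n) (hk : 1 < k) (tr : Trajectory n k h 1 ξ p T)
    (hl : IsLeftEnd T l) {x₁ : ℝ} (hx₁ : ∀ t ∈ T, ξ t ≤ x₁)
    (hF : ∀ x ≤ x₁, 0 < potentialDeriv n k h x) :
    ∃ x, (∃ a, l = 𝓝[>] a) ∧ Tendsto ξ l (𝓝 x) ∧ Tendsto p l (𝓝 1) ∧ potential n k h x = 0 := by
  obtain ⟨x, ⟨b, hb⟩, h1, h2, h3⟩ := tr.reflect.concave_right hn hk
    (isRightEnd_preimage_neg_iff.2 hl) (fun t ht => hx₁ (-t) ht) hF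
  rw [tendsto_map'_iff] at h1 h2
  refine ⟨x, ⟨-b, ?_⟩, by simpa [Function.comp_def] using h1, ?_, h3⟩
  · rw [← map_neg_map_neg l, hb]; simp
  · have := h2.neg
    simpa [Function.comp_def] using this

theorem convex_left (hk : 1 < k) (tr : Trajectory n k h 1 ξ p T)
    (hl : IsLeftEnd T l) {x₁ : ℝ} (hx₁ : ∀ t ∈ T, x₁ ≤ ξ t)
    (hF : ∀ x, x₁ ≤ x → potentialDeriv n k h x < 0 ∧ 0 < potential n k h x) :
    l = atBot ∧ Tendsto ξ l atTop ∧ ∀ᶠ t in l, p t < 0 := by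
  obtain ⟨hb, h1, h2⟩ := tr.reflect.convex_right hk
    (isRightEnd_preimage_neg_iff.2 hl) (fun t ht => hx₁ (-t) ht) hF
  rw [tendsto_map'_iff] at h1
  refine ⟨?_, by simpa [Function.comp_def] using h1, ?_⟩
  · rw [← map_neg_map_neg l, hb, Filter.map_neg_atTop]
  · rw [Filter.eventually_map] at h2
    filter_upwards [h2] with t ht
    simpa using ht

end Trajectory

/-! ### From phase curves back to radial solutions -/

section

variable {T : Set ℝ} {l : Filter ℝ} {a b : ℝ}

theorem nhdsLT_ne_atTop (b : ℝ) : 𝓝[<] b ≠ atTop := fun h => by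
  have h1 : Tendsto id (𝓝[<] b) (𝓝 b) := tendsto_id.mono_left nhdsWithin_le_nhds
  rw [h] at h1
  exact not_tendsto_nhds_of_tendsto_atTop tendsto_id _ h1

theorem IsRightEnd.of_atTop (h : IsRightEnd T atTop) : ∀ t ∈ T, Ici t ⊆ T := by
  rcases h with ⟨-, h⟩ | ⟨b, hb, -⟩
  · exact h
  · exact absurd hb.symm (nhdsLT_ne_atTop b)

theorem IsRightEnd.of_nhdsLT (h : IsRightEnd T (𝓝[<] b)) : ∀ t ∈ T, t < b ∧ Ico t b ⊆ T := by
  rcases h with ⟨hb, -⟩ | ⟨b', hb, h⟩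
  · exact absurd hb (nhdsLT_ne_atTop b)
  · have h1 : Tendsto id (𝓝[<] b) (𝓝 b) := tendsto_id.mono_left nhdsWithin_le_nhds
    have h2 : Tendsto id (𝓝[<] b) (𝓝 b') := by
      rw [hb]; exact tendsto_id.mono_left nhdsWithin_le_nhds
    rwa [tendsto_nhds_unique h1 h2]

theorem nhdsGT_ne_atBot (a : ℝ) : 𝓝[>] a ≠ atBot := fun h => by
  have h1 : Tendsto id (𝓝[>] a) (𝓝 a) := tendsto_id.mono_left nhdsWithin_le_nhds
  rw [h] at h1
  exact not_tendsto_nhds_of_tendsto_atBot tendsto_id _ h1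

theorem IsLeftEnd.of_atBot (h : IsLeftEnd T atBot) : ∀ t ∈ T, Iic t ⊆ T := by
  rcases h with ⟨-, h⟩ | ⟨b, hb, -⟩
  · exact h
  · exact absurd hb.symm (nhdsGT_ne_atBot b)

theorem IsLeftEnd.of_nhdsGT (h : IsLeftEnd T (𝓝[>] a)) : ∀ t ∈ T, a < t ∧ Ioc a t ⊆ T := by
  rcases h with ⟨hb, -⟩ | ⟨b', hb, h⟩
  · exact absurd hb (nhdsGT_ne_atBot a)
  · have h1 : Tendsto id (𝓝[>] a) (𝓝 a) := tendsto_id.mono_left nhdsWithin_le_nhds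
    have h2 : Tendsto id (𝓝[>] a) (𝓝 b') := by
      rw [hb]; exact tendsto_id.mono_left nhdsWithin_le_nhds
    rwa [tendsto_nhds_unique h1 h2]

/-- The domain of a solution, read off from the ends of the interval of `t = ln r`. -/
theorem radii_eq_Ioi (hne : T.Nonempty) (hl : IsLeftEnd T atBot) (hr : IsRightEnd T atTop) :
    radii T = Ioi 0 := by
  obtain ⟨t₀, ht₀⟩ := hne
  ext r
  refine ⟨fun h => h.1, fun h => ⟨h, ?_⟩⟩
  rcases le_total (Real.log r) t₀ with h1 | h1
  · exact hl.of_atBot t₀ ht₀ h1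
  · exact hr.of_atTop t₀ ht₀ h1

theorem radii_eq_Ioo_zero (hne : T.Nonempty) (hl : IsLeftEnd T atBot) (hr : IsRightEnd T (𝓝[<] b)) :
    radii T = Ioo 0 (Real.exp b) := by
  obtain ⟨t₀, ht₀⟩ := hne
  ext r
  constructor
  · intro h
    exact ⟨h.1, by rw [← Real.log_lt_iff_lt_exp h.1]; exact (hr.of_nhdsLT _ h.2).1⟩
  · intro h
    refine ⟨h.1, ?_⟩
    rcases le_total (Real.log r) t₀ with h1 | h1
    · exact hl.of_atBot t₀ ht₀ h1
    · exact (hr.of_nhdsLT t₀ ht₀).2 ⟨h1, by rw [Real.log_lt_iff_lt_exp h.1]; exact h.2⟩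

theorem radii_eq_Ioo (hne : T.Nonempty) (hl : IsLeftEnd T (𝓝[>] a)) (hr : IsRightEnd T (𝓝[<] b)) :
    radii T = Ioo (Real.exp a) (Real.exp b) ∧ a < b := by
  obtain ⟨t₀, ht₀⟩ := hne
  refine ⟨?_, (hl.of_nhdsGT t₀ ht₀).1.trans (hr.of_nhdsLT t₀ ht₀).1⟩
  ext r
  constructor
  · intro h
    exact ⟨by rw [← Real.lt_log_iff_exp_lt h.1]; exact (hl.of_nhdsGT _ h.2).1,
      by rw [← Real.log_lt_iff_lt_exp h.1]; exact (hr.of_nhdsLT _ h.2).1⟩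
  · intro h
    have h0 : 0 < r := (Real.exp_pos a).trans h.1
    refine ⟨h0, ?_⟩
    rcases le_total (Real.log r) t₀ with h1 | h1
    · exact (hl.of_nhdsGT t₀ ht₀).2 ⟨by rw [Real.lt_log_iff_exp_lt h0]; exact h.1, h1⟩
    · exact (hr.of_nhdsLT t₀ ht₀).2 ⟨h1, by rw [Real.log_lt_iff_lt_exp h0]; exact h.2⟩

theorem tendsto_log_nhdsLT_exp (b : ℝ) : Tendsto Real.log (𝓝[<] (Real.exp b)) (𝓝[<] b) := by
  have h : Tendsto Real.log (𝓝 (Real.exp b)) (𝓝 b) := by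
    simpa using (Real.continuousAt_log (Real.exp_pos b).ne').tendsto
  refine tendsto_nhdsWithin_iff.2 ⟨h.mono_left nhdsWithin_le_nhds, ?_⟩
  filter_upwards [Ioo_mem_nhdsLT (Real.exp_pos b)] with r hr
  rw [mem_Iio, Real.log_lt_iff_lt_exp hr.1]; exact hr.2

theorem tendsto_log_nhdsGT_exp (a : ℝ) : Tendsto Real.log (𝓝[>] (Real.exp a)) (𝓝[>] a) := by
  have h : Tendsto Real.log (𝓝 (Real.exp a)) (𝓝 a) := by
    simpa using (Real.continuousAt_log (Real.exp_pos a).ne').tendsto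
  refine tendsto_nhdsWithin_iff.2 ⟨h.mono_left nhdsWithin_le_nhds, ?_⟩
  filter_upwards [self_mem_nhdsWithin] with r hr
  rw [mem_Ioi, Real.lt_log_iff_exp_lt ((Real.exp_pos a).trans hr)]; exact hr

end

/-- A maximal radial solution with first integral `h` and sign `s` of `1 - ξ_t²`. -/
structure RadialTrajectory (n k : ℕ) (h s : ℝ) (v : ℝ → ℝ) (S : Set ℝ) : Prop where
  maximal : IsMaximalRadialSolution n k v S
  traj : Trajectory n k h s (xi v) (xit v) (Real.exp ⁻¹' S)

namespace RadialTrajectory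

variable {n k : ℕ} {h s : ℝ} {v : ℝ → ℝ} {S : Set ℝ} {lr : Filter ℝ}

theorem pos (rt : RadialTrajectory n k h s v S) {r : ℝ} (hr : r ∈ S) : 0 < r :=
  rt.maximal.1.subset_pos hr

theorem log_mem (rt : RadialTrajectory n k h s v S) {r : ℝ} (hr : r ∈ S) :
    Real.log r ∈ Real.exp ⁻¹' S := by
  rwa [mem_preimage, Real.exp_log (rt.pos hr)]

theorem radii_eq (rt : RadialTrajectory n k h s v S) : radii (Real.exp ⁻¹' S) = S :=
  radii_preimage_exp rt.maximal.1.subset_pos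

theorem apply_eq (rt : RadialTrajectory n k h s v S) {r : ℝ} (hr : r ∈ S) :
    v r = r * Real.exp (xi v (Real.log r)) :=
  eq_mul_exp_xi (rt.pos hr) (rt.maximal.1.pos r hr)

theorem confFactor_eq (rt : RadialTrajectory n k h s v S) {r : ℝ} (hr : r ∈ S) :
    confFactor v r = Real.exp (-2 * (xi v (Real.log r) + Real.log r)) := by
  rw [confFactor, rt.apply_eq hr]
  nth_rewrite 1 [← Real.exp_log (rt.pos hr)]
  rw [← Real.exp_add, ← Real.exp_nat_mul, ← Real.exp_neg]
  congr 1
  push_cast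
  ring

theorem hasDerivAt (rt : RadialTrajectory n k h s v S) {r : ℝ} (hr : r ∈ S) :
    HasDerivAt v ((1 + xit v (Real.log r)) * Real.exp (xi v (Real.log r))) r :=
  hasDerivAt_of_log_variable rt.traj.curve.isOpen
    (fun r => by rw [← mem_radii, rt.radii_eq]) rt.traj.curve.hasDerivAt_fst
    (fun r hr => rt.apply_eq hr) hr

theorem deriv_deriv_eq (rt : RadialTrajectory n k h s v S) {r : ℝ} (hr : r ∈ S) :
    deriv (deriv v) r = (accel n k (xi v (Real.log r)) (xit v (Real.log r)) +
      (1 + xit v (Real.log r)) * xit v (Real.log r)) *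
        Real.exp (xi v (Real.log r) - Real.log r) := by
  have h1 : deriv v =ᶠ[𝓝 r]
      fun r => (1 + xit v (Real.log r)) * Real.exp (xi v (Real.log r)) := by
    filter_upwards [rt.maximal.1.isOpen.mem_nhds hr] with r hr using (rt.hasDerivAt hr).deriv
  rw [h1.deriv_eq]
  exact (hasDerivAt_deriv_of_log_variable rt.traj.curve.hasDerivAt_fst
    rt.traj.curve.hasDerivAt_snd (rt.pos hr) (rt.log_mem hr)).deriv

theorem eventually_mem {l : Filter ℝ}
    (hl : ∀ᶠ t in l, t ∈ Real.exp ⁻¹' S) (hlog : Tendsto Real.log lr l)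
    (hpos : ∀ᶠ r in lr, 0 < r) : ∀ᶠ r in lr, r ∈ S := by
  filter_upwards [hlog.eventually hl, hpos] with r h1 h2
  rwa [mem_preimage, Real.exp_log h2] at h1

/-- Where a solution reaches the singular set `ξ_t² = 1` in finite time, `v_rr` blows up. -/
theorem secondDerivBlowsUp (hn : 3 ≤ n) (hk : 1 < k) (rt : RadialTrajectory n k h s v S) {b x ε : ℝ}
    (hS : ∀ᶠ r in lr, r ∈ S) (hlog : Tendsto Real.log lr (𝓝 b)) (hε : ε ^ 2 = 1)
    (hξ : Tendsto (fun r => xi v (Real.log r)) lr (𝓝 x))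
    (hp : Tendsto (fun r => xit v (Real.log r)) lr (𝓝 ε)) (hx : potential n k h x = 0) :
    SecondDerivBlowsUp v lr := by
  have hk0 : (0 : ℝ) < k := by positivity
  have hn0 : (0 : ℝ) < n := by positivity
  have hden : Tendsto (fun r => |2 * (k : ℝ) * (1 - xit v (Real.log r) ^ 2) ^ (k - 1)|) lr
      (𝓝[>] 0) := by
    refine tendsto_nhdsWithin_iff.2 ⟨?_, ?_⟩
    · have h1 := ((((hp.pow 2).const_sub 1).pow (k - 1)).const_mul (2 * (k : ℝ))).abs
      rw [hε, sub_self, zero_pow (by omega), mul_zero, abs_zero] at h1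
      exact h1
    · filter_upwards [hS] with r hr
      have := rt.traj.curve.sq_ne_one _ (rt.log_mem hr)
      exact abs_pos.2 (mul_ne_zero (by positivity) (pow_ne_zero _ this))
  have hnum : Tendsto (fun r => |(-potentialDeriv n k h (xi v (Real.log r)))|) lr
      (𝓝 (|(-potentialDeriv n k h x)|)) := ((continuous_potentialDeriv.tendsto x).comp hξ).neg.abs
  have hc : 0 < |(-potentialDeriv n k h x)| := by
    rw [abs_neg, potentialDeriv_of_potential_eq_zero hx]
    exact abs_pos.2 (by positivity)
  have hacc : Tendsto (fun r => |accel n k (xi v (Real.log r)) (xit v (Real.log r))|) lr atTop := by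
    refine (hnum.pos_mul_atTop hc hden.inv_tendsto_nhdsGT_zero).congr' ?_
    filter_upwards [hS] with r hr
    rw [rt.traj.accel_eq hk (rt.log_mem hr), abs_div]
    rfl
  have hrest : Tendsto (fun r => -|(1 + xit v (Real.log r)) * xit v (Real.log r)|) lr
      (𝓝 (-|(1 + ε) * ε|)) := ((hp.const_add 1).mul hp).abs.neg
  have hsum : Tendsto (fun r => |accel n k (xi v (Real.log r)) (xit v (Real.log r)) +
      (1 + xit v (Real.log r)) * xit v (Real.log r)|) lr atTop := by
    refine tendsto_atTop_mono (fun r => ?_) (hacc.atTop_add hrest)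
    have := abs_sub_abs_le_abs_sub (accel n k (xi v (Real.log r)) (xit v (Real.log r)))
      (-((1 + xit v (Real.log r)) * xit v (Real.log r)))
    rw [abs_neg, sub_neg_eq_add] at this
    linarith
  have hexp : Tendsto (fun r => Real.exp (xi v (Real.log r) - Real.log r)) lr
      (𝓝 (Real.exp (x - b))) := (hξ.sub hlog).rexp
  refine (hsum.atTop_mul_pos (Real.exp_pos _) hexp).congr' ?_
  filter_upwards [hS] with r hr
  rw [rt.deriv_deriv_eq hr, abs_mul, abs_of_pos (Real.exp_pos _)]

theorem stopsAt (hn : 3 ≤ n) (hk : 1 < k) (rt : RadialTrajectory n k h s v S) {b x : ℝ}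
    (hS : ∀ᶠ r in lr, r ∈ S) (hlog : Tendsto Real.log lr (𝓝 b))
    (hξ : Tendsto (fun r => xi v (Real.log r)) lr (𝓝 x))
    (hp : Tendsto (fun r => xit v (Real.log r)) lr (𝓝 (-1))) (hx : potential n k h x = 0) :
    StopsAt v lr := by
  refine ⟨⟨Real.exp b * Real.exp x, by positivity, ?_⟩, ?_,
    rt.secondDerivBlowsUp hn hk hS hlog (by norm_num) hξ hp hx⟩
  · refine (hlog.rexp.mul hξ.rexp).congr' ?_
    filter_upwards [hS] with r hr
    rw [rt.apply_eq hr, Real.exp_log (rt.pos hr)]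
  · have h1 := (hp.const_add 1).mul hξ.rexp
    rw [show (1 + (-1 : ℝ)) * Real.exp x = 0 by ring] at h1
    refine h1.congr' ?_
    filter_upwards [hS] with r hr using (rt.hasDerivAt hr).deriv.symm

theorem inversion (hn : 3 ≤ n) (hk : 1 < k) (hkn : k ≤ n) (rt : RadialTrajectory n k h s v S) :
    RadialTrajectory n k h s (inversion v) {r : ℝ | r⁻¹ ∈ S} := by
  have hm := IsMaximalRadialSolution.inversion hn hk hkn rt.maximal
  have hmax := isMaximalPhaseCurve_of_isMaximalRadialSolution hn hk hkn hm
  have hT : Real.exp ⁻¹' {r : ℝ | r⁻¹ ∈ S} = Neg.neg ⁻¹' (Real.exp ⁻¹' S) := by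
    ext t
    simp [Real.exp_neg]
  have hξ : EqOn (fun t => xi v (-t)) (xi (SigmaK.inversion v)) (Neg.neg ⁻¹' (Real.exp ⁻¹' S)) :=
    fun t ht => (xi_inversion (rt.maximal.1.pos _ ht)).symm
  have hp : EqOn (fun t => -xit v (-t)) (xit (SigmaK.inversion v))
      (Neg.neg ⁻¹' (Real.exp ⁻¹' S)) := by
    refine rt.traj.reflect.curve.eqOn_snd hmax.1 ?_ hξ
    rw [hT]
  refine ⟨hm, hmax, fun t ht => ?_, rt.traj.sign_eq, fun t ht => ?_⟩
  · rw [hT] at ht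
    rw [← hp ht, ← hξ ht]
    exact rt.traj.reflect.energy t ht
  · rw [hT] at ht
    rw [← hp ht]
    exact rt.traj.reflect.sign_pos t ht

theorem xit_inversion (hn : 3 ≤ n) (hk : 1 < k) (hkn : k ≤ n) (rt : RadialTrajectory n k h s v S)
    {t : ℝ} (ht : Real.exp (-t) ∈ S) : xit (SigmaK.inversion v) t = -xit v (-t) := by
  have hm := IsMaximalRadialSolution.inversion hn hk hkn rt.maximal
  have hmax := isMaximalPhaseCurve_of_isMaximalRadialSolution hn hk hkn hm
  have hT : Real.exp ⁻¹' {r : ℝ | r⁻¹ ∈ S} = Neg.neg ⁻¹' (Real.exp ⁻¹' S) := by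
    ext t
    simp [Real.exp_neg]
  have hξ : EqOn (fun t => xi v (-t)) (xi (SigmaK.inversion v)) (Neg.neg ⁻¹' (Real.exp ⁻¹' S)) :=
    fun t ht => (xi_inversion (rt.maximal.1.pos _ ht)).symm
  exact (rt.traj.reflect.curve.eqOn_snd hmax.1 (by rw [hT]) hξ (x := t) ht).symm

end RadialTrajectory

/-! ### Elementary asymptotics -/

theorem tendsto_div_id_atBot {u u' : ℝ → ℝ} {c : ℝ} (hd : ∀ᶠ t in atBot, HasDerivAt u (u' t) t)
    (hu' : Tendsto u' atBot (𝓝 c)) : Tendsto (fun t => u t / t) atBot (𝓝 c) := by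
  have key : (fun t => u t - c * t) =o[atBot] fun t : ℝ => t := by
    rw [isLittleO_iff]
    intro ε hε
    have h1 : ∀ᶠ t in atBot, |u' t - c| ≤ ε / 2 := by
      filter_upwards [hu'.eventually (Metric.closedBall_mem_nhds c (half_pos hε))] with t ht
      exact ht
    obtain ⟨t₁, ht₁⟩ := eventually_atBot.1 (hd.and h1)
    filter_upwards [eventually_le_atBot t₁, eventually_le_atBot (0 : ℝ),
      eventually_le_atBot (-(2 / ε * (|u t₁ - c * t₁| + ε / 2 * |t₁|)))] with t ht ht0 ht2
    have h2 := Convex.norm_image_sub_le_of_norm_hasDerivWithin_le (f := fun t => u t - c * t)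
      (f' := fun t => u' t - c) (s := Iic t₁) (x := t₁) (y := t) (C := ε / 2)
      (fun r hr => by
        have := ((ht₁ r hr).1.sub ((hasDerivAt_id r).const_mul c)).hasDerivWithinAt (s := Iic t₁)
        rwa [mul_one] at this)
      (fun r hr => (ht₁ r hr).2) (convex_Iic t₁) (mem_Iic.2 le_rfl) ht
    simp only [Real.norm_eq_abs] at h2 ⊢
    have h3 : |u t - c * t| ≤ |u t - c * t - (u t₁ - c * t₁)| + |u t₁ - c * t₁| := by
      have := abs_add_le (u t - c * t - (u t₁ - c * t₁)) (u t₁ - c * t₁)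
      rwa [sub_add_cancel] at this
    have h4 : |t - t₁| ≤ |t| + |t₁| := abs_sub _ _
    have h5 : |u t₁ - c * t₁| + ε / 2 * |t₁| ≤ ε / 2 * |t| := by
      rw [abs_of_nonpos ht0]
      have : 2 / ε * (|u t₁ - c * t₁| + ε / 2 * |t₁|) ≤ -t := by linarith
      rw [div_mul_eq_mul_div, div_le_iff₀ hε] at this
      linarith
    nlinarith
  have h := (key.tendsto_div_nhds_zero).add_const c
  rw [zero_add] at h
  refine h.congr' ?_
  filter_upwards [eventually_lt_atBot (0 : ℝ)] with t ht
  field_simp [ht.ne]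
  ring

theorem tendsto_div_id_atTop {u u' : ℝ → ℝ} {c : ℝ} (hd : ∀ᶠ t in atTop, HasDerivAt u (u' t) t)
    (hu' : Tendsto u' atTop (𝓝 c)) : Tendsto (fun t => u t / t) atTop (𝓝 c) := by
  have h1 := tendsto_div_id_atBot (u := fun t => u (-t)) (u' := fun t => -u' (-t)) (c := -c)
    (by
      filter_upwards [tendsto_neg_atBot_atTop.eventually hd] with t ht
      have := ht.comp t (hasDerivAt_neg t)
      rwa [mul_neg_one] at this)
    (hu'.comp tendsto_neg_atBot_atTop).neg
  have h2 := (h1.comp tendsto_neg_atTop_atBot).neg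
  rw [neg_neg] at h2
  refine h2.congr fun t => ?_
  simp [div_neg]

/-- A function whose derivative is `O(e^{βt})` as `t → -∞` varies by `O(e^{βt})`. -/
theorem abs_sub_le_of_deriv_le_exp {z z' : ℝ → ℝ} {C β t₁ : ℝ} (hβ : 0 < β)
    (hd : ∀ t ≤ t₁, HasDerivAt z (z' t) t) (hb : ∀ t ≤ t₁, |z' t| ≤ C * Real.exp (β * t))
    {a b : ℝ} (hab : a ≤ b) (hb₁ : b ≤ t₁) :
    |z b - z a| ≤ C / β * (Real.exp (β * b) - Real.exp (β * a)) := by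
  have he : ∀ t, HasDerivAt (fun t => C / β * (Real.exp (β * t) - Real.exp (β * a)))
      (C * Real.exp (β * t)) t := by
    intro t
    have := ((((hasDerivAt_id t).const_mul β).exp).sub_const (Real.exp (β * a))).const_mul (C / β)
    convert! this using 1
    simp only [id]
    field_simp
  exact image_norm_le_of_norm_deriv_right_le_deriv_boundary (f := fun t => z t - z a) (f' := z')
    (a := a) (b := b)
    (B := fun t => C / β * (Real.exp (β * t) - Real.exp (β * a)))
    (B' := fun t => C * Real.exp (β * t))
    (fun t ht => ((hd t (ht.2.trans hb₁)).sub_const _).continuousAt.continuousWithinAt)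
    (fun t ht => ((hd t (ht.2.le.trans hb₁)).sub_const _).hasDerivWithinAt) (by simp)
    he (fun t ht => hb t (ht.2.le.trans hb₁)) ⟨hab, le_rfl⟩

theorem exists_tendsto_of_deriv_le_exp {z z' : ℝ → ℝ} {C β t₁ : ℝ} (hβ : 0 < β)
    (hd : ∀ t ≤ t₁, HasDerivAt z (z' t) t) (hb : ∀ t ≤ t₁, |z' t| ≤ C * Real.exp (β * t)) :
    ∃ L, Tendsto z atBot (𝓝 L) := by
  have hexp : Tendsto (fun t => C / β * Real.exp (β * t)) atBot (𝓝 0) := by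
    have := (Real.tendsto_exp_atBot.comp (tendsto_id.const_mul_atBot hβ)).const_mul (C / β)
    simpa using this
  have hC : 0 ≤ C := by
    have := (abs_nonneg _).trans (hb t₁ le_rfl)
    exact nonneg_of_mul_nonneg_left this (Real.exp_pos _)
  refine cauchy_map_iff_exists_tendsto.1 ?_
  rw [Metric.cauchy_iff]
  refine ⟨inferInstance, fun ε hε => ?_⟩
  obtain ⟨t₂, ht₂⟩ := eventually_atBot.1 (hexp.eventually (gt_mem_nhds hε))
  refine ⟨z '' Iic (min t₁ t₂), image_mem_map (Iic_mem_atBot _), ?_⟩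
  have key : ∀ a b, a ≤ b → b ≤ min t₁ t₂ → |z b - z a| < ε := by
    intro a b hab hbm
    have h1 := abs_sub_le_of_deriv_le_exp hβ hd hb hab (hbm.trans (min_le_left _ _))
    have h2 := ht₂ b (hbm.trans (min_le_right _ _))
    have h3 : 0 ≤ C / β * Real.exp (β * a) := by positivity
    rw [mul_sub] at h1
    linarith
  rintro _ ⟨a, ha, rfl⟩ _ ⟨b, hb', rfl⟩
  rw [Real.dist_eq]
  rcases le_total a b with h | h
  · rw [abs_sub_comm]; exact key a b h hb'
  · exact key b a h ha

theorem abs_rpow_sub_rpow_le {a b r : ℝ} (ha : 0 ≤ a) (hb : 0 ≤ b) (hr0 : 0 ≤ r) (hr : r ≤ 1) :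
    |a ^ r - b ^ r| ≤ |a - b| ^ r := by
  have key : ∀ a b : ℝ, 0 ≤ b → b ≤ a → |a ^ r - b ^ r| ≤ |a - b| ^ r := by
    intro a b hb hab
    have h1 := Real.rpow_add_le_add_rpow (sub_nonneg.2 hab) hb hr0 hr
    rw [sub_add_cancel] at h1
    rw [abs_of_nonneg (sub_nonneg.2 (Real.rpow_le_rpow hb hab hr0)), abs_of_nonneg
      (sub_nonneg.2 hab)]
    linarith
  rcases le_total b a with h | h
  · exact key a b hb h
  · rw [abs_sub_comm, abs_sub_comm a]
    exact key b a ha h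

/-! ### Asymptotics as `t → -∞` -/

section

variable {n k : ℕ} {h s : ℝ}

theorem profile_eq (hk : 1 < k) (x : ℝ) : profile n k h s x =
    s * (Real.exp (-(2 - (n : ℝ) / k) * x) * |h - Real.exp (-(n * x))| ^ (1 / (k : ℝ))) := by
  have hk0 : (k : ℝ) ≠ 0 := by positivity
  rw [profile, potential_eq', abs_mul, abs_of_pos (Real.exp_pos _),
    Real.mul_rpow (Real.exp_pos _).le (abs_nonneg _), ← Real.exp_mul,
    show ((n : ℝ) - 2 * k) * x * (1 / k) = -(2 - (n : ℝ) / k) * x by field_simp; ring]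

theorem profile_eq' (hk : 1 < k) (x : ℝ) : profile n k h s x =
    s * (Real.exp (-(2 * x)) * |h * Real.exp (n * x) - 1| ^ (1 / (k : ℝ))) := by
  have hk0 : (k : ℝ) ≠ 0 := by positivity
  rw [profile, potential_eq, abs_mul, abs_of_pos (Real.exp_pos _),
    Real.mul_rpow (Real.exp_pos _).le (abs_nonneg _), ← Real.exp_mul,
    show -(2 * (k : ℝ)) * x * (1 / k) = -(2 * x) by field_simp]

theorem tendsto_exp_neg_mul_atTop {c : ℝ} (hc : 0 < c) :
    Tendsto (fun x => Real.exp (-(c * x))) atTop (𝓝 0) :=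
  Real.tendsto_exp_neg_atTop_nhds_zero.comp (tendsto_id.const_mul_atTop hc)

theorem tendsto_abs_sub_exp_rpow (hn : 3 ≤ n) :
    Tendsto (fun x => |h - Real.exp (-(n * x))| ^ (1 / (k : ℝ))) atTop (𝓝 (kthRoot k h)) := by
  have h1 := ((tendsto_exp_neg_mul_atTop (c := (n : ℝ)) (by positivity)).const_sub h).abs
  rw [sub_zero] at h1
  exact h1.rpow_const (Or.inr (by positivity))

theorem tendsto_profile_atTop_of_lt (hn : 3 ≤ n) (hk : 1 < k) (hnk : n < 2 * k) :
    Tendsto (profile n k h s) atTop (𝓝 0) := by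
  have hk0 : (0 : ℝ) < k := by positivity
  have hα : 0 < 2 - (n : ℝ) / k := by
    rw [sub_pos, div_lt_iff₀ hk0]; exact_mod_cast hnk
  have h1 := ((tendsto_exp_neg_mul_atTop hα).mul
    (tendsto_abs_sub_exp_rpow (h := h) (k := k) hn)).const_mul s
  rw [zero_mul, mul_zero] at h1
  refine h1.congr fun x => ?_
  rw [profile_eq hk, neg_mul]

theorem tendsto_profile_atTop_of_eq (hn : 3 ≤ n) (hk : 1 < k) (hnk : 2 * k = n) :
    Tendsto (profile n k h s) atTop (𝓝 (s * kthRoot k h)) := by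
  have hk0 : (k : ℝ) ≠ 0 := by positivity
  have hα : 2 - (n : ℝ) / k = 0 := by
    rw [← hnk]; push_cast; field_simp; norm_num
  refine ((tendsto_abs_sub_exp_rpow (h := h) (k := k) hn).const_mul s).congr fun x => ?_
  rw [profile_eq hk, hα]
  simp

theorem kthRoot_nonneg (k : ℕ) (h : ℝ) : 0 ≤ kthRoot k h := Real.rpow_nonneg (abs_nonneg _) _

theorem kthRoot_pos (k : ℕ) {h : ℝ} (hh : h ≠ 0) : 0 < kthRoot k h :=
  Real.rpow_pos_of_pos (abs_pos.2 hh) _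

end

namespace Trajectory

variable {n k : ℕ} {h s : ℝ} {ξ p : ℝ → ℝ} {T : Set ℝ} {l : Filter ℝ}

theorem velocity_eq_neg_sqrt (hk : 1 < k) (tr : Trajectory n k h s ξ p T) {t : ℝ} (ht : t ∈ T)
    (hp : p t ≤ 0) : p t = -Real.sqrt (1 - profile n k h s (ξ t)) := by
  rw [← tr.one_sub_sq hk ht, show 1 - (1 - p t ^ 2) = (-p t) ^ 2 by ring,
    Real.sqrt_sq (by linarith)]
  ring

/-- A decreasing branch of `ξ` solves `ξ_t = -√(1 - profile ξ)`, so the limit of `ξ_t` is that of the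
right hand side. -/
theorem tendsto_velocity (hk : 1 < k) (tr : Trajectory n k h s ξ p T) {w : ℝ} {lx : Filter ℝ}
    (hp : ∀ᶠ t in l, t ∈ T ∧ p t ≤ 0) (hξ : Tendsto ξ l lx)
    (hw : Tendsto (profile n k h s) lx (𝓝 w)) : Tendsto p l (𝓝 (-Real.sqrt (1 - w))) := by
  refine (((hw.comp hξ).const_sub 1).sqrt.neg).congr' ?_
  filter_upwards [hp] with t ht
  exact (tr.velocity_eq_neg_sqrt hk ht.1 ht.2).symm

/-- Linear growth of `ξ` at `-∞` when the velocity has a negative limit. -/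
theorem exists_linear_lower_bound (tr : Trajectory n k h s ξ p T) {β : ℝ} (hβ : 0 < β)
    (hT : ∀ᶠ t in atBot, t ∈ T) (hp : Tendsto p atBot (𝓝 (-β))) :
    ∃ C, ∀ᶠ t in atBot, -(β / 2) * t - C ≤ ξ t := by
  obtain ⟨t₁, ht₁⟩ := eventually_atBot.1 (hT.and
    (hp.eventually (gt_mem_nhds (show -β < -(β / 2) by linarith))))
  refine ⟨-(β / 2) * t₁ - ξ t₁, ?_⟩
  filter_upwards [eventually_le_atBot t₁] with t ht
  have hanti : AntitoneOn (fun t => ξ t + β / 2 * t) (Iic t₁) := by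
    refine antitoneOn_of_hasDerivWithinAt_nonpos (convex_Iic _) (f' := fun t => p t + β / 2) ?_ ?_ ?_
    · exact fun r hr => ((tr.curve.hasDerivAt_fst r (ht₁ r hr).1).add
        ((hasDerivAt_id r).const_mul (β / 2))).continuousAt.continuousWithinAt
    · intro r hr
      have := (tr.curve.hasDerivAt_fst r (ht₁ r (mem_Iic.1 (interior_subset hr))).1).add
        ((hasDerivAt_id r).const_mul (β / 2))
      rw [mul_one] at this
      exact this.hasDerivWithinAt
    · intro r hr
      linarith [(ht₁ r (mem_Iic.1 (interior_subset hr))).2]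
  have := hanti (mem_Iic.2 ht) (mem_Iic.2 le_rfl) ht
  simp only at this
  linarith

/-- Asymptotics of a solution with `ξ → ∞` as `t → -∞`, for `2k > n`: the function `ξ + t` has a
finite limit, and `1 + ξ_t` is asymptotic to a multiple of `e^{(2-n/k)t}`. -/
theorem asymptotics_of_lt (hn : 3 ≤ n) (hk : 1 < k) (hnk : n < 2 * k)
    (tr : Trajectory n k h s ξ p T) (hT : ∀ᶠ t in atBot, t ∈ T) (hp : ∀ᶠ t in atBot, p t < 0)
    (hξ : Tendsto ξ atBot atTop) :
    ∃ L, Tendsto (fun t => ξ t + t) atBot (𝓝 L) ∧ Tendsto p atBot (𝓝 (-1)) ∧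
      Tendsto (fun t => (1 + p t) / Real.exp ((2 - (n : ℝ) / k) * t)) atBot
        (𝓝 (s * kthRoot k h * Real.exp (-(2 - (n : ℝ) / k) * L) / 2)) := by
  have hk0 : (0 : ℝ) < k := by positivity
  set α := 2 - (n : ℝ) / k with hα_def
  have hα : 0 < α := by
    rw [sub_pos, div_lt_iff₀ hk0]; exact_mod_cast hnk
  have hpT : ∀ᶠ t in atBot, t ∈ T ∧ p t ≤ 0 := by
    filter_upwards [hT, hp] with t h1 h2 using ⟨h1, h2.le⟩
  have hp1 : Tendsto p atBot (𝓝 (-1)) := by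
    have := tr.tendsto_velocity hk hpT hξ (tendsto_profile_atTop_of_lt hn hk hnk)
    simpa using this
  obtain ⟨C₀, hC₀⟩ := tr.exists_linear_lower_bound one_pos hT hp1
  have hroot := (tendsto_abs_sub_exp_rpow (h := h) (k := k) hn).comp hξ
  have hs1 : |s| = 1 := by rcases tr.sign_eq with rfl | rfl <;> norm_num
  have hfac : ∀ t ∈ T, (1 + p t) * (1 - p t) =
      s * (Real.exp (-α * ξ t) * |h - Real.exp (-(n * ξ t))| ^ (1 / (k : ℝ))) := by
    intro t ht
    rw [← profile_eq hk, ← tr.one_sub_sq hk ht]; ring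
  have hd : ∀ᶠ t in atBot, HasDerivAt (fun t => ξ t + t) (1 + p t) t := by
    filter_upwards [hT] with t ht
    have := (tr.curve.hasDerivAt_fst t ht).add (hasDerivAt_id t)
    rwa [add_comm (p t)] at this
  -- `1 - p² = (1 + p)(1 - p)` with `1 - p ≥ 1`, and `ξ` grows at least linearly, so `1 + p` decays
  -- exponentially.
  have hb : ∀ᶠ t in atBot, |1 + p t| ≤
      ((kthRoot k h + 1) * Real.exp (α * C₀)) * Real.exp (α / 2 * t) := by
    filter_upwards [hT, hp, hC₀, hroot.eventually (gt_mem_nhds (lt_add_one _))] with t h1 h2 h3 h4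
    have h5 : |1 + p t| ≤ |1 + p t| * |1 - p t| := by
      have : 1 ≤ |1 - p t| := by rw [abs_of_pos (by linarith)]; linarith
      nlinarith [abs_nonneg (1 + p t)]
    rw [← abs_mul, hfac t h1, abs_mul, hs1, one_mul,
      abs_of_nonneg (a := Real.exp (-α * ξ t) * _) (by positivity)] at h5
    refine h5.trans ?_
    have h6 : Real.exp (-α * ξ t) ≤ Real.exp (α * C₀) * Real.exp (α / 2 * t) := by
      rw [← Real.exp_add, Real.exp_le_exp]
      nlinarith
    calc _ ≤ (Real.exp (α * C₀) * Real.exp (α / 2 * t)) * (kthRoot k h + 1) :=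
          mul_le_mul h6 h4.le (Real.rpow_nonneg (abs_nonneg _) _) (by positivity)
      _ = _ := by ring
  obtain ⟨t₁, ht₁⟩ := eventually_atBot.1 (hd.and hb)
  obtain ⟨L, hL⟩ := exists_tendsto_of_deriv_le_exp (half_pos hα) (fun t ht => (ht₁ t ht).1)
    (fun t ht => (ht₁ t ht).2)
  refine ⟨L, hL, hp1, ?_⟩
  have h1 : Tendsto (fun t => s * (Real.exp (-α * (ξ t + t)) *
      |h - Real.exp (-(n * ξ t))| ^ (1 / (k : ℝ))) / (1 - p t)) atBot
      (𝓝 (s * (Real.exp (-α * L) * kthRoot k h) / (1 - (-1)))) :=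
    (((hL.const_mul (-α)).rexp.mul hroot).const_mul s).div (hp1.const_sub 1) (by norm_num)
  rw [show s * kthRoot k h * Real.exp (-α * L) / 2 =
    s * (Real.exp (-α * L) * kthRoot k h) / (1 - (-1)) by ring]
  refine h1.congr' ?_
  filter_upwards [hT, hp] with t h1 h2
  have h3 : 1 - p t ≠ 0 := by linarith
  have h4 : Real.exp (-α * (ξ t + t)) = Real.exp (-α * ξ t) / Real.exp (α * t) := by
    rw [← Real.exp_sub]; ring_nf
  have h5 := hfac t h1
  have h6 := (Real.exp_pos (α * t)).ne'
  rw [h4]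
  generalize Real.exp (-α * ξ t) = A at *
  generalize |h - Real.exp (-(n * ξ t))| ^ (1 / (k : ℝ)) = B at *
  field_simp
  linear_combination -h5

/-- Asymptotics of a solution with `ξ → ∞` as `t → -∞`, for `2k = n`: the function `ξ + βt` has a
finite limit, for `-β` the limit of the velocity. -/
theorem asymptotics_of_eq (hn : 3 ≤ n) (hk : 1 < k) (hnk : 2 * k = n)
    (tr : Trajectory n k h s ξ p T) (hT : ∀ᶠ t in atBot, t ∈ T) (hp : ∀ᶠ t in atBot, p t < 0)
    (hξ : Tendsto ξ atBot atTop) (hβ : s * kthRoot k h < 1) :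
    ∃ L, Tendsto (fun t => ξ t + Real.sqrt (1 - s * kthRoot k h) * t) atBot (𝓝 L) := by
  have hk0 : (0 : ℝ) < k := by positivity
  have hk1 : (1 : ℝ) ≤ k := by exact_mod_cast hk.le
  set β := Real.sqrt (1 - s * kthRoot k h) with hβ_def
  have hβ0 : 0 < β := Real.sqrt_pos.2 (by linarith)
  have hpT : ∀ᶠ t in atBot, t ∈ T ∧ p t ≤ 0 := by
    filter_upwards [hT, hp] with t h1 h2 using ⟨h1, h2.le⟩
  have hpβ : Tendsto p atBot (𝓝 (-β)) :=
    tr.tendsto_velocity hk hpT hξ (tendsto_profile_atTop_of_eq hn hk hnk)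
  obtain ⟨C₀, hC₀⟩ := tr.exists_linear_lower_bound hβ0 hT hpβ
  have hs1 : |s| = 1 := by rcases tr.sign_eq with rfl | rfl <;> norm_num
  have hd : ∀ᶠ t in atBot, HasDerivAt (fun t => ξ t + β * t) (p t + β) t := by
    filter_upwards [hT] with t ht
    have := (tr.curve.hasDerivAt_fst t ht).add ((hasDerivAt_id t).const_mul β)
    rwa [mul_one] at this
  -- `β² - p²` is `O(e^{-2ξ})` because `y ↦ y^{1/k}` is Hölder continuous of exponent `1/k`, and `n/k = 2`.
  have hb : ∀ᶠ t in atBot, |p t + β| ≤ (Real.exp (2 * C₀) / β) * Real.exp (β * t) := by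
    filter_upwards [hT, hp, hC₀] with t h1 h2 h3
    have h4 : (p t + β) * (p t - β) = s * (kthRoot k h - |potential n k h (ξ t)| ^ (1 / (k : ℝ))) := by
      have e1 : β ^ 2 = 1 - s * kthRoot k h := Real.sq_sqrt (by linarith)
      have e2 := tr.one_sub_sq hk h1
      rw [profile] at e2
      linear_combination -e1 - e2
    have h5 : |kthRoot k h - |potential n k h (ξ t)| ^ (1 / (k : ℝ))| ≤ Real.exp (-(2 * ξ t)) := by
      refine (abs_rpow_sub_rpow_le (abs_nonneg _) (abs_nonneg _) (by positivity)
        ((div_le_one hk0).2 hk1)).trans ?_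
      have e3 : |(|h| - |potential n k h (ξ t)|)| ≤ Real.exp (-(n * ξ t)) := by
        refine (abs_abs_sub_abs_le _ _).trans ?_
        rw [potential_eq', show (n : ℝ) - 2 * k = 0 by rw [← hnk]; push_cast; ring]
        rw [zero_mul, Real.exp_zero, one_mul, sub_sub_cancel, abs_of_pos (Real.exp_pos _)]
      refine (Real.rpow_le_rpow (abs_nonneg _) e3 (by positivity)).trans ?_
      rw [← Real.exp_mul, Real.exp_le_exp, ← hnk]
      push_cast
      field_simp
      exact le_rfl
    have h6 : |p t + β| * β ≤ Real.exp (-(2 * ξ t)) := by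
      have : |p t + β| * |p t - β| ≤ Real.exp (-(2 * ξ t)) := by
        rw [← abs_mul, h4, abs_mul, hs1, one_mul]; exact h5
      have h7 : β ≤ |p t - β| := by rw [abs_of_neg (by linarith)]; linarith
      nlinarith [abs_nonneg (p t + β)]
    have h8 : Real.exp (-(2 * ξ t)) ≤ Real.exp (2 * C₀) * Real.exp (β * t) := by
      rw [← Real.exp_add, Real.exp_le_exp]
      nlinarith
    rw [div_mul_eq_mul_div, le_div_iff₀ hβ0]
    exact h6.trans h8
  obtain ⟨t₁, ht₁⟩ := eventually_atBot.1 (hd.and hb)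
  exact exists_tendsto_of_deriv_le_exp hβ0 (fun t ht => (ht₁ t ht).1) (fun t ht => (ht₁ t ht).2)

end Trajectory

/-! ### Asymptotics at finite ends and in the borderline cases -/

namespace Trajectory

variable {n k : ℕ} {h s : ℝ} {ξ p : ℝ → ℝ} {T : Set ℝ} {l : Filter ℝ}

/-- For `2k < n` a solution with `1 - ξ_t² < 0` and `ξ → ∞` at its left end gets there in finite
time; `e^{-(n-2k)ξ/(2k)}` has a positive limiting slope. -/
theorem asymptotics_of_gt (hn : 3 ≤ n) (hk : 1 < k) (hnk : 2 * k < n)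
    (tr : Trajectory n k h (-1) ξ p T) (hh : h ≠ 0) (hl : IsLeftEnd T l)
    (hp : ∀ t ∈ T, p t < 0) (hξ : Tendsto ξ l atTop) :
    (∃ a, l = 𝓝[>] a) ∧ ∃ c > 0, Tendsto (fun t => -((n : ℝ) - 2 * k) / (2 * k) * p t *
      Real.exp (-((n : ℝ) - 2 * k) / (2 * k) * ξ t)) l (𝓝 c) := by
  have hk0 : (0 : ℝ) < k := by positivity
  have hnk' : 2 * (k : ℝ) < n := by exact_mod_cast hnk
  obtain ⟨t₀, ht₀⟩ := tr.curve.nonempty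
  have hT := hl.eventually ht₀
  set κ := -((n : ℝ) - 2 * k) / (2 * k) with hκ_def
  have hκ : κ < 0 := div_neg_of_neg_of_pos (by linarith) (by positivity)
  -- With this `κ` the factor `e^{2κξ}` compensates the growth of `|F(ξ)|^{1/k}`.
  have hlim : Tendsto (fun t => κ * p t * Real.exp (κ * ξ t)) l
      (𝓝 (-κ * Real.sqrt (0 + kthRoot k h))) := by
    have h1 : Tendsto (fun x => Real.exp (-(-(2 * κ) * x)) +
        |h - Real.exp (-(n * x))| ^ (1 / (k : ℝ))) atTop (𝓝 (0 + kthRoot k h)) :=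
      (tendsto_exp_neg_mul_atTop (by linarith)).add (tendsto_abs_sub_exp_rpow hn)
    refine ((h1.comp hξ).sqrt.const_mul (-κ)).congr' ?_
    filter_upwards [hT] with t ht
    have e1 : Real.exp (-(-(2 * κ) * ξ t)) + |h - Real.exp (-(n * ξ t))| ^ (1 / (k : ℝ)) =
        (-p t * Real.exp (κ * ξ t)) ^ 2 := by
      have e2 := tr.one_sub_sq hk ht.1
      rw [profile_eq hk] at e2
      have e3 : p t ^ 2 = 1 + Real.exp (-(2 - (n : ℝ) / k) * ξ t) *
          |h - Real.exp (-(n * ξ t))| ^ (1 / (k : ℝ)) := by linarith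
      have e4 : Real.exp (κ * ξ t) ^ 2 = Real.exp (-(-(2 * κ) * ξ t)) := by
        rw [← Real.exp_nat_mul]; congr 1; push_cast; ring
      have e5 : Real.exp (-(2 - (n : ℝ) / k) * ξ t) * Real.exp (-(-(2 * κ) * ξ t)) = 1 := by
        rw [← Real.exp_add, Real.exp_eq_one_iff, hκ_def]
        field_simp
        ring
      rw [mul_pow, neg_sq, e3, e4]
      linear_combination -(|h - Real.exp (-(n * ξ t))| ^ (1 / (k : ℝ))) * e5
    have e6 : 0 ≤ -p t * Real.exp (κ * ξ t) :=
      mul_nonneg (by linarith [hp t ht.1]) (Real.exp_pos _).le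
    simp only [Function.comp_apply]
    rw [e1, Real.sqrt_sq e6]
    ring
  have hc : 0 < -κ * Real.sqrt (0 + kthRoot k h) :=
    mul_pos (by linarith) (Real.sqrt_pos.2 (by linarith [kthRoot_pos k hh]))
  refine ⟨?_, _, hc, hlim⟩
  rcases hl with ⟨rfl, -⟩ | ⟨a, ha, -⟩
  · exfalso
    -- A positive limiting slope over an infinite time would make `e^{κξ}` negative.
    have h1 := tendsto_div_id_atBot (u := fun t => Real.exp (κ * ξ t)) (by
      filter_upwards [hT] with t ht
      have := ((tr.curve.hasDerivAt_fst t ht.1).const_mul κ).exp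
      rwa [mul_comm] at this) hlim
    obtain ⟨t, h2, h3⟩ := ((h1.eventually (lt_mem_nhds hc)).and (eventually_lt_atBot 0)).exists
    exact absurd h2 (not_lt.2 (div_nonpos_of_nonneg_of_nonpos (Real.exp_pos _).le h3.le))
  · exact ⟨a, ha⟩

/-- A solution with `1 - ξ_t² < 0` and `ξ → -∞` at its right end gets there in finite time, and
`(e^ξ)_t → -1`. -/
theorem asymptotics_of_tendsto_atBot (hn : 3 ≤ n) (hk : 1 < k)
    (tr : Trajectory n k h (-1) ξ p T) (hl : IsRightEnd T l)
    (hp : ∀ t ∈ T, p t < 0) (hξ : Tendsto ξ l atBot) :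
    (∃ b, l = 𝓝[<] b) ∧ Tendsto (fun t => p t * Real.exp (ξ t)) l (𝓝 (-1)) := by
  obtain ⟨t₀, ht₀⟩ := tr.curve.nonempty
  have hT := hl.eventually ht₀
  have hn0 : (0 : ℝ) < n := by positivity
  have hlim : Tendsto (fun t => p t * Real.exp (ξ t)) l (𝓝 (-1)) := by
    have e0 : Tendsto (fun x => Real.exp (n * x)) atBot (𝓝 0) :=
      Real.tendsto_exp_atBot.comp (tendsto_id.const_mul_atBot hn0)
    have e0' : Tendsto (fun x : ℝ => Real.exp (2 * x)) atBot (𝓝 0) :=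
      Real.tendsto_exp_atBot.comp (tendsto_id.const_mul_atBot two_pos)
    have h1 : Tendsto (fun x => Real.exp (2 * x) + |h * Real.exp (n * x) - 1| ^ (1 / (k : ℝ)))
        atBot (𝓝 (0 + |h * 0 - 1| ^ (1 / (k : ℝ)))) :=
      e0'.add (((e0.const_mul h).sub_const 1).abs.rpow_const (Or.inr (by positivity)))
    have h2 := ((h1.comp hξ).sqrt).neg
    simp only [mul_zero, zero_sub, abs_neg, abs_one, Real.one_rpow, zero_add, Real.sqrt_one] at h2
    refine h2.congr' ?_
    filter_upwards [hT] with t ht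
    have e1 : Real.exp (2 * ξ t) + |h * Real.exp (n * ξ t) - 1| ^ (1 / (k : ℝ)) =
        (-p t * Real.exp (ξ t)) ^ 2 := by
      have e2 := tr.one_sub_sq hk ht.1
      rw [profile_eq' hk] at e2
      have e3 : p t ^ 2 = 1 + Real.exp (-(2 * ξ t)) *
          |h * Real.exp (n * ξ t) - 1| ^ (1 / (k : ℝ)) := by linarith
      have e4 : Real.exp (ξ t) ^ 2 = Real.exp (2 * ξ t) := by
        rw [← Real.exp_nat_mul]; congr 1
      have e5 : Real.exp (-(2 * ξ t)) * Real.exp (2 * ξ t) = 1 := by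
        rw [← Real.exp_add]; simp
      rw [mul_pow, neg_sq, e3, e4]
      linear_combination -(|h * Real.exp (n * ξ t) - 1| ^ (1 / (k : ℝ))) * e5
    have e6 : 0 ≤ -p t * Real.exp (ξ t) :=
      mul_nonneg (by linarith [hp t ht.1]) (Real.exp_pos _).le
    simp only [Function.comp_apply]
    rw [e1, Real.sqrt_sq e6]
    ring
  refine ⟨?_, hlim⟩
  rcases hl with ⟨rfl, -⟩ | ⟨a, ha, -⟩
  · exfalso
    -- A negative limiting slope over an infinite time would make `e^ξ` negative.
    have h1 := tendsto_div_id_atTop (u := fun t => Real.exp (ξ t)) (by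
      filter_upwards [hT] with t ht
      have := (tr.curve.hasDerivAt_fst t ht.1).exp
      rwa [mul_comm] at this) hlim
    obtain ⟨t, h2, h3⟩ := ((h1.eventually (gt_mem_nhds (show (-1 : ℝ) < 0 by norm_num))).and
      (eventually_gt_atTop 0)).exists
    exact absurd h2 (not_lt.2 (div_nonneg (Real.exp_pos _).le h3.le))
  · exact ⟨a, ha⟩

/-- The borderline case `h = 1`, `2k = n`: the velocity decays like `e^{-kξ}`. -/
theorem asymptotics_of_h_eq_one (hn : 3 ≤ n) (hk : 1 < k) (hnk : 2 * k = n)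
    (tr : Trajectory n k 1 1 ξ p T) (hT : ∀ᶠ t in l, t ∈ T) (hp : ∀ᶠ t in l, p t < 0)
    (hξ : Tendsto ξ l atTop) :
    Tendsto (fun t => p t * Real.exp (k * ξ t)) l (𝓝 (-Real.sqrt (1 / k))) := by
  have hk0 : (0 : ℝ) < k := by positivity
  -- Here `p² = 1 - (1 - e^{-nξ})^{1/k}`, which is `e^{-nξ}/k` to first order, and `n = 2k`.
  have hslope : Tendsto (fun y : ℝ => y⁻¹ * ((1 + y) ^ (1 / (k : ℝ)) - 1)) (𝓝[≠] 0)
      (𝓝 (1 / (k : ℝ))) := by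
    have h1 : HasDerivAt (fun x : ℝ => x ^ (1 / (k : ℝ))) (1 / (k : ℝ)) 1 := by
      have := Real.hasDerivAt_rpow_const (x := 1) (p := 1 / (k : ℝ)) (Or.inl one_ne_zero)
      simpa using this
    have h2 := h1.tendsto_slope_zero
    simpa using h2
  have hy : Tendsto (fun x => -Real.exp (-(n * x))) atTop (𝓝[≠] 0) := by
    refine tendsto_nhdsWithin_iff.2 ⟨?_, Eventually.of_forall fun x => ?_⟩
    · have := (tendsto_exp_neg_mul_atTop (c := (n : ℝ)) (by positivity)).neg
      rwa [neg_zero] at this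
    · exact neg_ne_zero.2 (Real.exp_pos _).ne'
  have h3 := (((hslope.comp hy).comp hξ).sqrt).neg
  refine h3.congr' ?_
  filter_upwards [hT, hp, hξ.eventually_gt_atTop 0] with t ht hpt hξt
  have hE : Real.exp (-(n * ξ t)) < 1 := by
    rw [Real.exp_lt_one_iff]
    have : (0 : ℝ) < n := by positivity
    nlinarith
  have e1 : (-Real.exp (-(n * ξ t)))⁻¹ * ((1 + -Real.exp (-(n * ξ t))) ^ (1 / (k : ℝ)) - 1) =
      (-p t * Real.exp (k * ξ t)) ^ 2 := by
    have e2 := tr.one_sub_sq hk ht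
    rw [profile_eq hk, abs_of_pos (by linarith), show 2 - (n : ℝ) / k = 0 by
      rw [← hnk]; push_cast; field_simp; norm_num, neg_zero, zero_mul, Real.exp_zero, one_mul,
      one_mul] at e2
    rw [← sub_eq_add_neg, ← e2, mul_pow, neg_sq, ← Real.exp_nat_mul]
    have e3 : (-Real.exp (-(n * ξ t)))⁻¹ = -Real.exp (((2 : ℕ) : ℝ) * (k * ξ t)) := by
      rw [inv_neg, ← Real.exp_neg, neg_neg, ← hnk]
      push_cast
      ring_nf
    rw [e3]
    ring
  have e6 : 0 ≤ -p t * Real.exp (k * ξ t) :=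
    mul_nonneg (by linarith) (Real.exp_pos _).le
  simp only [Function.comp_apply]
  rw [e1, Real.sqrt_sq e6]
  ring

/-- For `h = 0` the phase curves with `ξ_t < 0` are explicit: `e^ξ = sinh (b - t)`. -/
theorem exp_eq_sinh (hk : 1 < k) (tr : Trajectory n k 0 (-1) ξ p T) {b : ℝ}
    (hl : IsRightEnd T (𝓝[<] b)) (hp : ∀ t ∈ T, p t < 0) (hξ : Tendsto ξ (𝓝[<] b) atBot) :
    ∀ t ∈ T, Real.exp (ξ t) = Real.sinh (b - t) := by
  have hd : ∀ t ∈ T, HasDerivAt (fun t => Real.arsinh (Real.exp (ξ t)) + t) 0 t := by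
    intro t ht
    have h1 := ((tr.curve.hasDerivAt_fst t ht).exp.arsinh).add (hasDerivAt_id t)
    convert! h1 using 1
    have e2 := tr.one_sub_sq hk ht
    rw [profile_eq' hk] at e2
    simp only [zero_mul, zero_sub, abs_neg, abs_one, Real.one_rpow, mul_one] at e2
    have e3 : 1 + Real.exp (ξ t) ^ 2 = (-p t * Real.exp (ξ t)) ^ 2 := by
      have e4 : Real.exp (-(2 * ξ t)) * Real.exp (ξ t) ^ 2 = 1 := by
        rw [← Real.exp_nat_mul, ← Real.exp_add]; simp
      rw [mul_pow, neg_sq]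
      linear_combination -e4 + Real.exp (ξ t) ^ 2 * e2
    have hpe := hp t ht
    have hp0 := hpe.ne
    have hE := Real.exp_pos (ξ t)
    rw [e3, Real.sqrt_sq (mul_nonneg (by linarith) hE.le)]
    simp only [smul_eq_mul]
    field_simp
    norm_num
  intro t ht
  have hconst : ∀ r ∈ T, Real.arsinh (Real.exp (ξ r)) + r = Real.arsinh (Real.exp (ξ t)) + t :=
    fun r hr => tr.curve.isOpen.is_const_of_deriv_eq_zero tr.curve.ordConnected.isPreconnected
      (fun s hs => (hd s hs).differentiableAt.differentiableWithinAt)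
      (fun s hs => (hd s hs).deriv) hr ht
  have hlim : Tendsto (fun r => Real.arsinh (Real.exp (ξ r)) + r) (𝓝[<] b)
      (𝓝 (Real.arsinh 0 + b)) :=
    ((Real.continuous_arsinh.tendsto 0).comp (Real.tendsto_exp_atBot.comp hξ)).add
      (tendsto_id.mono_left nhdsWithin_le_nhds)
  have hlim2 : Tendsto (fun r => Real.arsinh (Real.exp (ξ r)) + r) (𝓝[<] b)
      (𝓝 (Real.arsinh (Real.exp (ξ t)) + t)) := by
    refine tendsto_const_nhds.congr' ?_
    filter_upwards [hl.eventually ht] with r hr using (hconst r hr.1).symm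
  have := tendsto_nhds_unique hlim hlim2
  rw [Real.arsinh_zero, zero_add] at this
  rw [this, add_sub_cancel_right, Real.sinh_arsinh]

end Trajectory

/-! ### Behaviour at the origin for `2k > n` -/

namespace RadialTrajectory

variable {n k : ℕ} {h s : ℝ} {v : ℝ → ℝ} {S : Set ℝ}

theorem eventually_mem_nhdsGT_zero (hT : ∀ᶠ t in atBot, t ∈ Real.exp ⁻¹' S) :
    ∀ᶠ r in 𝓝[>] (0 : ℝ), r ∈ S :=
  eventually_mem hT Real.tendsto_log_nhdsGT_zero self_mem_nhdsWithin

theorem hasDerivAt_log_confFactor (rt : RadialTrajectory n k h s v S) {t : ℝ}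
    (ht : t ∈ Real.exp ⁻¹' S) : HasDerivAt (fun t => Real.exp (-2 * (xi v t + t)))
      (Real.exp (-2 * (xi v t + t)) * (-2 * (1 + xit v t))) t := by
  have := (((rt.traj.curve.hasDerivAt_fst t ht).add (hasDerivAt_id t)).const_mul (-2)).exp
  rwa [add_comm (xit v t)] at this

/-- For `2k > n` the derivative of `v⁻²` in the variable `t = ln r` is asymptotic to a multiple of
`r^{2-n/k}` at the origin, if `ξ → ∞` there. -/
theorem exists_tendsto_log_confFactor (hn : 3 ≤ n) (hk : 1 < k) (hnk : n < 2 * k)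
    (rt : RadialTrajectory n k h s v S) (hT : ∀ᶠ t in atBot, t ∈ Real.exp ⁻¹' S)
    (hp : ∀ᶠ t in atBot, xit v t < 0) (hξ : Tendsto (xi v) atBot atTop) :
    ∃ L, Tendsto (fun t => Real.exp (-2 * (xi v t + t))) atBot (𝓝 (Real.exp (-2 * L))) ∧
      Tendsto (fun t => Real.exp (-2 * (xi v t + t)) * (-2 * (1 + xit v t)) /
        Real.exp ((2 - (n : ℝ) / k) * t)) atBot
        (𝓝 (-(s * kthRoot k h) * Real.exp (-2 * L) * Real.exp (-(2 - (n : ℝ) / k) * L))) := by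
  obtain ⟨L, hL, -, hw⟩ := rt.traj.asymptotics_of_lt hn hk hnk hT hp hξ
  have hφ := (hL.const_mul (-2)).rexp
  refine ⟨L, hφ, ?_⟩
  have h1 := (hφ.mul (hw.const_mul (-2)))
  rw [show Real.exp (-2 * L) *
    (-2 * (s * kthRoot k h * Real.exp (-(2 - (n : ℝ) / k) * L) / 2)) =
    -(s * kthRoot k h) * Real.exp (-2 * L) * Real.exp (-(2 - (n : ℝ) / k) * L) by ring] at h1
  exact h1.congr fun t => by ring

theorem two_sub_div_pos (hk : 1 < k) (hnk : n < 2 * k) : 0 < 2 - (n : ℝ) / k := by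
  have hk0 : (0 : ℝ) < k := by positivity
  rw [sub_pos, div_lt_iff₀ hk0]; exact_mod_cast hnk

/-- The expansion of `v⁻²` at the origin, by l'Hôpital's rule from its derivative in `t = ln r`. -/
theorem hasExpansionAtZero (hn : 3 ≤ n) (hk : 1 < k) (hnk : n < 2 * k)
    (rt : RadialTrajectory n k h s v S) (hT : ∀ᶠ t in atBot, t ∈ Real.exp ⁻¹' S)
    (hp : ∀ᶠ t in atBot, xit v t < 0) (hξ : Tendsto (xi v) atBot atTop) :
    HasExpansionAtZero n k (-(s * kthRoot k h)) v := by
  obtain ⟨L, hL, hd⟩ := rt.exists_tendsto_log_confFactor hn hk hnk hT hp hξ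
  have hk0 : (0 : ℝ) < k := by positivity
  have hnk' : (n : ℝ) < 2 * k := by exact_mod_cast hnk
  have hα := two_sub_div_pos hk hnk
  have hαk : (k : ℝ) / (2 * k - n) = 1 / (2 - (n : ℝ) / k) := by
    have : (2 : ℝ) * k - n ≠ 0 := by linarith
    field_simp
  set α := 2 - (n : ℝ) / k with hα_def
  set D := -(s * kthRoot k h) * Real.exp (-2 * L) * Real.exp (-α * L) with hD
  have hquot : Tendsto (fun t => (Real.exp (-2 * (xi v t + t)) - Real.exp (-2 * L)) /
      Real.exp (α * t)) atBot (𝓝 (D / α)) := by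
    refine HasDerivAt.lhopital_zero_atBot
      (f' := fun t => Real.exp (-2 * (xi v t + t)) * (-2 * (1 + xit v t)))
      (g' := fun t => Real.exp (α * t) * α) ?_ ?_ ?_ ?_ ?_ ?_
    · filter_upwards [hT] with t ht using (rt.hasDerivAt_log_confFactor ht).sub_const _
    · refine Eventually.of_forall fun t => ?_
      have := ((hasDerivAt_id t).const_mul α).exp
      rwa [mul_one] at this
    · exact Eventually.of_forall fun t => (mul_pos (Real.exp_pos _) hα).ne'
    · have := hL.sub_const (Real.exp (-2 * L))
      rwa [sub_self] at this
    · exact Real.tendsto_exp_atBot.comp (tendsto_id.const_mul_atBot hα)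
    · refine (hd.div_const α).congr fun t => ?_
      rw [div_div]
  refine ⟨Real.exp L, Real.exp_pos L, ?_⟩
  have hpos : ∀ᶠ r in 𝓝[>] (0 : ℝ), 0 < r := self_mem_nhdsWithin
  rw [isLittleO_iff_tendsto']
  · have h1 := (hquot.comp Real.tendsto_log_nhdsGT_zero).sub_const (D / α)
    rw [sub_self] at h1
    refine h1.congr' ?_
    filter_upwards [eventually_mem_nhdsGT_zero hT, hpos] with r hr hr0
    have e1 : r ^ α = Real.exp (α * Real.log r) := by
      rw [Real.rpow_def_of_pos hr0, mul_comm]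
    have e2 : (r / Real.exp L) ^ α = r ^ α * Real.exp (-α * L) := by
      rw [Real.div_rpow hr0.le (Real.exp_pos _).le, ← Real.exp_mul, div_eq_mul_inv,
        ← Real.exp_neg]
      ring_nf
    have e3 : (Real.exp L ^ 2)⁻¹ = Real.exp (-2 * L) := by
      rw [← Real.exp_nat_mul, ← Real.exp_neg]; push_cast; ring_nf
    have e4 : r ^ α ≠ 0 := (Real.rpow_pos_of_pos hr0 _).ne'
    rw [rt.confFactor_eq hr, ← hα_def, e2, e3, hαk, Function.comp_apply, ← e1, hD]
    generalize r ^ α = R at *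
    field_simp
    ring
  · filter_upwards [hpos] with r hr0 h0
    exact absurd h0 (Real.rpow_pos_of_pos hr0 _).ne'

/-- The bound `O(r^α)`, `α = 2 - n/k`, for the derivative of `v⁻²` in `ln r` integrates to
`|v⁻²(b) - v⁻²(a)| ≤ C (bᵅ - aᵅ) ≤ C |b - a|ᵅ`, as `α ≤ 1`. -/
theorem extendsHolderAtOrigin (hn : 3 ≤ n) (hk : 1 < k) (hkn : k ≤ n) (hnk : n < 2 * k)
    (rt : RadialTrajectory n k h s v S) (hT : ∀ᶠ t in atBot, t ∈ Real.exp ⁻¹' S)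
    (hp : ∀ᶠ t in atBot, xit v t < 0) (hξ : Tendsto (xi v) atBot atTop) :
    ExtendsHolderAtOrigin n (2 - (n : ℝ) / k) v := by
  obtain ⟨L, hL, hd⟩ := rt.exists_tendsto_log_confFactor hn hk hnk hT hp hξ
  have hk0 : (0 : ℝ) < k := by positivity
  have hα := two_sub_div_pos hk hnk
  have hα1 : 2 - (n : ℝ) / k ≤ 1 := by
    have : 1 ≤ (n : ℝ) / k := by rw [one_le_div hk0]; exact_mod_cast hkn
    linarith
  set α := 2 - (n : ℝ) / k with hα_def
  set D := -(s * kthRoot k h) * Real.exp (-2 * L) * Real.exp (-α * L) with hD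
  set φ : ℝ → ℝ := fun t => Real.exp (-2 * (xi v t + t)) with hφ
  have hbd : ∀ᶠ t in atBot, |Real.exp (-2 * (xi v t + t)) * (-2 * (1 + xit v t))| ≤
      (|D| + 1) * Real.exp (α * t) := by
    filter_upwards [hd.abs.eventually (gt_mem_nhds (lt_add_one |D|))] with t ht
    rw [abs_div, abs_of_pos (Real.exp_pos (α * t)), div_lt_iff₀ (Real.exp_pos _)] at ht
    exact ht.le
  obtain ⟨t₁, ht₁⟩ := eventually_atBot.1 (hT.and hbd)
  set C := (|D| + 1) / α with hC
  have hC0 : 0 ≤ C := by positivity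
  have hvar : ∀ a b, a ≤ b → b ≤ t₁ →
      |φ b - φ a| ≤ C * (Real.exp (α * b) - Real.exp (α * a)) := fun a b hab hb =>
    abs_sub_le_of_deriv_le_exp hα (fun t ht => rt.hasDerivAt_log_confFactor (ht₁ t ht).1)
      (fun t ht => (ht₁ t ht).2) hab hb
  have hvar0 : ∀ b ≤ t₁, |φ b - Real.exp (-2 * L)| ≤ C * Real.exp (α * b) := by
    intro b hb
    refine le_of_tendsto (hL.const_sub (φ b)).abs ?_
    filter_upwards [eventually_le_atBot b] with a ha
    refine (hvar a b ha hb).trans ?_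
    have := (Real.exp_pos (α * a)).le
    nlinarith
  let Φ : ℝ → ℝ := fun r => if r = 0 then Real.exp (-2 * L) else confFactor v r
  have hΦ0 : Φ 0 = Real.exp (-2 * L) := if_pos rfl
  have hΦ : ∀ r, 0 < r → r < Real.exp t₁ → Φ r = φ (Real.log r) := by
    intro r hr hr1
    have hlog : Real.log r ≤ t₁ := ((Real.log_lt_iff_lt_exp hr).2 hr1).le
    have hmem : r ∈ S := by
      have := (ht₁ _ hlog).1
      rwa [mem_preimage, Real.exp_log hr] at this
    simp only [Φ, if_neg hr.ne', hφ]
    exact rt.confFactor_eq hmem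
  have hexp : ∀ r, 0 < r → Real.exp (α * Real.log r) = r ^ α := fun r hr => by
    rw [Real.rpow_def_of_pos hr, mul_comm]
  have key : ∀ a b, 0 ≤ a → a ≤ b → b < Real.exp t₁ → |Φ b - Φ a| ≤ C * |b - a| ^ α := by
    intro a b ha hab hb
    have h1 : |Φ b - Φ a| ≤ C * (b ^ α - a ^ α) := by
      rcases ha.eq_or_lt with rfl | ha'
      · rcases hab.eq_or_lt with rfl | hb'
        · simp
        · rw [hΦ0, hΦ b hb' hb, Real.zero_rpow hα.ne', sub_zero, ← hexp b hb']
          exact hvar0 _ ((Real.log_lt_iff_lt_exp hb').2 hb).le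
      · have hb' := ha'.trans_le hab
        rw [hΦ b hb' hb, hΦ a ha' (hab.trans_lt hb), ← hexp b hb', ← hexp a ha']
        exact hvar _ _ (Real.log_le_log ha' hab) ((Real.log_lt_iff_lt_exp hb').2 hb).le
    refine h1.trans (mul_le_mul_of_nonneg_left ?_ hC0)
    exact (le_abs_self _).trans (abs_rpow_sub_rpow_le (ha.trans hab) ha hα.le hα1)
  refine ⟨fun x => Φ ‖x‖, ?_, fun x hx => if_neg (norm_ne_zero_iff.2 hx), Real.exp t₁,
    Real.exp_pos _, C, fun x y hx hy => ?_⟩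
  · simp only [norm_zero, hΦ0]; exact Real.exp_pos _
  · have h2 : |Φ ‖x‖ - Φ ‖y‖| ≤ C * |‖x‖ - ‖y‖| ^ α := by
      rcases le_total ‖y‖ ‖x‖ with h | h
      · exact key _ _ (norm_nonneg _) h hx
      · rw [abs_sub_comm, abs_sub_comm ‖x‖]
        exact key _ _ (norm_nonneg _) h hy
    refine h2.trans (mul_le_mul_of_nonneg_left ?_ hC0)
    exact Real.rpow_le_rpow (abs_nonneg _) (abs_norm_sub_norm_le x y) hα.le

/-- For `n < 2k` the quantity `ξ_tt + (1 + ξ_t) ξ_t` is of the order `e^{(2-n/k)t}` as `t → -∞`,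
with a coefficient that does not vanish unless `k = n`. -/
theorem secondDerivBlowsUp_zero (hn : 3 ≤ n) (hk : 1 < k) (hkn : k < n) (hnk : n < 2 * k)
    (rt : RadialTrajectory n k h s v S) (hh : h ≠ 0) (hT : ∀ᶠ t in atBot, t ∈ Real.exp ⁻¹' S)
    (hp : ∀ᶠ t in atBot, xit v t < 0) (hξ : Tendsto (xi v) atBot atTop) :
    SecondDerivBlowsUp v (𝓝[>] 0) := by
  obtain ⟨L, hL, hp1, hw⟩ := rt.traj.asymptotics_of_lt hn hk hnk hT hp hξ
  have hk0 : (0 : ℝ) < k := by positivity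
  have hn0 : (0 : ℝ) < n := by positivity
  have hα := two_sub_div_pos hk hnk
  have hα1 : 2 - (n : ℝ) / k < 1 := by
    have : 1 < (n : ℝ) / k := by rw [one_lt_div hk0]; exact_mod_cast hkn
    linarith
  have hαk : (n : ℝ) - 2 * k = -(2 - (n : ℝ) / k) * k := by field_simp; ring
  set α := 2 - (n : ℝ) / k with hα_def
  set K := s * kthRoot k h * Real.exp (-α * L) / 2 with hK
  have hK0 : K ≠ 0 := by
    have hs : s ≠ 0 := by rcases rt.traj.sign_eq with rfl | rfl <;> norm_num
    have := kthRoot_pos k hh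
    have := Real.exp_pos (-α * L)
    rw [hK]; positivity
  -- `F'/F → n - 2k`, and `ξ_tt = -(F'/F) (1 - ξ_t²) / (2k)`.
  have hratio : Tendsto (fun t => potentialDeriv n k h (xi v t) / potential n k h (xi v t)) atBot
      (𝓝 ((n : ℝ) - 2 * k + n * 0 / (h - 0))) := by
    have h0 := (tendsto_exp_neg_mul_atTop hn0).comp hξ
    refine (((h0.const_mul (n : ℝ)).div (h0.const_sub h) (by simpa using hh)).const_add
      ((n : ℝ) - 2 * k)).congr' ?_
    filter_upwards [hT] with t ht
    have h1 := rt.traj.potential_ne_zero ht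
    have e1 : potentialDeriv n k h (xi v t) = ((n : ℝ) - 2 * k) * potential n k h (xi v t) +
        n * (Real.exp (((n : ℝ) - 2 * k) * xi v t) * Real.exp (-(n * xi v t))) := by
      rw [← Real.exp_add, show ((n : ℝ) - 2 * k) * xi v t + -(n * xi v t) =
        -(2 * (k : ℝ)) * xi v t by ring, potentialDeriv, potential]
      ring
    rw [e1, add_div, mul_div_cancel_right₀ _ h1, potential_eq']
    congr 1
    have h2 := (Real.exp_pos (((n : ℝ) - 2 * k) * xi v t)).ne'
    simp only [Function.comp_apply, mul_left_comm (n : ℝ)]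
    rw [mul_div_mul_left _ _ h2]
    rfl
  rw [mul_zero, zero_div, add_zero] at hratio
  have hacc : Tendsto (fun t => (accel n k (xi v t) (xit v t) + (1 + xit v t) * xit v t) /
      Real.exp (α * t)) atBot (𝓝 ((-((n : ℝ) - 2 * k) / (2 * k)) * (K * (1 - -1)) + K * -1)) := by
    refine (((hratio.neg.div_const (2 * (k : ℝ))).mul (hw.mul (hp1.const_sub 1))).add
      (hw.mul hp1)).congr' ?_
    filter_upwards [hT] with t ht
    have hF := rt.traj.potential_ne_zero ht
    have hq := rt.traj.curve.sq_ne_one t ht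
    have he := rt.traj.energy t ht
    have e1 : accel n k (xi v t) (xit v t) = -(potentialDeriv n k h (xi v t) /
        potential n k h (xi v t)) / (2 * k) * (1 - xit v t ^ 2) := by
      rw [rt.traj.accel_eq hk ht, ← he]
      obtain ⟨j, rfl⟩ : ∃ j, k = j + 1 := ⟨k - 1, by omega⟩
      rw [Nat.add_sub_cancel, pow_succ]
      have := pow_ne_zero j hq
      field_simp
      ring
    rw [e1]
    have := (Real.exp_pos (α * t)).ne'
    field_simp
    ring
  have hlim : (-((n : ℝ) - 2 * k) / (2 * k)) * (K * (1 - -1)) + K * -1 = K * (α - 1) := by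
    rw [hαk]; field_simp; ring
  rw [hlim] at hacc
  have hne : 0 < |K * (α - 1)| := abs_pos.2 (mul_ne_zero hK0 (by linarith))
  -- `v_rr` is `ξ_tt + (1 + ξ_t) ξ_t = O(e^{αt})` times `e^{ξ - t}`, and `ξ + t` converges.
  have hexp : Tendsto (fun t => Real.exp ((xi v t + t) + (α - 2) * t)) atBot atTop := by
    refine Real.tendsto_exp_atTop.comp ?_
    exact hL.add_atTop ((tendsto_const_mul_atTop_of_neg (by linarith)).2 tendsto_id)
  have hfin := (hacc.abs.pos_mul_atTop hne hexp).comp Real.tendsto_log_nhdsGT_zero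
  refine hfin.congr' ?_
  filter_upwards [eventually_mem_nhdsGT_zero hT] with r hr
  rw [rt.deriv_deriv_eq hr, abs_mul, abs_of_pos (Real.exp_pos (xi v (Real.log r) - _)),
    Function.comp_apply, abs_div, abs_of_pos (Real.exp_pos (α * _)), div_mul_eq_mul_div,
    mul_div_assoc, ← Real.exp_sub]
  ring_nf

end RadialTrajectory

/-! ### Asymptotics and completeness at the ends -/

namespace RadialTrajectory

variable {n k : ℕ} {h s : ℝ} {v : ℝ → ℝ} {S : Set ℝ}

/-- The case `2k = n`: `v⁻²` behaves like a power of `r` at the origin. -/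
theorem asympMultiple_rpow (hn : 3 ≤ n) (hk : 1 < k) (hnk : 2 * k = n)
    (rt : RadialTrajectory n k h s v S) (hT : ∀ᶠ t in atBot, t ∈ Real.exp ⁻¹' S)
    (hp : ∀ᶠ t in atBot, xit v t < 0) (hξ : Tendsto (xi v) atBot atTop)
    (hβ : s * kthRoot k h < 1) :
    AsympMultiple (confFactor v)
      (fun r => r ^ (-2 * (1 - Real.sqrt (1 - s * kthRoot k h)))) (𝓝[>] 0) := by
  obtain ⟨L, hL⟩ := rt.traj.asymptotics_of_eq hn hk hnk hT hp hξ hβ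
  refine ⟨Real.exp (-2 * L), Real.exp_pos _, ?_⟩
  refine ((hL.const_mul (-2)).rexp.comp Real.tendsto_log_nhdsGT_zero).congr' ?_
  filter_upwards [eventually_mem_nhdsGT_zero hT] with r hr
  rw [rt.confFactor_eq hr, Real.rpow_def_of_pos (rt.pos hr), ← Real.exp_sub, Function.comp_apply]
  ring_nf

/-- The case `2k = n`, `h = 1`: the slope of `e^{kξ}` tends to `-√k`. -/
theorem asympMultiple_log (hn : 3 ≤ n) (hk : 1 < k) (hnk : 2 * k = n)
    (rt : RadialTrajectory n k 1 1 v S) (hT : ∀ᶠ t in atBot, t ∈ Real.exp ⁻¹' S)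
    (hp : ∀ᶠ t in atBot, xit v t < 0) (hξ : Tendsto (xi v) atBot atTop) :
    AsympMultiple (confFactor v)
      (fun r => r ^ (-2 : ℝ) * (Real.log (1 / r)) ^ (-(2 / (k : ℝ)))) (𝓝[>] 0) := by
  have hk0 : (0 : ℝ) < k := by positivity
  have h1 := (rt.traj.asymptotics_of_h_eq_one hn hk hnk hT hp hξ).const_mul (k : ℝ)
  have hc : 0 < (k : ℝ) * Real.sqrt (1 / k) := by positivity
  have h2 := (tendsto_div_id_atBot (u := fun t => Real.exp (k * xi v t)) (by
    filter_upwards [hT] with t ht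
    have := ((rt.traj.curve.hasDerivAt_fst t ht).const_mul (k : ℝ)).exp
    rwa [mul_comm, mul_assoc] at this) h1).neg
  rw [mul_neg, neg_neg] at h2
  refine ⟨((k : ℝ) * Real.sqrt (1 / k)) ^ (-(2 / (k : ℝ))), Real.rpow_pos_of_pos hc _, ?_⟩
  refine ((h2.rpow_const (p := -(2 / (k : ℝ))) (Or.inl hc.ne')).comp
    Real.tendsto_log_nhdsGT_zero).congr' ?_
  filter_upwards [eventually_mem_nhdsGT_zero hT, Ioo_mem_nhdsGT one_pos] with r hr hr1
  have h0 := rt.pos hr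
  have hlog : 0 < -Real.log r := neg_pos.2 (Real.log_neg h0 hr1.2)
  rw [rt.confFactor_eq hr, Function.comp_apply, one_div, Real.log_inv, ← div_neg,
    Real.div_rpow (Real.exp_pos _).le hlog.le, ← Real.exp_mul, Real.rpow_def_of_pos h0,
    ← div_div, ← Real.exp_sub]
  congr 2
  field_simp
  ring

/-- The case `2k < n`: `e^{-(n-2k)ξ/(2k)}` vanishes to first order at the left end. -/
theorem asympMultiple_sub (hn : 3 ≤ n) (hk : 1 < k) (hnk : 2 * k < n)
    (rt : RadialTrajectory n k h (-1) v S) (hh : h ≠ 0) {a : ℝ}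
    (hl : IsLeftEnd (Real.exp ⁻¹' S) (𝓝[>] a))
    (hp : ∀ t ∈ Real.exp ⁻¹' S, xit v t < 0) (hξ : Tendsto (xi v) (𝓝[>] a) atTop) :
    AsympMultiple (confFactor v)
      (fun r => (r - Real.exp a) ^ (4 * (k : ℝ) / (n - 2 * k))) (𝓝[>] (Real.exp a)) := by
  obtain ⟨-, c, hc, hlim⟩ := rt.traj.asymptotics_of_gt hn hk hnk hh hl hp hξ
  have hk0 : (0 : ℝ) < k := by positivity
  have hnk' : 2 * (k : ℝ) < n := by exact_mod_cast hnk
  obtain ⟨t₀, ht₀⟩ := rt.traj.curve.nonempty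
  have hpos : ∀ᶠ r in 𝓝[>] (Real.exp a), 0 < r := by
    filter_upwards [self_mem_nhdsWithin] with r hr using (Real.exp_pos a).trans hr
  have hS : ∀ᶠ r in 𝓝[>] (Real.exp a), r ∈ S :=
    eventually_mem ((hl.eventually ht₀).mono fun t ht => ht.1) (tendsto_log_nhdsGT_exp a) hpos
  set κ := -((n : ℝ) - 2 * k) / (2 * k) with hκ_def
  have hκ : κ < 0 := div_neg_of_neg_of_pos (by linarith) (by positivity)
  have hid : Tendsto (fun r : ℝ => r) (𝓝[>] (Real.exp a)) (𝓝 (Real.exp a)) :=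
    tendsto_id.mono_left nhdsWithin_le_nhds
  have hquot : Tendsto (fun r => Real.exp (κ * xi v (Real.log r)) / (r - Real.exp a))
      (𝓝[>] (Real.exp a)) (𝓝 (c / Real.exp a)) := by
    refine HasDerivAt.lhopital_zero_nhdsGT
      (f' := fun r => κ * xit v (Real.log r) * Real.exp (κ * xi v (Real.log r)) / r)
      (g' := fun _ => 1) ?_ ?_ ?_ ?_ ?_ ?_
    · filter_upwards [hS] with r hr
      have h1 := ((rt.traj.curve.hasDerivAt_fst _ (rt.log_mem hr)).comp r
        (Real.hasDerivAt_log (rt.pos hr).ne')).const_mul κ |>.exp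
      convert! h1 using 1
      simp only [Function.comp_apply]
      ring
    · exact Eventually.of_forall fun r => (hasDerivAt_id r).sub_const _
    · exact Eventually.of_forall fun r => one_ne_zero
    · exact Real.tendsto_exp_atBot.comp (((tendsto_const_mul_atBot_of_neg hκ).2 hξ).comp
        (tendsto_log_nhdsGT_exp a))
    · have := hid.sub_const (Real.exp a)
      rwa [sub_self] at this
    · simp only [div_one]
      exact (hlim.comp (tendsto_log_nhdsGT_exp a)).div hid (Real.exp_pos a).ne'
  have hcA : 0 < c / Real.exp a := by positivity
  refine ⟨(c / Real.exp a) ^ (4 * (k : ℝ) / (n - 2 * k)) / Real.exp a ^ 2,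
    div_pos (Real.rpow_pos_of_pos hcA _) (by positivity), ?_⟩
  refine ((hquot.rpow_const (p := 4 * (k : ℝ) / (n - 2 * k)) (Or.inl hcA.ne')).div (hid.pow 2)
    (by positivity)).congr' ?_
  filter_upwards [hS, self_mem_nhdsWithin] with r hr hra
  have h0 := rt.pos hr
  have hr1 : 0 < r - Real.exp a := sub_pos.2 hra
  have e1 : κ * xi v (Real.log r) * (4 * (k : ℝ) / (n - 2 * k)) = -2 * xi v (Real.log r) := by
    have : (n : ℝ) - 2 * k ≠ 0 := by linarith
    rw [hκ_def]; field_simp; ring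
  have e2 : Real.exp (-2 * (xi v (Real.log r) + Real.log r)) =
      Real.exp (-2 * xi v (Real.log r)) / r ^ 2 := by
    rw [mul_add, Real.exp_add, div_eq_mul_inv]
    congr 1
    rw [neg_mul, Real.exp_neg, two_mul, Real.exp_add, Real.exp_log h0, sq]
  simp only [Pi.div_apply]
  rw [rt.confFactor_eq hr, Real.div_rpow (Real.exp_pos _).le hr1.le, ← Real.exp_mul, e1, e2]
  ring

/-- Near an end with `ξ → -∞` the function `v` vanishes to first order with slope `-1`, as for the
hyperbolic metric. -/
theorem tendsto_confFactor_div (hn : 3 ≤ n) (hk : 1 < k)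
    (rt : RadialTrajectory n k h (-1) v S) {b : ℝ}
    (hl : IsRightEnd (Real.exp ⁻¹' S) (𝓝[<] b))
    (hp : ∀ t ∈ Real.exp ⁻¹' S, xit v t < 0) (hξ : Tendsto (xi v) (𝓝[<] b) atBot) :
    Tendsto (fun r => confFactor v r / (Real.exp b - r) ^ (-2 : ℝ)) (𝓝[<] (Real.exp b))
      (𝓝 1) := by
  obtain ⟨-, hlim⟩ := rt.traj.asymptotics_of_tendsto_atBot hn hk hl hp hξ
  obtain ⟨t₀, ht₀⟩ := rt.traj.curve.nonempty
  have hlog := tendsto_log_nhdsLT_exp b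
  have hS : ∀ᶠ r in 𝓝[<] (Real.exp b), r ∈ S :=
    eventually_mem ((hl.eventually ht₀).mono fun t ht => ht.1) hlog (by
      filter_upwards [Ioo_mem_nhdsLT (Real.exp_pos b)] with r hr using hr.1)
  have hid : Tendsto (fun r : ℝ => r) (𝓝[<] (Real.exp b)) (𝓝 (Real.exp b)) :=
    tendsto_id.mono_left nhdsWithin_le_nhds
  have hquot : Tendsto (fun r => v r / (Real.exp b - r)) (𝓝[<] (Real.exp b)) (𝓝 1) := by
    refine HasDerivAt.lhopital_zero_nhdsLT
      (f' := fun r => (1 + xit v (Real.log r)) * Real.exp (xi v (Real.log r)))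
      (g' := fun _ => -1) ?_ ?_ ?_ ?_ ?_ ?_
    · filter_upwards [hS] with r hr using rt.hasDerivAt hr
    · exact Eventually.of_forall fun r => (hasDerivAt_id r).const_sub _
    · exact Eventually.of_forall fun r => by norm_num
    · have h1 := hid.mul ((Real.tendsto_exp_atBot.comp hξ).comp hlog)
      rw [mul_zero] at h1
      refine h1.congr' ?_
      filter_upwards [hS] with r hr using (rt.apply_eq hr).symm
    · have := hid.const_sub (Real.exp b)
      rwa [sub_self] at this
    · have h1 := (((Real.tendsto_exp_atBot.comp hξ).add hlim).comp hlog).neg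
      rw [zero_add, neg_neg] at h1
      refine h1.congr fun r => ?_
      simp only [Function.comp_apply]
      ring
  have h2 := (hquot.pow 2).inv₀ (by norm_num)
  rw [one_pow, inv_one] at h2
  refine h2.congr' ?_
  filter_upwards [self_mem_nhdsWithin] with r hr
  have : 0 < Real.exp b - r := sub_pos.2 hr
  rw [confFactor, Real.rpow_neg this.le, Real.rpow_two, div_pow, inv_div, div_inv_eq_mul]
  ring

/-- The `g`-length of a curve bounds the variation of `ξ` along it where `|ξ_t| e^ξ` is bounded;
hence an end at which `ξ` is infinite is at infinite distance. -/
theorem completeToward (rt : RadialTrajectory n k h s v S) {c C : ℝ}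
    (hC : ∀ᶠ r in 𝓝[S] c, |xit v (Real.log r)| * Real.exp (xi v (Real.log r)) ≤ C)
    (hinf : Tendsto (fun r => |xi v (Real.log r)|) (𝓝[S] c) atTop) : CompleteToward n v S c := by
  intro γ hγ hγS hγc
  by_contra hfin
  -- On `(s₁, 1)` the curve stays in the region where `|ξ_t| e^ξ ≤ C`.
  have hγt : Tendsto (fun s => ‖γ s‖) (𝓝[<] 1) (𝓝[S] c) := by
    refine tendsto_nhdsWithin_iff.2 ⟨hγc, ?_⟩
    filter_upwards [Ioo_mem_nhdsLT one_pos] with s hs using hγS s ⟨hs.1.le, hs.2⟩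
  obtain ⟨s₁, hs₁, hbd⟩ := (mem_nhdsLT_iff_exists_Ioo_subset' one_pos).1 (hγt.eventually hC)
  set s₀ := (max s₁ 0 + 1) / 2 with hs₀
  have hs₁1 : s₁ < 1 := hs₁
  have hm : max s₁ 0 < 1 := max_lt hs₁1 one_pos
  have h01 : s₀ < 1 := by linarith
  have h0 : 0 < s₀ := by linarith [le_max_right s₁ 0]
  have h1 : s₁ < s₀ := by linarith [le_max_left s₁ 0]
  have hγd : ∀ s ∈ Ioo (0 : ℝ) 1, HasDerivAt γ (deriv γ s) s := fun s hs =>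
    ((hγ.differentiableOn one_ne_zero).differentiableAt
      (mem_of_superset (isOpen_Ioo.mem_nhds hs) Ioo_subset_Ico_self)).hasDerivAt
  have hγc1 : ContinuousOn (deriv γ) (Ioo 0 1) :=
    (hγ.mono Ioo_subset_Ico_self).continuousOn_deriv_of_isOpen isOpen_Ioo le_rfl
  have hγS' : ∀ s ∈ Ioo (0 : ℝ) 1, ‖γ s‖ ∈ S := fun s hs => hγS s ⟨hs.1.le, hs.2⟩
  have hvc : ContinuousOn v S := fun r hr => (rt.hasDerivAt hr).continuousAt.continuousWithinAt
  have hgc : ContinuousOn (fun s => ‖deriv γ s‖ / v ‖γ s‖) (Ioo 0 1) := by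
    refine hγc1.norm.div (hvc.comp ?_ hγS') fun s hs => (rt.maximal.1.pos _ (hγS' s hs)).ne'
    exact fun s hs => (hγd s hs).continuousAt.norm.continuousWithinAt
  set I := ∫⁻ s in Ioo (0 : ℝ) 1, ENNReal.ofReal (‖deriv γ s‖ / v ‖γ s‖) with hI
  have hg0 : ∀ s ∈ Ioo (0 : ℝ) 1, 0 ≤ ‖deriv γ s‖ / v ‖γ s‖ := fun s hs =>
    div_nonneg (norm_nonneg _) (rt.maximal.1.pos _ (hγS' s hs)).le
  have hder : ∀ s ∈ Ioo (0 : ℝ) 1, ∃ d, HasDerivAt (fun s => xi v (Real.log ‖γ s‖)) d s ∧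
      |d| ≤ |xit v (Real.log ‖γ s‖)| * Real.exp (xi v (Real.log ‖γ s‖)) *
        (‖deriv γ s‖ / v ‖γ s‖) := by
    intro s hs
    have hr := hγS' s hs
    have hr0 := rt.pos hr
    have hne : γ s ≠ 0 := norm_pos_iff.1 hr0
    have d2 : HasDerivAt (fun s => ‖γ s‖) (2 * inner ℝ (γ s) (deriv γ s) / (2 * ‖γ s‖)) s := by
      have := (hγd s hs).norm_sq.sqrt (by positivity)
      simpa only [Real.sqrt_sq (norm_nonneg _)] using this
    have d3 := (rt.traj.curve.hasDerivAt_fst _ (rt.log_mem hr)).comp s (d2.log hr0.ne')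
    refine ⟨_, d3, ?_⟩
    rw [abs_mul, mul_assoc]
    refine mul_le_mul_of_nonneg_left ?_ (abs_nonneg _)
    have e1 : Real.exp (xi v (Real.log ‖γ s‖)) * (‖deriv γ s‖ / v ‖γ s‖) =
        ‖deriv γ s‖ / ‖γ s‖ := by
      have := (Real.exp_pos (xi v (Real.log ‖γ s‖))).ne'
      have h3 := rt.apply_eq hr
      set E := Real.exp (xi v (Real.log ‖γ s‖))
      rw [h3]
      field_simp
    rw [e1, mul_div_mul_left _ _ two_ne_zero, abs_div, abs_of_pos hr0, abs_div, abs_of_pos hr0]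
    refine div_le_div_of_nonneg_right ?_ hr0.le
    rw [div_le_iff₀ hr0, mul_comm]
    exact abs_real_inner_le_norm _ _
  have hC0 : 0 ≤ C := by
    have := @hbd s₀ ⟨h1, h01⟩
    exact (mul_nonneg (abs_nonneg _) (Real.exp_pos _).le).trans this
  -- The variation of `ξ` along the curve is at most `C` times the length.
  have hle : ∀ s₂ ∈ Ioo s₀ 1, |xi v (Real.log ‖γ s₂‖) - xi v (Real.log ‖γ s₀‖)| ≤ C * I.toReal := by
    intro s₂ hs₂
    have hsub : Icc s₀ s₂ ⊆ Ioo 0 1 := fun s hs => ⟨h0.trans_le hs.1, hs.2.trans_lt hs₂.2⟩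
    have hint : ContinuousOn (fun s => ‖deriv γ s‖ / v ‖γ s‖) (Icc s₀ s₂) := hgc.mono hsub
    have hii : IntervalIntegrable (fun s => ‖deriv γ s‖ / v ‖γ s‖) volume s₀ s₂ :=
      hint.intervalIntegrable_of_Icc hs₂.1.le
    have h2 := norm_sub_le_integral_of_norm_deriv_le_of_le
      (f := fun s => xi v (Real.log ‖γ s‖))
      (B := fun s => C * (‖deriv γ s‖ / v ‖γ s‖)) hs₂.1.le
      (fun s hs => (hder s (hsub hs)).choose_spec.1.continuousAt.continuousWithinAt)
      (fun s hs => (hder s (hsub (Ioo_subset_Icc_self hs))).choose_spec.1.differentiableAt.differentiableWithinAt)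
      (Eventually.of_forall fun s hs => by
        have hs' := hsub (Ioo_subset_Icc_self hs)
        obtain ⟨d, hd, hd'⟩ := hder s hs'
        rw [hd.deriv, Real.norm_eq_abs]
        exact hd'.trans (mul_le_mul_of_nonneg_right (hbd ⟨h1.trans hs.1, hs'.2⟩) (hg0 s hs')))
      (hii.const_mul C)
    rw [Real.norm_eq_abs] at h2
    refine h2.trans ?_
    rw [intervalIntegral.integral_const_mul, intervalIntegral.integral_of_le hs₂.1.le]
    refine mul_le_mul_of_nonneg_left ?_ hC0
    rw [integral_eq_lintegral_of_nonneg_ae]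
    · exact ENNReal.toReal_mono hfin (lintegral_mono_set fun s hs =>
        hsub (Ioc_subset_Icc_self hs))
    · refine (ae_restrict_iff' measurableSet_Ioc).2 (Eventually.of_forall fun s hs => ?_)
      exact hg0 s (hsub (Ioc_subset_Icc_self hs))
    · exact (hint.mono Ioc_subset_Icc_self).aestronglyMeasurable measurableSet_Ioc
  have hev : ∀ᶠ s in 𝓝[<] (1 : ℝ), s ∈ Ioo s₀ 1 := Ioo_mem_nhdsLT h01
  obtain ⟨s₂, hs₂, hgt⟩ := (hev.and
    ((hinf.comp hγt).eventually_gt_atTop (C * I.toReal + |xi v (Real.log ‖γ s₀‖)|))).exists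
  have h3 := hle s₂ hs₂
  have h4 := abs_sub_abs_le_abs_sub (xi v (Real.log ‖γ s₂‖)) (xi v (Real.log ‖γ s₀‖))
  simp only [Function.comp_apply] at hgt
  linarith

/-- If `v⁻¹` is bounded by an integrable power of `r`, then a radial segment has finite length. -/
theorem not_completeToward (hn : 3 ≤ n) {β C δ : ℝ}
    (hβ : 0 < β) (hδ : 0 < δ) (hS : ∀ r, 0 < r → r ≤ δ → r ∈ S)
    (hC : ∀ r, 0 < r → r ≤ δ → (v r)⁻¹ ≤ C * r ^ (β - 1)) : ¬ CompleteToward n v S 0 := by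
  intro hcomp
  obtain ⟨e, he⟩ := exists_euclidean_norm_eq hn hδ
  have hγd : ∀ s : ℝ, HasDerivAt (fun s : ℝ => (1 - s) • e) ((-1 : ℝ) • e) s := fun s =>
    ((hasDerivAt_id s).const_sub 1).smul_const e
  have hnorm : ∀ s ∈ Ico (0 : ℝ) 1, ‖(1 - s) • e‖ = (1 - s) * δ := fun s hs => by
    rw [norm_smul, he, Real.norm_eq_abs, abs_of_pos (by linarith [hs.2])]
  have hr : ∀ s ∈ Ico (0 : ℝ) 1, 0 < (1 - s) * δ ∧ (1 - s) * δ ≤ δ := fun s hs =>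
    ⟨mul_pos (by linarith [hs.2]) hδ, by nlinarith [hs.1]⟩
  have h := hcomp (fun s => (1 - s) • e)
    ((contDiff_const.sub contDiff_id).smul contDiff_const).contDiffOn
    (fun s hs => by rw [hnorm s hs]; exact hS _ (hr s hs).1 (hr s hs).2) (by
      have h1 : Tendsto (fun s : ℝ => ‖(1 - s) • e‖) (𝓝 1) (𝓝 ‖((1 : ℝ) - 1) • e‖) :=
        ((continuous_const.sub continuous_id).smul continuous_const).norm.tendsto 1
      rw [sub_self, zero_smul, norm_zero] at h1
      exact h1.mono_left nhdsWithin_le_nhds)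
  have hint : IntegrableOn (fun s : ℝ => δ * (C * ((1 - s) * δ) ^ (β - 1))) (Ioo 0 1) := by
    have h1 : IntervalIntegrable (fun x : ℝ => x ^ (β - 1)) volume 0 δ :=
      intervalIntegral.intervalIntegrable_rpow' (by linarith)
    have h2 : IntervalIntegrable (fun x : ℝ => (x * δ) ^ (β - 1)) volume 0 1 := by
      have := h1.comp_mul_right (c := δ)
      rwa [zero_div, div_self hδ.ne'] at this
    have h3 := (h2.comp_sub_left 1).symm
    rw [sub_self, sub_zero] at h3
    exact (((intervalIntegrable_iff_integrableOn_Ioo_of_le zero_le_one).1 h3).const_mul C).const_mul δ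
  refine absurd h (ne_of_lt ((lintegral_mono_ae ?_).trans_lt hint.lintegral_lt_top))
  refine (ae_restrict_iff' measurableSet_Ioo).2 (Eventually.of_forall fun s hs => ?_)
  have hs' : s ∈ Ico (0 : ℝ) 1 := ⟨hs.1.le, hs.2⟩
  refine ENNReal.ofReal_le_ofReal ?_
  rw [(hγd s).deriv, hnorm s hs', neg_one_smul, norm_neg, he, div_eq_mul_inv]
  exact mul_le_mul_of_nonneg_left (hC _ (hr s hs').1 (hr s hs').2) hδ.le

end RadialTrajectory

/-! ### The threshold `h*` -/

section

variable {n k : ℕ} {h : ℝ}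

theorem hStar_pos (hn : 3 ≤ n) (hnk : n < 2 * k) : 0 < hStar n k := by
  have hn0 : (0 : ℝ) < n := by positivity
  have hnk' : (n : ℝ) < 2 * k := by exact_mod_cast hnk
  have h1 : 0 < 2 * (k : ℝ) - n := by linarith
  have h2 : 0 < 2 * (k : ℝ) := by linarith
  exact mul_pos (by positivity) (Real.rpow_pos_of_pos (by positivity) _)

theorem exp_mul_xiStar (hn : 3 ≤ n) (hnk : n < 2 * k) (hh : 0 < h) :
    Real.exp (n * xiStar n k h) = 2 * (k : ℝ) / ((2 * k - n) * h) := by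
  have hn0 : (0 : ℝ) < n := by positivity
  have hnk' : (n : ℝ) < 2 * k := by exact_mod_cast hnk
  have h1 : 0 < 2 * (k : ℝ) - n := by linarith
  have h2 : 0 < 2 * (k : ℝ) := by linarith
  rw [xiStar, ← mul_assoc, mul_one_div_cancel hn0.ne', one_mul, Real.exp_log (by positivity)]

/-- The maximum of the potential as a function of `h`. -/
theorem potential_xiStar (hn : 3 ≤ n) (hnk : n < 2 * k) (hh : 0 < h) :
    potential n k h (xiStar n k h) = (h / hStar n k) ^ (2 * (k : ℝ) / n) := by
  have hn0 : (0 : ℝ) < n := by positivity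
  have hnk' : (n : ℝ) < 2 * k := by exact_mod_cast hnk
  have h1 : 0 < 2 * (k : ℝ) - n := by linarith
  have h2 : 0 < 2 * (k : ℝ) := by linarith
  set d := 2 * (k : ℝ) / (2 * k - n) with hd
  have hd0 : 0 < d := by positivity
  have e1 : Real.exp (-(2 * (k : ℝ)) * xiStar n k h) = (h / d) ^ (2 * (k : ℝ) / n) := by
    have : 2 * (k : ℝ) / ((2 * k - n) * h) = (h / d)⁻¹ := by rw [hd]; field_simp
    rw [xiStar, this, Real.log_inv, Real.rpow_def_of_pos (by positivity)]
    congr 1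
    field_simp
  have e2 : (hStar n k) ^ (2 * (k : ℝ) / n) =
      d ^ (2 * (k : ℝ) / n) * ((2 * (k : ℝ) - n) / n) := by
    rw [hStar, Real.mul_rpow hd0.le (Real.rpow_nonneg (by positivity) _), ← Real.rpow_mul
      (by positivity), show (n : ℝ) / (2 * k) * (2 * k / n) = 1 by rw [div_mul_div_comm, mul_comm (n : ℝ), div_self (by positivity)], Real.rpow_one]
  rw [potential_eq, exp_mul_xiStar hn hnk hh, e1, Real.div_rpow hh.le (hStar_pos hn hnk).le, e2,
    Real.div_rpow hh.le hd0.le]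
  have := (Real.rpow_pos_of_pos hd0 (2 * (k : ℝ) / n)).ne'
  field_simp
  ring

theorem potentialDeriv_eq (x : ℝ) : potentialDeriv n k h x =
    Real.exp (-(2 * (k : ℝ)) * x) * (2 * k - (2 * k - n) * h * Real.exp (n * x)) := by
  have : Real.exp (((n : ℝ) - 2 * k) * x) =
      Real.exp (-(2 * (k : ℝ)) * x) * Real.exp (n * x) := by
    rw [← Real.exp_add]; ring_nf
  rw [potentialDeriv, this]
  ring

theorem potentialDeriv_pos_of_le (hk : 1 < k) (hnk : 2 * k ≤ n) (hh : 0 < h) (x : ℝ) :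
    0 < potentialDeriv n k h x := by
  have hk0 : (0 : ℝ) < k := by positivity
  have hnk' : 2 * (k : ℝ) ≤ n := by exact_mod_cast hnk
  rw [potentialDeriv_eq]
  refine mul_pos (Real.exp_pos _) ?_
  have h1 : 0 ≤ ((n : ℝ) - 2 * k) * (h * Real.exp (n * x)) :=
    mul_nonneg (by linarith) (by positivity)
  nlinarith

theorem exp_mul_lt_iff (hn : 3 ≤ n) (hnk : n < 2 * k) (hh : 0 < h) {x : ℝ} :
    (2 * (k : ℝ) - n) * h * Real.exp (n * x) < 2 * k ↔ x < xiStar n k h := by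
  have hn0 : (0 : ℝ) < n := by positivity
  have hnk' : (n : ℝ) < 2 * k := by exact_mod_cast hnk
  have h1 : 0 < (2 * (k : ℝ) - n) * h := mul_pos (by linarith) hh
  rw [← lt_div_iff₀' h1, ← exp_mul_xiStar hn hnk hh, Real.exp_lt_exp, mul_lt_mul_iff_right₀ hn0]

theorem lt_exp_mul_iff (hn : 3 ≤ n) (hnk : n < 2 * k) (hh : 0 < h) {x : ℝ} :
    2 * (k : ℝ) < (2 * (k : ℝ) - n) * h * Real.exp (n * x) ↔ xiStar n k h < x := by
  have hn0 : (0 : ℝ) < n := by positivity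
  have hnk' : (n : ℝ) < 2 * k := by exact_mod_cast hnk
  have h1 : 0 < (2 * (k : ℝ) - n) * h := mul_pos (by linarith) hh
  rw [← div_lt_iff₀' h1, ← exp_mul_xiStar hn hnk hh, Real.exp_lt_exp, mul_lt_mul_iff_right₀ hn0]

/-- For `2k > n` the point `ξ*` is the unique critical point, a maximum, of the potential. -/
theorem potentialDeriv_pos_iff (hn : 3 ≤ n) (hnk : n < 2 * k) (hh : 0 < h) {x : ℝ} :
    0 < potentialDeriv n k h x ↔ x < xiStar n k h := by
  rw [potentialDeriv_eq, mul_pos_iff_of_pos_left (Real.exp_pos _), sub_pos,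
    exp_mul_lt_iff hn hnk hh]

theorem potentialDeriv_neg_iff (hn : 3 ≤ n) (hnk : n < 2 * k) (hh : 0 < h) {x : ℝ} :
    potentialDeriv n k h x < 0 ↔ xiStar n k h < x := by
  rw [← lt_exp_mul_iff hn hnk hh, potentialDeriv_eq, ← neg_pos, ← mul_neg, neg_sub,
    mul_pos_iff_of_pos_left (Real.exp_pos _), sub_pos]

theorem strictMonoOn_potential (hn : 3 ≤ n) (hnk : n < 2 * k) (hh : 0 < h) :
    StrictMonoOn (potential n k h) (Iic (xiStar n k h)) := by
  refine strictMonoOn_of_deriv_pos (convex_Iic _) continuous_potential.continuousOn fun x hx => ?_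
  rw [interior_Iic] at hx
  rw [(hasDerivAt_potential x).deriv]
  exact (potentialDeriv_pos_iff hn hnk hh).2 hx

theorem strictAntiOn_potential (hn : 3 ≤ n) (hnk : n < 2 * k) (hh : 0 < h) :
    StrictAntiOn (potential n k h) (Ici (xiStar n k h)) := by
  refine strictAntiOn_of_deriv_neg (convex_Ici _) continuous_potential.continuousOn fun x hx => ?_
  rw [interior_Ici] at hx
  rw [(hasDerivAt_potential x).deriv]
  exact (potentialDeriv_neg_iff hn hnk hh).2 hx

theorem potential_lt_xiStar (hn : 3 ≤ n) (hnk : n < 2 * k) (hh : 0 < h) {x : ℝ}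
    (hx : x ≠ xiStar n k h) : potential n k h x < potential n k h (xiStar n k h) := by
  rcases hx.lt_or_gt with h1 | h1
  · exact strictMonoOn_potential hn hnk hh h1.le (mem_Iic.2 le_rfl) h1
  · exact strictAntiOn_potential hn hnk hh (mem_Ici.2 le_rfl) h1.le h1

theorem potential_le_xiStar (hn : 3 ≤ n) (hnk : n < 2 * k) (hh : 0 < h) (x : ℝ) :
    potential n k h x ≤ potential n k h (xiStar n k h) := by
  rcases eq_or_ne x (xiStar n k h) with rfl | hx
  · exact le_rfl
  · exact (potential_lt_xiStar hn hnk hh hx).le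

theorem potential_xiStar_eq_one_iff (hn : 3 ≤ n) (hnk : n < 2 * k) (hh : 0 < h) :
    potential n k h (xiStar n k h) = 1 ↔ h = hStar n k := by
  have hs := hStar_pos hn hnk
  have hn0 : (0 : ℝ) < n := by positivity
  have hnk' : (n : ℝ) < 2 * k := by exact_mod_cast hnk
  have hq : 0 < 2 * (k : ℝ) / n := div_pos (by linarith) hn0
  have := Real.rpow_left_inj (div_pos hh hs).le zero_le_one hq.ne'
  rw [Real.one_rpow] at this
  rw [potential_xiStar hn hnk hh, this, div_eq_one_iff_eq hs.ne']

theorem one_lt_potential_xiStar_iff (hn : 3 ≤ n) (hnk : n < 2 * k) (hh : 0 < h) :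
    1 < potential n k h (xiStar n k h) ↔ hStar n k < h := by
  have hs := hStar_pos hn hnk
  have hn0 : (0 : ℝ) < n := by positivity
  have hnk' : (n : ℝ) < 2 * k := by exact_mod_cast hnk
  have hq : 0 < 2 * (k : ℝ) / n := div_pos (by linarith) hn0
  rw [potential_xiStar hn hnk hh, Real.one_lt_rpow_iff_of_pos (by positivity), one_lt_div hs]
  constructor
  · rintro (h | h)
    · exact h.1
    · linarith [h.2]
  · exact fun h => Or.inl ⟨h, hq⟩

/-- The threshold `h*` is the value of `h` for which the maximum of the potential equals `1`. -/
theorem threshold (hn : 3 ≤ n) (hnk : n < 2 * k) : ∃ M : ℝ → ℝ,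
    (∀ h : ℝ, 0 < h → IsGreatest (range fun x : ℝ =>
      Real.exp (((n : ℝ) - 2 * k) * x) * h - Real.exp (-(2 * (k : ℝ)) * x)) (M h)) ∧
    StrictMonoOn M (Ioi 0) ∧ ∀ h : ℝ, 0 < h → (M h = 1 ↔ h = hStar n k) := by
  have hs := hStar_pos hn hnk
  have hn0 : (0 : ℝ) < n := by positivity
  have hnk' : (n : ℝ) < 2 * k := by exact_mod_cast hnk
  have hq : 0 < 2 * (k : ℝ) / n := div_pos (by linarith) hn0
  refine ⟨fun h => potential n k h (xiStar n k h), fun h hh => ⟨⟨_, rfl⟩, ?_⟩, ?_,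
    fun h hh => potential_xiStar_eq_one_iff hn hnk hh⟩
  · rintro _ ⟨x, rfl⟩
    exact potential_le_xiStar hn hnk hh x
  · intro a ha b hb hab
    simp only [potential_xiStar hn hnk ha, potential_xiStar hn hnk hb]
    exact Real.rpow_lt_rpow (div_nonneg (le_of_lt ha) hs.le) (div_lt_div_of_pos_right hab hs) hq

end

/-! ### Solutions with `1 - ξ_t² > 0` and `2k ≤ n` -/

namespace RadialTrajectory

variable {n k : ℕ} {h s : ℝ} {v : ℝ → ℝ} {S : Set ℝ} {l : Filter ℝ}

/-- Solutions along which `ξ_t ≠ 0` need only be studied when `ξ_t < 0`. -/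
theorem upToInversion (hn : 3 ≤ n) (hk : 1 < k) (hkn : k ≤ n) (rt : RadialTrajectory n k h s v S)
    (h0 : ∀ t ∈ Real.exp ⁻¹' S, xit v t ≠ 0) {P : (ℝ → ℝ) → Set ℝ → Prop}
    (H : ∀ v S, RadialTrajectory n k h s v S → (∀ t ∈ Real.exp ⁻¹' S, xit v t < 0) → P v S) :
    UpToInversion P v S := by
  rcases rt.traj.curve.velocity_dichotomy h0 with hp | hp
  · exact Or.inl (H v S rt hp)
  · refine Or.inr (H _ _ (rt.inversion hn hk hkn) fun t ht => ?_)
    have ht' : Real.exp (-t) ∈ S := by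
      rw [Real.exp_neg]; exact ht
    rw [rt.xit_inversion hn hk hkn ht', neg_lt_zero]
    exact hp _ ht'

theorem xitt_eq (rt : RadialTrajectory n k h s v S) {t : ℝ} (ht : t ∈ Real.exp ⁻¹' S) :
    xitt v t = accel n k (xi v t) (xit v t) := (rt.traj.curve.hasDerivAt_snd t ht).deriv

theorem stopsAt_exp (hn : 3 ≤ n) (hk : 1 < k) (rt : RadialTrajectory n k h s v S) {b x : ℝ}
    (hl : IsRightEnd (Real.exp ⁻¹' S) (𝓝[<] b)) (hξ : Tendsto (xi v) (𝓝[<] b) (𝓝 x))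
    (hp : Tendsto (xit v) (𝓝[<] b) (𝓝 (-1))) (hx : potential n k h x = 0) :
    StopsAt v (𝓝[<] (Real.exp b)) := by
  obtain ⟨t₀, ht₀⟩ := rt.traj.curve.nonempty
  have hlog := tendsto_log_nhdsLT_exp b
  refine rt.stopsAt hn hk (eventually_mem ((hl.eventually ht₀).mono fun t ht => ht.1) hlog ?_)
    (hlog.mono_right nhdsWithin_le_nhds) (hξ.comp hlog) (hp.comp hlog) hx
  filter_upwards [Ioo_mem_nhdsLT (Real.exp_pos b)] with r hr using hr.1

/-- The right end of a solution with `ξ_t < 0` along which the potential is positive. -/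
theorem right_end (hn : 3 ≤ n) (hk : 1 < k) (rt : RadialTrajectory n k h s v S)
    (hl : IsRightEnd (Real.exp ⁻¹' S) l) (hp : ∀ t ∈ Real.exp ⁻¹' S, xit v t < 0)
    (hF : ∀ t ∈ Real.exp ⁻¹' S, 0 < potential n k h (xi v t)) :
    ∃ x, Tendsto (xi v) l (𝓝 x) ∧ (∀ t ∈ Real.exp ⁻¹' S, x ≤ xi v t) ∧
      ((l = atTop ∧ Tendsto (xit v) l (𝓝 0) ∧ potential n k h x = 1) ∨
        ∃ b, l = 𝓝[<] b ∧ Tendsto (xit v) l (𝓝 (-1)) ∧ StopsAt v (𝓝[<] (Real.exp b)) ∧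
          potential n k h x = 0) := by
  have hlim := fun t₀ (ht₀ : t₀ ∈ Real.exp ⁻¹' S) => rt.traj.limit_right hk hl (t₀ := t₀) (ε := -1)
    (m := Real.log h / n) ht₀ (Or.inr rfl) (fun t ht _ => by linarith [hp t ht]) (fun t ht _ => by
      have := Trajectory.lower_bound_of_potential_pos hn (hF t ht)
      rw [neg_div] at this
      linarith)
  obtain ⟨t₀, ht₀⟩ := rt.traj.curve.nonempty
  have := hl.neBot
  obtain ⟨x, hξ, -, hx⟩ := hlim t₀ ht₀
  refine ⟨x, hξ, fun t ht => ?_, ?_⟩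
  · obtain ⟨y, hy, hle, -⟩ := hlim t ht
    obtain rfl := tendsto_nhds_unique hξ hy
    linarith [hle t ht le_rfl]
  · rcases hx with hx | ⟨⟨b, rfl⟩, hp1, hx⟩
    · exact Or.inl hx
    · exact Or.inr ⟨b, rfl, hp1, rt.stopsAt_exp hn hk hl hξ hp1 hx, hx⟩

/-- The left end of a solution with `ξ_t < 0`: there `ξ → ∞`, or else `ξ` has a finite limit. -/
theorem left_end (hk : 1 < k) (rt : RadialTrajectory n k h s v S)
    (hl : IsLeftEnd (Real.exp ⁻¹' S) l) (hp : ∀ t ∈ Real.exp ⁻¹' S, xit v t < 0) :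
    Tendsto (xi v) l atTop ∨ ∃ x, Tendsto (xi v) l (𝓝 x) ∧ (∀ t ∈ Real.exp ⁻¹' S, xi v t ≤ x) ∧
      ((l = atBot ∧ Tendsto (xit v) l (𝓝 0) ∧ potential n k h x = 1) ∨
        ((∃ a, l = 𝓝[>] a) ∧ Tendsto (xit v) l (𝓝 (-1)) ∧ potential n k h x = 0)) := by
  obtain ⟨t₀, ht₀⟩ := rt.traj.curve.nonempty
  have hneg : ∀ t₀ : ℝ, ∀ t ∈ Real.exp ⁻¹' S, t ≤ t₀ → 1 * xit v t ≤ 0 := fun _ t ht _ => by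
    linarith [hp t ht]
  by_cases hb : ∃ m, ∀ t ∈ Real.exp ⁻¹' S, t ≤ t₀ → 1 * xi v t ≤ m
  · right
    obtain ⟨m, hm⟩ := hb
    obtain ⟨x, hξ, hle, hx⟩ := rt.traj.limit_left hk hl ht₀ (Or.inl rfl) (hneg t₀) hm
    have := hl.neBot
    refine ⟨x, hξ, fun t ht => ?_, hx⟩
    rcases le_total t t₀ with h1 | h1
    · linarith [hle t ht h1]
    · have h2 := rt.traj.limit_left hk hl ht (ε := 1) (m := max m (xi v t₀)) (Or.inl rfl) (hneg t)
        (fun r hr _ => by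
          rcases le_total r t₀ with h3 | h3
          · exact (hm r hr h3).trans (le_max_left _ _)
          · have h4 := rt.traj.monotoneOn (ε := -1) (t₀ := t₀)
              (fun u hu _ => by linarith [hp u hu]) ⟨ht₀, mem_Ici.2 le_rfl⟩ ⟨hr, h3⟩ h3
            simp only at h4
            exact le_trans (by linarith) (le_max_right _ _))
      obtain ⟨y, hy, hle', -⟩ := h2
      obtain rfl := tendsto_nhds_unique hξ hy
      linarith [hle' t ht le_rfl]
  · left
    simpa using rt.traj.tendsto_left_of_unbounded hl (hneg t₀) hb

/-- For `1 - ξ_t² > 0` and `ξ_t < 0` the left end is at `-∞`. -/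
theorem left_end_of_pos (hk : 1 < k) (rt : RadialTrajectory n k h 1 v S)
    (hl : IsLeftEnd (Real.exp ⁻¹' S) l) (hp : ∀ t ∈ Real.exp ⁻¹' S, xit v t < 0) :
    l = atBot ∧ (Tendsto (xi v) l atTop ∨ ∃ x, Tendsto (xi v) l (𝓝 x) ∧
      (∀ t ∈ Real.exp ⁻¹' S, xi v t ≤ x) ∧ Tendsto (xit v) l (𝓝 0) ∧ potential n k h x = 1) := by
  obtain ⟨t₀, ht₀⟩ := rt.traj.curve.nonempty
  rcases rt.left_end hk hl hp with h1 | ⟨x, hξ, hle, (⟨hb, hp0, hx⟩ | ⟨-, -, hx⟩)⟩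
  · exact ⟨rt.traj.eq_atBot_of_unbounded hl (ε := 1) (C := 1) ht₀
      (fun t ht _ => by linarith [(rt.traj.velocity_sq_lt_one ht).1]) (by simpa using h1), Or.inl h1⟩
  · exact ⟨hb, Or.inr ⟨x, hξ, hle, hp0, hx⟩⟩
  · exfalso
    have h1 := rt.traj.potential_pos ht₀
    have hh := Trajectory.h_pos_of_potential_pos h1
    rw [potential_pos_iff] at h1
    rw [potential_eq_zero_iff] at hx
    have : Real.exp (n * xi v t₀) ≤ Real.exp (n * x) :=
      Real.exp_le_exp.2 (mul_le_mul_of_nonneg_left (hle t₀ ht₀) (by positivity))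
    nlinarith

/-- A solution confined to a region where the potential increases is concave and has two finite
ends. -/
theorem concave (hn : 3 ≤ n) (hk : 1 < k) (rt : RadialTrajectory n k h 1 v S) {x₁ : ℝ}
    (hx₁ : ∀ t ∈ Real.exp ⁻¹' S, xi v t ≤ x₁) (hF : ∀ x ≤ x₁, 0 < potentialDeriv n k h x) :
    ∃ a b : ℝ, 0 < a ∧ a < b ∧ S = Ioo a b ∧
      SecondDerivBlowsUp v (𝓝[>] a) ∧ SecondDerivBlowsUp v (𝓝[<] b) ∧
      InterceptsLine v (𝓝[>] (Real.log a)) 1 ∧ InterceptsLine v (𝓝[<] (Real.log b)) (-1) := by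
  have hc := rt.traj.curve
  obtain ⟨t₀, ht₀⟩ := hc.nonempty
  obtain ⟨l, hl⟩ := exists_isLeftEnd hc.isOpen hc.ordConnected hc.nonempty
  obtain ⟨l', hl'⟩ := exists_isRightEnd hc.isOpen hc.ordConnected hc.nonempty
  obtain ⟨x, ⟨a, rfl⟩, hξ, hp, hx⟩ := rt.traj.concave_left hn hk hl hx₁ hF
  obtain ⟨x', ⟨b, rfl⟩, hξ', hp', hx'⟩ := rt.traj.concave_right hn hk hl' hx₁ hF
  obtain ⟨hS, hab⟩ := radii_eq_Ioo hc.nonempty hl hl'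
  rw [rt.radii_eq] at hS
  have hlog := tendsto_log_nhdsGT_exp a
  refine ⟨Real.exp a, Real.exp b, Real.exp_pos _, Real.exp_lt_exp.2 hab, hS, ?_,
    (rt.stopsAt_exp hn hk hl' hξ' hp' hx').2.2, ?_, ?_⟩
  · refine rt.secondDerivBlowsUp hn hk
      (eventually_mem ((hl.eventually ht₀).mono fun t ht => ht.1) hlog ?_)
      (hlog.mono_right nhdsWithin_le_nhds) (by norm_num) (hξ.comp hlog) (hp.comp hlog) hx
    filter_upwards [self_mem_nhdsWithin] with r hr using (Real.exp_pos a).trans hr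
  · rw [Real.log_exp]; exact ⟨⟨x, hξ⟩, hp⟩
  · rw [Real.log_exp]; exact ⟨⟨x', hξ'⟩, hp'⟩

theorem h_pos (rt : RadialTrajectory n k h 1 v S) : 0 < h := by
  obtain ⟨t₀, ht₀⟩ := rt.traj.curve.nonempty
  exact Trajectory.h_pos_of_potential_pos (rt.traj.potential_pos ht₀)

/-- If the potential increases and eventually exceeds `1`, then `ξ` is concave and both ends of the
domain are positive and finite. -/
theorem annulusBlowUp (hn : 3 ≤ n) (hk : 1 < k) (hnk : 2 * k ≤ n)
    (rt : RadialTrajectory n k h 1 v S) (hF : ∀ᶠ x in atTop, 1 < potential n k h x) :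
    AnnulusBlowUp v S := by
  obtain ⟨x₁, hx₁⟩ := eventually_atTop.1 hF
  obtain ⟨a, b, h1, h2, h3, h4, h5, -⟩ := rt.concave hn hk (x₁ := x₁)
    (fun t ht => by
      by_contra hcon
      exact absurd (rt.traj.potential_le_one ht) (not_le.2 (hx₁ _ (not_le.1 hcon).le)))
    (fun x _ => potentialDeriv_pos_of_le hk hnk rt.h_pos x)
  exact ⟨a, b, h1, h2, h3, h4, h5⟩

theorem annulusBlowUp_of_lt (hn : 3 ≤ n) (hk : 1 < k) (hnk : 2 * k < n)
    (rt : RadialTrajectory n k h 1 v S) : AnnulusBlowUp v S := by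
  have hn0 : (0 : ℝ) < n := by positivity
  have hnk' : 2 * (k : ℝ) < n := by exact_mod_cast hnk
  refine rt.annulusBlowUp hn hk hnk.le ?_
  have h1 := (tendsto_exp_neg_mul_atTop hn0).const_sub h
  rw [sub_zero] at h1
  have h2 : Tendsto (fun x => Real.exp (((n : ℝ) - 2 * k) * x)) atTop atTop :=
    Real.tendsto_exp_atTop.comp (tendsto_id.const_mul_atTop (by linarith))
  filter_upwards [(h2.atTop_mul_pos rt.h_pos h1).eventually_gt_atTop 1] with x hx
  rwa [potential_eq']

theorem potential_of_two_mul_eq (hnk : 2 * k = n) (x : ℝ) :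
    potential n k h x = h - Real.exp (-(n * x)) := by
  rw [potential_eq', ← hnk]
  simp

theorem xit_ne_zero (rt : RadialTrajectory n k h s v S) {t : ℝ}
    (ht : t ∈ Real.exp ⁻¹' S) (hF : potential n k h (xi v t) ≠ 1) : xit v t ≠ 0 := by
  intro h0
  have := rt.traj.energy t ht
  rw [h0] at this
  norm_num at this
  exact hF this.symm

theorem not_completeToward_of_lt (hn : 3 ≤ n) (hk : 1 < k) (hnk : 2 * k = n)
    (rt : RadialTrajectory n k h s v S) (hT : ∀ᶠ t in atBot, t ∈ Real.exp ⁻¹' S)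
    (hp : ∀ᶠ t in atBot, xit v t < 0) (hξ : Tendsto (xi v) atBot atTop)
    (hβ : s * kthRoot k h < 1) : ¬ CompleteToward n v S 0 := by
  obtain ⟨L, hL⟩ := rt.traj.asymptotics_of_eq hn hk hnk hT hp hξ hβ
  set β := Real.sqrt (1 - s * kthRoot k h) with hβ_def
  have hβ0 : 0 < β := Real.sqrt_pos.2 (by linarith)
  obtain ⟨t₁, ht₁⟩ := eventually_atBot.1
    (hT.and (hL.eventually (lt_mem_nhds (show L - 1 < L by linarith))))
  have hlog : ∀ r : ℝ, 0 < r → r ≤ Real.exp t₁ → Real.log r ≤ t₁ := fun r hr h => by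
    rwa [Real.log_le_iff_le_exp hr]
  have hS : ∀ r : ℝ, 0 < r → r ≤ Real.exp t₁ → r ∈ S := fun r hr h => by
    have := (ht₁ _ (hlog r hr h)).1
    rwa [mem_preimage, Real.exp_log hr] at this
  refine RadialTrajectory.not_completeToward hn (β := β) (C := Real.exp (1 - L)) hβ0
    (Real.exp_pos t₁) hS fun r hr h => ?_
  have h1 := (ht₁ _ (hlog r hr h)).2
  rw [rt.apply_eq (hS r hr h), Real.rpow_def_of_pos hr, ← Real.exp_add]
  nth_rewrite 1 [← Real.exp_log hr]
  rw [← Real.exp_add, ← Real.exp_neg, Real.exp_le_exp]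
  linarith

theorem caseIEq (hn : 3 ≤ n) (hk : 1 < k) (hkn : k ≤ n) (hnk : 2 * k = n)
    (rt : RadialTrajectory n k h 1 v S) : UpToInversion (CaseIEq n k h) v S := by
  have hn0 : (0 : ℝ) < n := by positivity
  have hk0 : (0 : ℝ) < k := by positivity
  have hh := rt.h_pos
  rcases lt_or_ge 1 h with h1 | h1
  · refine Or.inl (Or.inr (Or.inr ⟨h1, rt.annulusBlowUp hn hk hnk.le ?_⟩))
    have h2 := (tendsto_exp_neg_mul_atTop hn0).const_sub h
    rw [sub_zero] at h2
    filter_upwards [h2.eventually (lt_mem_nhds h1)] with x hx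
    rwa [potential_of_two_mul_eq hnk]
  -- For `h ≤ 1` the potential stays below `1`, so that `ξ_t` does not vanish.
  have hF1 : ∀ x, potential n k h x ≠ 1 := fun x => by
    rw [potential_of_two_mul_eq hnk]
    exact ne_of_lt (by linarith [Real.exp_pos (-(n * x))])
  refine rt.upToInversion hn hk hkn (fun t ht => rt.xit_ne_zero ht (hF1 _)) ?_
  intro v S rt hp
  have hc := rt.traj.curve
  obtain ⟨t₀, ht₀⟩ := hc.nonempty
  obtain ⟨l, hl⟩ := exists_isLeftEnd hc.isOpen hc.ordConnected hc.nonempty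
  obtain ⟨l', hl'⟩ := exists_isRightEnd hc.isOpen hc.ordConnected hc.nonempty
  obtain ⟨rfl, (hξ | ⟨x, -, -, -, hx⟩)⟩ := rt.left_end_of_pos hk hl hp
  swap
  · exact absurd hx (hF1 x)
  obtain ⟨x, -, -, (⟨-, -, hx⟩ | ⟨b, rfl, -, hst, -⟩)⟩ := rt.right_end hn hk hl' hp
    (fun t ht => rt.traj.potential_pos ht)
  · exact absurd hx (hF1 x)
  have hS := radii_eq_Ioo_zero hc.nonempty hl hl'
  rw [rt.radii_eq] at hS
  have hT : ∀ᶠ t in atBot, t ∈ Real.exp ⁻¹' S := (hl.eventually ht₀).mono fun t ht => ht.1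
  have hpe : ∀ᶠ t in atBot, xit v t < 0 := hT.mono hp
  rcases h1.lt_or_eq with h1 | rfl
  · have hβ : 1 * kthRoot k h < 1 := by
      rw [one_mul, kthRoot, abs_of_pos hh]
      exact Real.rpow_lt_one hh.le h1 (by positivity)
    refine Or.inl ⟨hh, h1, Real.exp b, Real.exp_pos b, hS, hst, ?_,
      rt.not_completeToward_of_lt hn hk hnk hT hpe hξ hβ⟩
    simpa using rt.asympMultiple_rpow hn hk hnk hT hpe hξ hβ
  · refine Or.inr (Or.inl ⟨rfl, Real.exp b, Real.exp_pos b, hS, hst,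
      rt.asympMultiple_log hn hk hnk hT hpe hξ, ?_⟩)
    have hlog : Tendsto Real.log (𝓝[S] 0) atBot := by
      rw [hS, nhdsWithin_Ioo_eq_nhdsGT (Real.exp_pos b)]
      exact Real.tendsto_log_nhdsGT_zero
    have h2 := (rt.traj.asymptotics_of_h_eq_one hn hk hnk hT hpe hξ).abs
    refine rt.completeToward (C := |(-Real.sqrt (1 / k))| + 1) ?_
      (tendsto_abs_atTop_atTop.comp (hξ.comp hlog))
    filter_upwards [(h2.comp hlog).eventually (gt_mem_nhds (lt_add_one _)),
      (hξ.comp hlog).eventually_ge_atTop 0] with r hr hr0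
    simp only [Function.comp_apply] at hr hr0
    rw [abs_mul, abs_of_pos (Real.exp_pos _)] at hr
    refine le_trans (mul_le_mul_of_nonneg_left (Real.exp_le_exp.2 ?_) (abs_nonneg _)) hr.le
    have : (1 : ℝ) ≤ k := by exact_mod_cast hk.le
    nlinarith

end RadialTrajectory

/-! ### Solutions with `1 - ξ_t² > 0` and `2k > n` -/

/-- The equilibrium `ξ ≡ ξ*` at the threshold `h = h*`. -/
theorem isPhaseCurve_equilibrium {n k : ℕ} (hn : 3 ≤ n) (hnk : n < 2 * k) :
    IsPhaseCurve n k (fun _ => xiStar n k (hStar n k)) (fun _ => 0) univ := by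
  have hs := hStar_pos hn hnk
  have hnk' : (n : ℝ) < 2 * k := by exact_mod_cast hnk
  have hn0 : (0 : ℝ) < n := by positivity
  have hacc : accel n k (xiStar n k (hStar n k)) 0 = 0 := by
    have h1 := (potential_xiStar_eq_one_iff hn hnk hs).2 rfl
    rw [potential_eq, exp_mul_xiStar hn hnk hs] at h1
    have h2 : 0 < 2 * (k : ℝ) - n := by linarith
    have h3 : 0 < 2 * (k : ℝ) := by linarith
    have h4 : (0 : ℝ) < k := by linarith
    rw [accel, zero_pow two_ne_zero, sub_zero, one_pow, div_one, mul_one]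
    generalize hStar n k = H at *
    generalize Real.exp (-(2 * (k : ℝ)) * xiStar n k H) = A at *
    field_simp at h1 ⊢
    linear_combination -h1
  refine ⟨isOpen_univ, ordConnected_univ, univ_nonempty, fun t _ => hasDerivAt_const _ _,
    fun t _ => ?_, fun t _ => by norm_num⟩
  simp only [hacc]
  exact hasDerivAt_const _ _

namespace RadialTrajectory

variable {n k : ℕ} {h s : ℝ} {v : ℝ → ℝ} {S : Set ℝ} {l : Filter ℝ}

/-- At the threshold, `ξ_t` vanishes only at `ξ = ξ*`, so a solution along which it vanishes is the
equilibrium. -/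
theorem eq_equilibrium (hn : 3 ≤ n) (hnk : n < 2 * k) (rt : RadialTrajectory n k h 1 v S)
    (hh : h = hStar n k) {t₀ : ℝ} (ht₀ : t₀ ∈ Real.exp ⁻¹' S) (h0 : xit v t₀ = 0) :
    Real.exp ⁻¹' S = univ ∧ ∀ t, xi v t = xiStar n k h ∧ xit v t = 0 := by
  have hF : potential n k h (xi v t₀) = 1 := by
    rw [← rt.traj.energy t₀ ht₀, h0]; norm_num
  have h1 : xi v t₀ = xiStar n k h := by
    by_contra hne
    have := potential_lt_xiStar hn hnk rt.h_pos hne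
    rw [hF, (potential_xiStar_eq_one_iff hn hnk rt.h_pos).2 hh] at this
    exact lt_irrefl _ this
  have heq := isPhaseCurve_equilibrium hn hnk
  rw [← hh] at heq
  obtain ⟨h2, h3⟩ := rt.traj.curve.eqOn_inter heq ⟨ht₀, mem_univ _⟩ h1 h0
  rw [inter_univ] at h2 h3
  have hT := rt.traj.maximal.2 _ _ _ heq (subset_univ _) h2
  rw [← hT] at h2 h3
  exact ⟨hT.symm, fun t => ⟨h2 (mem_univ t), h3 (mem_univ t)⟩⟩

/-- The sign of `ξ - c` is constant along a solution that avoids the value `c`. -/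
theorem xi_dichotomy (rt : RadialTrajectory n k h s v S) {c : ℝ}
    (hc : ∀ t ∈ Real.exp ⁻¹' S, xi v t ≠ c) :
    (∀ t ∈ Real.exp ⁻¹' S, xi v t < c) ∨ (∀ t ∈ Real.exp ⁻¹' S, c < xi v t) := by
  have hcont : ContinuousOn (xi v) (Real.exp ⁻¹' S) := fun t ht =>
    (rt.traj.curve.hasDerivAt_fst t ht).continuousAt.continuousWithinAt
  by_contra hcon
  push Not at hcon
  obtain ⟨⟨a, ha, ha'⟩, b, hb, hb'⟩ := hcon
  obtain ⟨r, hrT, hr0⟩ := rt.traj.curve.ordConnected.isPreconnected.intermediate_value hb ha hcont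
    ⟨hb', ha'⟩
  exact hc r hrT hr0

theorem tendsto_confFactor_div_rpow (rt : RadialTrajectory n k h s v S) {x : ℝ} {lr : Filter ℝ}
    (hS : ∀ᶠ r in lr, r ∈ S) (hξ : Tendsto (fun r => xi v (Real.log r)) lr (𝓝 x)) :
    Tendsto (fun r => confFactor v r / r ^ (-2 : ℝ)) lr (𝓝 (Real.exp (-2 * x))) := by
  refine ((hξ.const_mul (-2)).rexp).congr' ?_
  filter_upwards [hS] with r hr
  rw [rt.confFactor_eq hr, Real.rpow_def_of_pos (rt.pos hr), ← Real.exp_sub]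
  ring_nf

/-- A solution with `2k > n` that stays above the maximum point of the potential, by a definite
amount, is convex; this is its behaviour at the origin. -/
theorem convex_zero (hn : 3 ≤ n) (hk : 1 < k) (hkn : k ≤ n) (hnk : n < 2 * k)
    (rt : RadialTrajectory n k h 1 v S) {x₁ : ℝ} (hx₁ : ∀ t ∈ Real.exp ⁻¹' S, x₁ ≤ xi v t)
    (hF : ∀ x, x₁ ≤ x → potentialDeriv n k h x < 0 ∧ 0 < potential n k h x) :
    IsLeftEnd (Real.exp ⁻¹' S) atBot ∧ HasExpansionAtZero n k (-kthRoot k h) v ∧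
      ExtendsHolderAtOrigin n (2 - (n : ℝ) / k) v ∧ AsymptoticToLine v atBot (-1) := by
  have hc := rt.traj.curve
  obtain ⟨t₀, ht₀⟩ := hc.nonempty
  obtain ⟨l, hl⟩ := exists_isLeftEnd hc.isOpen hc.ordConnected hc.nonempty
  obtain ⟨rfl, hξ, hp⟩ := rt.traj.convex_left hk hl hx₁ hF
  have hT : ∀ᶠ t in atBot, t ∈ Real.exp ⁻¹' S := (hl.eventually ht₀).mono fun t ht => ht.1
  have h1 := rt.hasExpansionAtZero hn hk hnk hT hp hξ
  rw [one_mul] at h1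
  obtain ⟨L, -, h2, -⟩ := rt.traj.asymptotics_of_lt hn hk hnk hT hp hξ
  exact ⟨hl, h1, rt.extendsHolderAtOrigin hn hk hkn hnk hT hp hξ, hξ, h2⟩

theorem caseIGt_of_lt (hn : 3 ≤ n) (hk : 1 < k) (hkn : k ≤ n) (hnk : n < 2 * k)
    (rt : RadialTrajectory n k h 1 v S) (hlt : h < hStar n k) :
    UpToInversion (CaseIGt n k h) v S := by
  have hh := rt.h_pos
  -- Below the threshold the maximum of the potential is less than `1`, so `ξ_t` does not vanish.
  have hF1 : ∀ x, potential n k h x ≠ 1 := fun x hx => by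
    have h1 := potential_le_xiStar hn hnk hh x
    rw [hx] at h1
    rcases h1.lt_or_eq with h2 | h2
    · exact absurd ((one_lt_potential_xiStar_iff hn hnk hh).1 h2) (not_lt.2 hlt.le)
    · exact hlt.ne ((potential_xiStar_eq_one_iff hn hnk hh).1 h2.symm)
  refine rt.upToInversion hn hk hkn (fun t ht => rt.xit_ne_zero ht (hF1 _)) ?_
  intro v S rt hp
  have hc := rt.traj.curve
  obtain ⟨t₀, ht₀⟩ := hc.nonempty
  obtain ⟨l, hl⟩ := exists_isLeftEnd hc.isOpen hc.ordConnected hc.nonempty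
  obtain ⟨l', hl'⟩ := exists_isRightEnd hc.isOpen hc.ordConnected hc.nonempty
  obtain ⟨rfl, (hξ | ⟨x, -, -, -, hx⟩)⟩ := rt.left_end_of_pos hk hl hp
  swap
  · exact absurd hx (hF1 x)
  obtain ⟨x, hξ', -, (⟨-, -, hx⟩ | ⟨b, rfl, hp', hst, -⟩)⟩ := rt.right_end hn hk hl' hp
    (fun t ht => rt.traj.potential_pos ht)
  · exact absurd hx (hF1 x)
  have hS := radii_eq_Ioo_zero hc.nonempty hl hl'
  rw [rt.radii_eq] at hS
  have hT : ∀ᶠ t in atBot, t ∈ Real.exp ⁻¹' S := (hl.eventually ht₀).mono fun t ht => ht.1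
  have hpe : ∀ᶠ t in atBot, xit v t < 0 := hT.mono hp
  have h1 := rt.hasExpansionAtZero hn hk hnk hT hpe hξ
  rw [one_mul] at h1
  obtain ⟨L, -, h2, -⟩ := rt.traj.asymptotics_of_lt hn hk hnk hT hpe hξ
  refine Or.inl ⟨hlt, Real.exp b, Real.exp_pos b, hS, hst, h1, ?_, hξ, h2⟩
  rw [Real.log_exp]
  exact ⟨⟨x, hξ'⟩, hp'⟩

theorem caseIGt_of_eq (hn : 3 ≤ n) (hk : 1 < k) (hkn : k ≤ n) (hnk : n < 2 * k)
    (rt : RadialTrajectory n k h 1 v S) (heq : h = hStar n k) :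
    UpToInversion (CaseIGt n k h) v S := by
  have hh := rt.h_pos
  have hF1 := (potential_xiStar_eq_one_iff hn hnk hh).2 heq
  have huniq : ∀ x, potential n k h x = 1 → x = xiStar n k h := fun x hx => by
    by_contra hne
    have := potential_lt_xiStar hn hnk hh hne
    linarith
  by_cases h0 : ∃ t ∈ Real.exp ⁻¹' S, xit v t = 0
  · obtain ⟨t₀, ht₀, h0⟩ := h0
    obtain ⟨hT, hconst⟩ := rt.eq_equilibrium hn hnk heq ht₀ h0
    have hS : S = Ioi 0 := by
      rw [← rt.radii_eq, hT]
      ext r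
      simp [radii]
    refine Or.inl (Or.inr (Or.inr (Or.inr (Or.inl ⟨heq, fun t ht => ?_, hS,
      fun t => (hconst t).1, fun r hr => ?_⟩))))
    · have : xit v = fun _ => 0 := funext fun t => (hconst t).2
      rw [xitt, this]
      simp
    · have hrS : r ∈ S := by rw [hS]; exact hr
      rw [rt.confFactor_eq hrS, (hconst _).1, mul_add, Real.exp_add, Real.rpow_def_of_pos hr,
        mul_comm (Real.log r)]
  push Not at h0
  refine rt.upToInversion hn hk hkn h0 ?_
  intro v S rt hp
  have hc := rt.traj.curve
  obtain ⟨t₀, ht₀⟩ := hc.nonempty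
  obtain ⟨l, hl⟩ := exists_isLeftEnd hc.isOpen hc.ordConnected hc.nonempty
  obtain ⟨l', hl'⟩ := exists_isRightEnd hc.isOpen hc.ordConnected hc.nonempty
  have hleft := rt.left_end_of_pos hk hl hp
  obtain ⟨x', hξ', hle', hright⟩ := rt.right_end hn hk hl' hp
    (fun t ht => rt.traj.potential_pos ht)
  obtain ⟨rfl, hleft⟩ := hleft
  have hT : ∀ᶠ t in atBot, t ∈ Real.exp ⁻¹' S := (hl.eventually ht₀).mono fun t ht => ht.1
  have hpe : ∀ᶠ t in atBot, xit v t < 0 := hT.mono hp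
  -- `0 < ξ_t² < 1` excludes `F(ξ) = 1`, the value at `ξ*`.
  have hne : ∀ t ∈ Real.exp ⁻¹' S, xi v t ≠ xiStar n k h := fun t ht hx => by
    have h1 := rt.traj.energy t ht
    have h2 := rt.traj.sign_pos t ht
    rw [hx, hF1, one_mul] at *
    have h3 : 1 - xit v t ^ 2 < 1 := by
      have := pow_pos (neg_pos.2 (hp t ht)) 2
      rw [neg_sq] at this
      linarith
    exact (pow_lt_one₀ h2.le h3 (by omega)).ne h1
  rcases rt.xi_dichotomy hne with hlt | hgt
  · obtain ⟨x, hξ, -, hp0, hx⟩ : ∃ x, Tendsto (xi v) atBot (𝓝 x) ∧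
        (∀ t ∈ Real.exp ⁻¹' S, xi v t ≤ x) ∧ Tendsto (xit v) atBot (𝓝 0) ∧
          potential n k h x = 1 := by
      refine hleft.resolve_left fun hξ => ?_
      obtain ⟨t, ht1, ht2⟩ := (hT.and (hξ.eventually_ge_atTop (xiStar n k h))).exists
      exact absurd (hlt t ht1) (not_lt.2 ht2)
    obtain rfl := huniq x hx
    obtain ⟨b, rfl, hp', hst, -⟩ := hright.resolve_left fun hcon => by
      have h1 := huniq x' hcon.2.2
      have h2 := hle' t₀ ht₀
      have h3 := hlt t₀ ht₀
      linarith
    have hS := radii_eq_Ioo_zero hc.nonempty hl hl'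
    rw [rt.radii_eq] at hS
    refine Or.inr (Or.inl ⟨heq, fun t ht => ?_, Real.exp b, Real.exp_pos b, hS, hst,
      rt.tendsto_confFactor_div_rpow (eventually_mem_nhdsGT_zero hT)
        (hξ.comp Real.tendsto_log_nhdsGT_zero), ⟨hξ, hp0⟩, ?_⟩)
    · rw [rt.xitt_eq ht]
      exact rt.traj.accel_neg_of_potentialDeriv_pos hk ht
        ((potentialDeriv_pos_iff hn hnk hh).2 (hlt t ht))
    · rw [Real.log_exp]; exact ⟨⟨x', hξ'⟩, hp'⟩
  · have hξ : Tendsto (xi v) atBot atTop := by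
      refine hleft.resolve_right ?_
      rintro ⟨x, -, hle, -, hx⟩
      have h1 := hle t₀ ht₀
      have h2 := hgt t₀ ht₀
      rw [huniq x hx] at h1
      linarith
    have hxle : xiStar n k h ≤ x' := by
      have := hl'.neBot
      exact ge_of_tendsto hξ' ((hl'.eventually ht₀).mono fun t ht => (hgt t ht.1).le)
    obtain ⟨rfl, hp0, hx⟩ := hright.resolve_right (by
      rintro ⟨b, -, -, -, hx⟩
      have h1 : 0 < potential n k h (xiStar n k h) := by rw [hF1]; exact one_pos
      rw [potential_pos_iff] at h1
      rw [potential_eq_zero_iff] at hx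
      have : Real.exp (n * xiStar n k h) ≤ Real.exp (n * x') :=
        Real.exp_le_exp.2 (mul_le_mul_of_nonneg_left hxle (by positivity))
      nlinarith)
    obtain rfl := huniq x' hx
    have hS := radii_eq_Ioi hc.nonempty hl hl'
    rw [rt.radii_eq] at hS
    have h1 := rt.hasExpansionAtZero hn hk hnk hT hpe hξ
    rw [one_mul] at h1
    obtain ⟨L, -, h2, -⟩ := rt.traj.asymptotics_of_lt hn hk hnk hT hpe hξ
    refine Or.inr (Or.inr (Or.inl ⟨heq, fun t ht => ?_, hS,
      rt.tendsto_confFactor_div_rpow ?_ (hξ'.comp Real.tendsto_log_atTop), h1, ⟨hξ', hp0⟩,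
        hξ, h2⟩))
    · rw [rt.xitt_eq ht]
      exact rt.traj.accel_pos_of_potentialDeriv_neg hk ht
        ((potentialDeriv_neg_iff hn hnk hh).2 (hgt t ht))
    · rw [hS]; exact Ioi_mem_atTop 0

theorem caseIGt_of_gt (hn : 3 ≤ n) (hk : 1 < k) (hkn : k ≤ n) (hnk : n < 2 * k)
    (rt : RadialTrajectory n k h 1 v S) (hgt : hStar n k < h) : CaseIGt n k h v S := by
  have hh := rt.h_pos
  have hF1 := (one_lt_potential_xiStar_iff hn hnk hh).2 hgt
  have hev : ∀ᶠ x in 𝓝 (xiStar n k h), 1 < potential n k h x :=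
    (continuous_potential.tendsto _).eventually (lt_mem_nhds hF1)
  -- `F(ξ) ≤ 1 < F(ξ*)` keeps `ξ` away from `ξ*`, by a definite amount.
  have hne : ∀ t ∈ Real.exp ⁻¹' S, xi v t ≠ xiStar n k h := fun t ht hx => by
    have h1 := rt.traj.potential_le_one ht
    rw [hx] at h1
    linarith
  rcases rt.xi_dichotomy hne with hlt | hgt'
  · obtain ⟨x₁, h1, h2⟩ := ((hev.filter_mono (nhdsWithin_le_nhds (s := Iio (xiStar n k h)))).and
      self_mem_nhdsWithin).exists
    have hx₁ : ∀ t ∈ Real.exp ⁻¹' S, xi v t ≤ x₁ := fun t ht => by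
      by_contra hcon
      have := strictMonoOn_potential hn hnk hh (le_of_lt h2) (hlt t ht).le (not_le.1 hcon)
      linarith [rt.traj.potential_le_one ht]
    refine Or.inr (Or.inr (Or.inr (Or.inr (Or.inl ⟨hgt, fun t ht => ?_, rt.concave hn hk hx₁
      fun x hx => (potentialDeriv_pos_iff hn hnk hh).2 (hx.trans_lt h2)⟩))))
    rw [rt.xitt_eq ht]
    exact rt.traj.accel_neg_of_potentialDeriv_pos hk ht
      ((potentialDeriv_pos_iff hn hnk hh).2 (hlt t ht))
  · obtain ⟨x₁, h1, h2⟩ := ((hev.filter_mono (nhdsWithin_le_nhds (s := Ioi (xiStar n k h)))).and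
      self_mem_nhdsWithin).exists
    have hx₁ : ∀ t ∈ Real.exp ⁻¹' S, x₁ ≤ xi v t := fun t ht => by
      by_contra hcon
      have := strictAntiOn_potential hn hnk hh (hgt' t ht).le (le_of_lt h2) (not_le.1 hcon)
      linarith [rt.traj.potential_le_one ht]
    have hF : ∀ x, x₁ ≤ x → potentialDeriv n k h x < 0 ∧ 0 < potential n k h x := fun x hx => by
      refine ⟨(potentialDeriv_neg_iff hn hnk hh).2 (lt_of_lt_of_le h2 hx), ?_⟩
      have h3 : 0 < potential n k h x₁ := by linarith
      rw [potential_pos_iff] at h3 ⊢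
      have : Real.exp (n * x₁) ≤ Real.exp (n * x) :=
        Real.exp_le_exp.2 (mul_le_mul_of_nonneg_left hx (by positivity))
      nlinarith
    obtain ⟨hl, e1, e2, e3⟩ := rt.convex_zero hn hk hkn hnk hx₁ hF
    have hc := rt.traj.curve
    obtain ⟨l', hl'⟩ := exists_isRightEnd hc.isOpen hc.ordConnected hc.nonempty
    obtain ⟨rfl, hξ', -⟩ := rt.traj.convex_right hk hl' hx₁ hF
    have hS := radii_eq_Ioi hc.nonempty hl hl'
    rw [rt.radii_eq] at hS
    have hinv : ∀ t ∈ Real.exp ⁻¹' {r : ℝ | r⁻¹ ∈ S}, Real.exp (-t) ∈ S := fun t ht => by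
      rw [Real.exp_neg]; exact ht
    obtain ⟨-, e4, e5, e6⟩ := (rt.inversion hn hk hkn).convex_zero hn hk hkn hnk (x₁ := x₁)
      (fun t ht => by
        rw [xi_inversion (rt.maximal.1.pos _ (hinv t ht))]
        exact hx₁ _ (hinv t ht)) hF
    refine Or.inr (Or.inr (Or.inr (Or.inr (Or.inr ⟨hgt, fun t ht => ?_, hS, e1, e4, e2, e5, e3,
      hξ', ?_⟩))))
    · rw [rt.xitt_eq ht]
      exact rt.traj.accel_pos_of_potentialDeriv_neg hk ht
        ((potentialDeriv_neg_iff hn hnk hh).2 (hgt' t ht))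
    · have h3 := (e6.2.comp tendsto_neg_atTop_atBot).neg
      rw [neg_neg] at h3
      refine h3.congr fun t => ?_
      rw [Function.comp_apply, rt.xit_inversion hn hk hkn (by
        rw [neg_neg, hS]; exact Real.exp_pos t), neg_neg, neg_neg]

theorem caseIGt (hn : 3 ≤ n) (hk : 1 < k) (hkn : k ≤ n) (hnk : n < 2 * k)
    (rt : RadialTrajectory n k h 1 v S) : UpToInversion (CaseIGt n k h) v S := by
  rcases lt_trichotomy h (hStar n k) with h1 | h1 | h1
  · exact rt.caseIGt_of_lt hn hk hkn hnk h1
  · exact rt.caseIGt_of_eq hn hk hkn hnk h1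
  · exact Or.inl (rt.caseIGt_of_gt hn hk hkn hnk h1)

end RadialTrajectory

/-! ### Solutions with `1 - ξ_t² < 0` -/

/-- For fixed `m > 0` the sign of `C(n-1, j+1) m - C(n-1, j) λ` is that of `n m - (j + 1)(m + λ)`,
so positivity at `j + 1 = k` implies positivity at all smaller orders. -/
theorem choose_mul_sub_pos {n k j : ℕ} (hk : 1 < k) (hkn : k ≤ n) (hj : j + 1 ≤ k) {m lam : ℝ}
    (hm : 0 < m)
    (hpos : 0 < ((n - 1).choose k : ℝ) * m - ((n - 1).choose (k - 1) : ℝ) * lam) :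
    0 < ((n - 1).choose (j + 1) : ℝ) * m - ((n - 1).choose j : ℝ) * lam := by
  have key : ∀ i, i + 1 ≤ n → ((i : ℝ) + 1) * (((n - 1).choose (i + 1) : ℝ) * m -
      ((n - 1).choose i : ℝ) * lam) =
      ((n - 1).choose i : ℝ) * (n * m - ((i : ℝ) + 1) * (m + lam)) := by
    intro i hi
    have h1 : (((n - 1).choose (i + 1) : ℕ) : ℝ) * ((i : ℝ) + 1) =
        ((n - 1).choose i : ℝ) * (n - 1 - i) := by
      have := Nat.choose_succ_right_eq (n - 1) i
      have h2 : ((n - 1 - i : ℕ) : ℝ) = n - 1 - i := by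
        rw [Nat.cast_sub (by omega), Nat.cast_sub (by omega)]; simp
      rw [← h2]
      exact_mod_cast this
    linear_combination m * h1
  have hch : ∀ i, i + 1 ≤ n → (0 : ℝ) < (n - 1).choose i := fun i hi => by
    exact_mod_cast Nat.choose_pos (by omega)
  obtain ⟨i, rfl⟩ : ∃ i, k = i + 1 := ⟨k - 1, by omega⟩
  have h1 := key i hkn
  have h2 := key j (hj.trans hkn)
  have h3 : 0 < n * m - ((i : ℝ) + 1) * (m + lam) := by
    rw [Nat.add_sub_cancel] at hpos
    exact pos_of_mul_pos_right (h1 ▸ mul_pos (by positivity) hpos) (hch i hkn).le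
  have hji : (j : ℝ) ≤ i := by exact_mod_cast (by omega : j ≤ i)
  have h4 : 0 < n * m - ((j : ℝ) + 1) * (m + lam) := by
    rcases le_total (m + lam) 0 with h | h
    · have h5 : (0 : ℝ) < n := by exact_mod_cast (by omega : 0 < n)
      have h6 := mul_pos h5 hm
      have h7 : ((j : ℝ) + 1) * (m + lam) ≤ 0 :=
        mul_nonpos_of_nonneg_of_nonpos (by positivity) h
      linarith
    · nlinarith
  have h5 := mul_pos (hch j (hj.trans hkn)) h4
  rw [← h2] at h5
  exact pos_of_mul_pos_right h5 (by positivity)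

namespace RadialTrajectory

variable {n k : ℕ} {h s : ℝ} {v : ℝ → ℝ} {S : Set ℝ} {l : Filter ℝ}

/-- For odd `k` and `1 - ξ_t² < 0` the sign of `σ_k` forces the signs of all `σ_j`, `j ≤ k`, because
`A_g` has a negative eigenvalue of multiplicity `n - 1`. -/
theorem inGammaMinus (hn : 3 ≤ n) (hk : 1 < k) (hkn : k ≤ n) (hodd : Odd k)
    (rt : RadialTrajectory n k h (-1) v S) : InGammaMinus n k v S := by
  intro x hx j hj1 hjk
  obtain ⟨i, rfl⟩ : ∃ i, j = i + 1 := ⟨j - 1, by omega⟩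
  have ht := rt.log_mem hx
  set t := Real.log ‖x‖ with ht_def
  have hform := sigmaCurv_log_variable (S := S) hn rt.traj.curve.isOpen
    (fun r => by rw [← mem_radii, rt.radii_eq]) rt.traj.curve.hasDerivAt_fst
    rt.traj.curve.hasDerivAt_snd (fun r hr => rt.apply_eq hr) hx ht_def
  have hq := rt.traj.sign_pos t ht
  set m := -(Real.exp (2 * xi v t) * (1 - xit v t ^ 2) / 2) with hm
  set lam := Real.exp (2 * xi v t) * (accel n k (xi v t) (xit v t) - (1 - xit v t ^ 2) / 2)
  have hm0 : 0 < m := by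
    have := mul_pos (Real.exp_pos (2 * xi v t)) hq
    rw [hm]; linarith
  have hform' : ∀ i, (-1 : ℝ) ^ (i + 1) * sigmaCurv (i + 1) (radialMetric n v) x =
      m ^ i * (((n - 1).choose (i + 1) : ℝ) * m - ((n - 1).choose i : ℝ) * lam) := by
    intro i
    rw [hform i, show Real.exp (2 * xi v t) * (1 - xit v t ^ 2) / 2 = -m by rw [hm, neg_neg],
      neg_pow m (i + 1), neg_pow m i]
    have h1 : (-1 : ℝ) ^ i * (-1) ^ i = 1 := by rw [← mul_pow]; norm_num
    rw [pow_succ, pow_succ]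
    linear_combination (((n - 1).choose (i + 1) : ℝ) * m ^ i * m -
      lam * ((n - 1).choose i : ℝ) * m ^ i) * h1
  rw [hform' i]
  refine mul_pos (pow_pos hm0 i) (choose_mul_sub_pos hk hkn hjk hm0 ?_)
  have h2 := rt.maximal.1.eqn x hx
  obtain ⟨l, rfl⟩ : ∃ l, k = l + 1 := ⟨k - 1, by omega⟩
  have h3 : 0 < m ^ l * (((n - 1).choose (l + 1) : ℝ) * m - ((n - 1).choose l : ℝ) * lam) := by
    rw [← hform' l, h2, hodd.neg_one_pow]
    have : (0 : ℝ) < n.choose (l + 1) := by exact_mod_cast Nat.choose_pos hkn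
    have h4 : (0 : ℝ) < ((2 : ℝ) ^ (l + 1))⁻¹ := by positivity
    nlinarith [mul_pos h4 this]
  exact pos_of_mul_pos_right h3 (pow_pos hm0 l).le

theorem one_lt_sq (rt : RadialTrajectory n k h (-1) v S) {t : ℝ} (ht : t ∈ Real.exp ⁻¹' S) :
    1 < xit v t ^ 2 := by linarith [rt.traj.sign_pos t ht]

theorem not_tendsto_velocity_zero [l.NeBot] (rt : RadialTrajectory n k h (-1) v S)
    (hT : ∀ᶠ t in l, t ∈ Real.exp ⁻¹' S) : ¬ Tendsto (xit v) l (𝓝 0) := by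
  intro h0
  have h1 : (1 : ℝ) ≤ 0 ^ 2 := ge_of_tendsto (h0.pow 2) (hT.mono fun t ht => (rt.one_lt_sq ht).le)
  norm_num at h1

/-- For `1 - ξ_t² < 0` and `ξ_t < 0`, the function `ξ` tends to `∞` at the left end unless it stops
there at a zero of the potential. -/
theorem left_end_of_neg (hk : 1 < k) (rt : RadialTrajectory n k h (-1) v S)
    (hl : IsLeftEnd (Real.exp ⁻¹' S) l) (hp : ∀ t ∈ Real.exp ⁻¹' S, xit v t < 0) :
    Tendsto (xi v) l atTop ∨ ∃ x, Tendsto (xi v) l (𝓝 x) ∧ (∀ t ∈ Real.exp ⁻¹' S, xi v t ≤ x) ∧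
      (∃ a, l = 𝓝[>] a) ∧ Tendsto (xit v) l (𝓝 (-1)) ∧ potential n k h x = 0 := by
  obtain ⟨t₀, ht₀⟩ := rt.traj.curve.nonempty
  have := hl.neBot
  rcases rt.left_end hk hl hp with h1 | ⟨x, hξ, hle, (⟨-, h2, -⟩ | h2)⟩
  · exact Or.inl h1
  · exact absurd h2 (rt.not_tendsto_velocity_zero ((hl.eventually ht₀).mono fun t ht => ht.1))
  · exact Or.inr ⟨x, hξ, hle, h2⟩

theorem eq_atBot_of_bounded_profile (hk : 1 < k) (rt : RadialTrajectory n k h s v S)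
    (hC : ∀ x₀, ∃ C, ∀ x, x₀ ≤ x → |profile n k h s x| ≤ C) (hl : IsLeftEnd (Real.exp ⁻¹' S) l)
    (hp : ∀ t ∈ Real.exp ⁻¹' S, xit v t < 0) (hξ : Tendsto (xi v) l atTop) : l = atBot := by
  obtain ⟨t₀, ht₀⟩ := rt.traj.curve.nonempty
  obtain ⟨C, hC⟩ := hC (xi v t₀)
  refine rt.traj.eq_atBot_of_unbounded hl (ε := 1) (C := 1 + C) ht₀ (fun t ht h => ?_)
    (by simpa using hξ)
  have h1 := rt.traj.monotoneOn (ε := -1) (t₀ := t) (fun u hu _ => by linarith [hp u hu])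
    ⟨ht, mem_Ici.2 le_rfl⟩ ⟨ht₀, h⟩ h
  simp only at h1
  have h2 := hC (xi v t) (by linarith)
  rw [← rt.traj.one_sub_sq hk ht, abs_le] at h2
  nlinarith [h2.1]

theorem bounded_profile (hk : 1 < k) (hnk : n ≤ 2 * k) (x₀ : ℝ) :
    ∃ C, ∀ x, x₀ ≤ x → |profile n k h (-1) x| ≤ C := by
  have hk0 : (0 : ℝ) < k := by positivity
  have hα : 0 ≤ 2 - (n : ℝ) / k := by
    rw [sub_nonneg, div_le_iff₀ hk0]; exact_mod_cast hnk
  refine ⟨Real.exp (-(2 - (n : ℝ) / k) * x₀) * (|h| + Real.exp (-(n * x₀))) ^ (1 / (k : ℝ)),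
    fun x hx => ?_⟩
  rw [profile_eq hk, abs_mul, abs_neg, abs_one, one_mul, abs_of_nonneg (by positivity)]
  refine mul_le_mul (Real.exp_le_exp.2 (by nlinarith)) ?_ (by positivity) (by positivity)
  refine Real.rpow_le_rpow (abs_nonneg _) ?_ (by positivity)
  refine (abs_sub _ _).trans (add_le_add_right ?_ _)
  rw [abs_of_pos (Real.exp_pos _), Real.exp_le_exp]
  have := mul_le_mul_of_nonneg_left hx (Nat.cast_nonneg (α := ℝ) n)
  linarith

theorem bounded_profile_zero (hk : 1 < k) (x₀ : ℝ) :
    ∃ C, ∀ x, x₀ ≤ x → |profile n k 0 (-1) x| ≤ C := by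
  refine ⟨Real.exp (-(2 * x₀)), fun x hx => ?_⟩
  rw [profile_eq' hk]
  simp only [zero_mul, zero_sub, abs_neg, abs_one, Real.one_rpow, mul_one, abs_mul, one_mul,
    abs_of_pos (Real.exp_pos _)]
  exact Real.exp_le_exp.2 (by linarith)

/-- The behaviour at the left end of a solution with `1 - ξ_t² < 0`, `ξ_t < 0` and `ξ → ∞`, as it
is listed in `CaseII` and `CaseIII`. -/
theorem left_end_catalog (hn : 3 ≤ n) (hk : 1 < k)
    (rt : RadialTrajectory n k h (-1) v S) (hh : h ≠ 0)
    (hl : IsLeftEnd (Real.exp ⁻¹' S) l) (hp : ∀ t ∈ Real.exp ⁻¹' S, xit v t < 0)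
    (hξ : Tendsto (xi v) l atTop) :
    (∃ a, l = 𝓝[>] a ∧ 2 * k < n ∧ AsympMultiple (confFactor v)
        (fun r => (r - Real.exp a) ^ (4 * (k : ℝ) / (n - 2 * k))) (𝓝[>] (Real.exp a))) ∨
      (l = atBot ∧ 2 * k = n ∧ AsympMultiple (confFactor v)
        (fun r => r ^ (2 * (Real.sqrt (1 + kthRoot k h) - 1))) (𝓝[>] 0)) ∨
      (l = atBot ∧ n < 2 * k ∧ HasExpansionAtZero n k (kthRoot k h) v ∧
        (k < n → SecondDerivBlowsUp v (𝓝[>] 0))) := by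
  obtain ⟨t₀, ht₀⟩ := rt.traj.curve.nonempty
  have hT : ∀ᶠ t in l, t ∈ Real.exp ⁻¹' S := (hl.eventually ht₀).mono fun t ht => ht.1
  have hpe : ∀ᶠ t in l, xit v t < 0 := hT.mono hp
  rcases lt_or_ge (2 * k) n with h1 | h1
  · obtain ⟨⟨a, rfl⟩, -⟩ := rt.traj.asymptotics_of_gt hn hk h1 hh hl hp hξ
    exact Or.inl ⟨a, rfl, h1, rt.asympMultiple_sub hn hk h1 hh hl hp hξ⟩
  · obtain rfl := rt.eq_atBot_of_bounded_profile hk (bounded_profile hk h1) hl hp hξ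
    rcases h1.eq_or_lt with h2 | h2
    · refine Or.inr (Or.inl ⟨rfl, h2.symm, ?_⟩)
      have := rt.asympMultiple_rpow hn hk h2.symm hT hpe hξ (by linarith [kthRoot_nonneg k h])
      rwa [neg_one_mul, sub_neg_eq_add, show -2 * (1 - Real.sqrt (1 + kthRoot k h)) =
        2 * (Real.sqrt (1 + kthRoot k h) - 1) by ring] at this
    · refine Or.inr (Or.inr ⟨rfl, h2, ?_, fun h3 =>
        rt.secondDerivBlowsUp_zero hn hk h3 h2 hh hT hpe hξ⟩)
      have := rt.hasExpansionAtZero hn hk h2 hT hpe hξ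
      rwa [neg_one_mul, neg_neg] at this

theorem xit_ne_zero_of_neg (rt : RadialTrajectory n k h (-1) v S) {t : ℝ}
    (ht : t ∈ Real.exp ⁻¹' S) : xit v t ≠ 0 := fun h0 => by
  have := rt.one_lt_sq ht
  rw [h0] at this
  norm_num at this

theorem potential_pos_of_even (hk : Even k) (rt : RadialTrajectory n k h s v S) {t : ℝ}
    (ht : t ∈ Real.exp ⁻¹' S) : 0 < potential n k h (xi v t) := by
  rw [← rt.traj.energy t ht]
  exact hk.pow_pos (rt.traj.curve.sq_ne_one t ht)

theorem h_pos_of_even (hk : Even k) (rt : RadialTrajectory n k h s v S) : 0 < h := by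
  obtain ⟨t₀, ht₀⟩ := rt.traj.curve.nonempty
  exact Trajectory.h_pos_of_potential_pos (rt.potential_pos_of_even hk ht₀)

theorem potential_neg_of_odd (hk : Odd k) (rt : RadialTrajectory n k h (-1) v S) {t : ℝ}
    (ht : t ∈ Real.exp ⁻¹' S) : potential n k h (xi v t) < 0 := by
  rw [← rt.traj.energy t ht]
  exact hk.pow_neg (by linarith [rt.one_lt_sq ht])

theorem caseIII (hn : 3 ≤ n) (hk : 1 < k) (hkn : k ≤ n) (heven : Even k)
    (rt : RadialTrajectory n k h (-1) v S) : UpToInversion (CaseIII n k h) v S := by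
  refine rt.upToInversion hn hk hkn (fun t ht => rt.xit_ne_zero_of_neg ht) ?_
  intro v S rt hp
  have hh := rt.h_pos_of_even heven
  have hc := rt.traj.curve
  obtain ⟨t₀, ht₀⟩ := hc.nonempty
  obtain ⟨l, hl⟩ := exists_isLeftEnd hc.isOpen hc.ordConnected hc.nonempty
  obtain ⟨l', hl'⟩ := exists_isRightEnd hc.isOpen hc.ordConnected hc.nonempty
  have := hl'.neBot
  obtain ⟨x, -, -, (⟨-, hp0, -⟩ | ⟨b, rfl, -, hst, -⟩)⟩ := rt.right_end hn hk hl' hp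
    (fun t ht => rt.potential_pos_of_even heven ht)
  · exact absurd hp0 (rt.not_tendsto_velocity_zero ((hl'.eventually ht₀).mono fun t ht => ht.1))
  have hξ : Tendsto (xi v) l atTop := by
    refine (rt.left_end_of_neg hk hl hp).resolve_right ?_
    rintro ⟨x, -, hle, -, -, hx⟩
    have h1 := rt.potential_pos_of_even heven ht₀
    rw [potential_pos_iff] at h1
    rw [potential_eq_zero_iff] at hx
    have : Real.exp (n * xi v t₀) ≤ Real.exp (n * x) :=
      Real.exp_le_exp.2 (mul_le_mul_of_nonneg_left (hle t₀ ht₀) (by positivity))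
    nlinarith
  rcases rt.left_end_catalog hn hk hh.ne' hl hp hξ with
    ⟨a, rfl, h1, h2⟩ | ⟨rfl, h1, h2⟩ | ⟨rfl, h1, h2⟩
  · obtain ⟨hS, hab⟩ := radii_eq_Ioo hc.nonempty hl hl'
    rw [rt.radii_eq] at hS
    exact ⟨Real.exp a, Real.exp b, (Real.exp_pos a).le, Real.exp_lt_exp.2 hab, hS, hst,
      Or.inl ⟨h1, Real.exp_pos a, h2⟩⟩
  · have hS := radii_eq_Ioo_zero hc.nonempty hl hl'
    rw [rt.radii_eq] at hS
    exact ⟨0, Real.exp b, le_rfl, Real.exp_pos b, hS, hst, Or.inr (Or.inl ⟨h1, rfl, h2⟩)⟩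
  · have hS := radii_eq_Ioo_zero hc.nonempty hl hl'
    rw [rt.radii_eq] at hS
    exact ⟨0, Real.exp b, le_rfl, Real.exp_pos b, hS, hst, Or.inr (Or.inr ⟨h1, rfl, h2⟩)⟩

/-- For odd `k` and `1 - ξ_t² < 0`, `ξ_t < 0`, the solution does not reach the singular set at its
right end: the potential is negative on the solution, and then also to the left of it. -/
theorem tendsto_atBot_of_odd (hk : 1 < k) (hodd : Odd k)
    (rt : RadialTrajectory n k h (-1) v S) (hl : IsRightEnd (Real.exp ⁻¹' S) l)
    (hp : ∀ t ∈ Real.exp ⁻¹' S, xit v t < 0) : Tendsto (xi v) l atBot := by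
  obtain ⟨t₀, ht₀⟩ := rt.traj.curve.nonempty
  have := hl.neBot
  have hneg : ∀ t ∈ Real.exp ⁻¹' S, t₀ ≤ t → 0 ≤ -1 * xit v t := fun t ht _ => by
    linarith [hp t ht]
  have hunb : ¬ ∃ m, ∀ t ∈ Real.exp ⁻¹' S, t₀ ≤ t → -1 * xi v t ≤ m := by
    rintro ⟨m, hm⟩
    obtain ⟨x, -, hle, (⟨-, hp0, -⟩ | ⟨-, -, hx⟩)⟩ :=
      rt.traj.limit_right hk hl ht₀ (Or.inr rfl) hneg hm
    · exact rt.not_tendsto_velocity_zero ((hl.eventually ht₀).mono fun t ht => ht.1) hp0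
    · have h1 := rt.potential_neg_of_odd hodd ht₀
      rw [potential_neg_iff] at h1
      rw [potential_eq_zero_iff] at hx
      have h2 : Real.exp (n * x) ≤ Real.exp (n * xi v t₀) :=
        Real.exp_le_exp.2 (mul_le_mul_of_nonneg_left (by linarith [hle t₀ ht₀ le_rfl])
          (by positivity))
      have h3 : 0 < h := by
        by_contra hcon
        nlinarith [Real.exp_pos (n * x)]
      nlinarith
  have h1 := tendsto_neg_atTop_atBot.comp (rt.traj.tendsto_right_of_unbounded hl hneg hunb)
  simpa [Function.comp_def] using h1

theorem completeToward_right (hn : 3 ≤ n) (hk : 1 < k)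
    (rt : RadialTrajectory n k h (-1) v S) {b c : ℝ} (hc : c < Real.exp b)
    (hS : S = Ioo c (Real.exp b)) (hl : IsRightEnd (Real.exp ⁻¹' S) (𝓝[<] b))
    (hp : ∀ t ∈ Real.exp ⁻¹' S, xit v t < 0) (hξ : Tendsto (xi v) (𝓝[<] b) atBot) :
    CompleteToward n v S (Real.exp b) := by
  obtain ⟨-, hlim⟩ := rt.traj.asymptotics_of_tendsto_atBot hn hk hl hp hξ
  have hlog : Tendsto Real.log (𝓝[S] (Real.exp b)) (𝓝[<] b) := by
    rw [hS, nhdsWithin_Ioo_eq_nhdsLT hc]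
    exact tendsto_log_nhdsLT_exp b
  refine rt.completeToward (C := |(-1)| + 1) ?_ (tendsto_abs_atBot_atTop.comp (hξ.comp hlog))
  filter_upwards [(hlim.abs.comp hlog).eventually (gt_mem_nhds (lt_add_one _))] with r hr
  rw [Function.comp_apply, abs_mul, abs_of_pos (Real.exp_pos _)] at hr
  exact hr.le

/-- For `h = 0` the metric is the hyperbolic metric of a ball. -/
theorem confFactor_hyperbolic (hk : 1 < k) (rt : RadialTrajectory n k 0 (-1) v S) {b : ℝ}
    (hl : IsRightEnd (Real.exp ⁻¹' S) (𝓝[<] b)) (hp : ∀ t ∈ Real.exp ⁻¹' S, xit v t < 0)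
    (hξ : Tendsto (xi v) (𝓝[<] b) atBot) {r : ℝ} (hr : r ∈ S) :
    confFactor v r = (2 * Real.exp b / (Real.exp b ^ 2 - r ^ 2)) ^ 2 := by
  have h1 := rt.traj.exp_eq_sinh hk hl hp hξ _ (rt.log_mem hr)
  have h0 := rt.pos hr
  have hb := Real.exp_pos b
  have h2 : v r = (Real.exp b ^ 2 - r ^ 2) / (2 * Real.exp b) := by
    rw [rt.apply_eq hr, h1, Real.sinh_eq, neg_sub, Real.exp_sub, Real.exp_sub, Real.exp_log h0]
    field_simp
  rw [confFactor, h2, ← inv_pow, inv_div]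

theorem caseII (hn : 3 ≤ n) (hk : 1 < k) (hkn : k ≤ n) (hodd : Odd k)
    (rt : RadialTrajectory n k h (-1) v S) : UpToInversion (CaseII n k h) v S := by
  refine rt.upToInversion hn hk hkn (fun t ht => rt.xit_ne_zero_of_neg ht) ?_
  intro v S rt hp
  have hc := rt.traj.curve
  obtain ⟨t₀, ht₀⟩ := hc.nonempty
  obtain ⟨l, hl⟩ := exists_isLeftEnd hc.isOpen hc.ordConnected hc.nonempty
  obtain ⟨l', hl'⟩ := exists_isRightEnd hc.isOpen hc.ordConnected hc.nonempty
  have hξ' := rt.tendsto_atBot_of_odd hk hodd hl' hp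
  obtain ⟨⟨b, rfl⟩, -⟩ := rt.traj.asymptotics_of_tendsto_atBot hn hk hl' hp hξ'
  have hconf := rt.tendsto_confFactor_div hn hk hl' hp hξ'
  have hξ : h ≤ 0 → Tendsto (xi v) l atTop := by
    refine fun hh => (rt.left_end_of_neg hk hl hp).resolve_right ?_
    rintro ⟨x, -, -, -, -, hx⟩
    rw [potential_eq_zero_iff] at hx
    nlinarith [Real.exp_pos (n * x)]
  rcases lt_trichotomy h 0 with hh | rfl | hh
  · rcases rt.left_end_catalog hn hk hh.ne hl hp (hξ hh.le) with
      ⟨a, rfl, h1, h2⟩ | ⟨rfl, h1, h2⟩ | ⟨rfl, h1, h2, -⟩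
    · obtain ⟨hS, hab⟩ := radii_eq_Ioo hc.nonempty hl hl'
      rw [rt.radii_eq] at hS
      have hab' := Real.exp_lt_exp.2 hab
      exact ⟨Real.exp a, Real.exp b, (Real.exp_pos a).le, hab', hS, hconf,
        Or.inr (Or.inr ⟨hh, Or.inl ⟨h1, Real.exp_pos a, h2,
          rt.completeToward_right hn hk hab' hS hl' hp hξ'⟩⟩)⟩
    · have hS := radii_eq_Ioo_zero hc.nonempty hl hl'
      rw [rt.radii_eq] at hS
      exact ⟨0, Real.exp b, le_rfl, Real.exp_pos b, hS, hconf,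
        Or.inr (Or.inr ⟨hh, Or.inr (Or.inl ⟨h1, rfl, h2,
          rt.completeToward_right hn hk (Real.exp_pos b) hS hl' hp hξ'⟩)⟩)⟩
    · have hS := radii_eq_Ioo_zero hc.nonempty hl hl'
      rw [rt.radii_eq] at hS
      exact ⟨0, Real.exp b, le_rfl, Real.exp_pos b, hS, hconf,
        Or.inr (Or.inr ⟨hh, Or.inr (Or.inr ⟨h1, rfl, h2⟩)⟩)⟩
  · obtain rfl := rt.eq_atBot_of_bounded_profile hk (bounded_profile_zero hk) hl hp (hξ le_rfl)
    have hS := radii_eq_Ioo_zero hc.nonempty hl hl'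
    rw [rt.radii_eq] at hS
    exact ⟨0, Real.exp b, le_rfl, Real.exp_pos b, hS, hconf,
      Or.inl ⟨rfl, rfl, fun r hr => rt.confFactor_hyperbolic hk hl' hp hξ' hr⟩⟩
  · rcases rt.left_end_of_neg hk hl hp with h1 | ⟨x, hξ, -, ⟨a, rfl⟩, hp1, hx⟩
    · exfalso
      have := hl.neBot
      have hn0 : (0 : ℝ) < n := by positivity
      have h2 : Tendsto (fun t => h * Real.exp (n * xi v t)) l atTop :=
        (Real.tendsto_exp_atTop.comp (h1.const_mul_atTop hn0)).const_mul_atTop hh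
      obtain ⟨t, h3, h4⟩ := ((hl.eventually ht₀).and (h2.eventually_ge_atTop 1)).exists
      exact absurd (potential_neg_iff.1 (rt.potential_neg_of_odd hodd h3.1)) (not_lt.2 h4)
    · obtain ⟨hS, hab⟩ := radii_eq_Ioo hc.nonempty hl hl'
      rw [rt.radii_eq] at hS
      have hlog := tendsto_log_nhdsGT_exp a
      refine ⟨Real.exp a, Real.exp b, (Real.exp_pos a).le, Real.exp_lt_exp.2 hab, hS, hconf,
        Or.inr (Or.inl ⟨hh, Real.exp_pos a, rt.stopsAt hn hk
          (eventually_mem ((hl.eventually ht₀).mono fun t ht => ht.1) hlog ?_)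
          (hlog.mono_right nhdsWithin_le_nhds) (hξ.comp hlog) (hp1.comp hlog) hx⟩)⟩
      filter_upwards [self_mem_nhdsWithin] with r hr using (Real.exp_pos a).trans hr

end RadialTrajectory

/-! ### The catalog of solutions -/

/-- Every solution is contained in a greatest one. -/
theorem exists_greatest_radialSolution {n k : ℕ} (hn : 3 ≤ n) (hk : 1 < k) (hkn : k ≤ n)
    {v : ℝ → ℝ} {S : Set ℝ} (hv : IsRadialSolution n k v S) :
    ∃ (w : ℝ → ℝ) (T : Set ℝ), IsMaximalRadialSolution n k w T ∧ S ⊆ T ∧ EqOn v w S ∧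
      ∀ (w' : ℝ → ℝ) (T' : Set ℝ), IsRadialSolution n k w' T' → S ⊆ T' → EqOn v w' S →
        T' ⊆ T ∧ EqOn w' w T' := by
  obtain ⟨η, ρ, U, hU, hSU, hEq, hmax⟩ :=
    (isPhaseCurve_of_isRadialSolution hn hk hkn hv).exists_greatest_extension
  set w : ℝ → ℝ := fun r => r * Real.exp (η (Real.log r)) with hw
  have hsol : IsRadialSolution n k w (radii U) :=
    hU.isRadialSolution hn hk hkn fun r _ => rfl
  have hST : S ⊆ radii U := fun r hr => by
    have hr0 := hv.subset_pos hr
    exact ⟨hr0, hSU (by rwa [mem_preimage, Real.exp_log hr0])⟩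
  have hvw : EqOn v w S := fun r hr => by
    have hr0 := hv.subset_pos hr
    rw [eq_mul_exp_xi hr0 (hv.pos r hr), hEq (x := Real.log r)
      (by rwa [mem_preimage, Real.exp_log hr0])]
  have hgreat : ∀ (w' : ℝ → ℝ) (T' : Set ℝ), IsRadialSolution n k w' T' → S ⊆ T' →
      EqOn v w' S → T' ⊆ radii U ∧ EqOn w' w T' := by
    intro w' T' hw' hST' hEq'
    obtain ⟨h1, h2⟩ := hmax _ _ _ (isPhaseCurve_of_isRadialSolution hn hk hkn hw')
      (preimage_mono hST') fun t ht => by rw [xi, xi, hEq' ht]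
    have hlog : ∀ r ∈ T', Real.log r ∈ Real.exp ⁻¹' T' := fun r hr => by
      rwa [mem_preimage, Real.exp_log (hw'.subset_pos hr)]
    refine ⟨fun r hr => ⟨hw'.subset_pos hr, h1 (hlog r hr)⟩, fun r hr => ?_⟩
    rw [eq_mul_exp_xi (hw'.subset_pos hr) (hw'.pos r hr), h2 (hlog r hr)]
  refine ⟨w, radii U, ⟨hsol, fun w' T' hw' hUT hEq' => ?_⟩, hST, hvw, hgreat⟩
  exact Subset.antisymm (hgreat w' T' hw' (hST.trans hUT)
    fun r hr => (hvw hr).trans (hEq' (hST hr))).1 hUT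

theorem theorem2 (n k : ℕ) (hn : 3 ≤ n) (hk : 1 < k) (hkn : k ≤ n) :
    -- every solution has a maximum domain of definition
    (∀ (v : ℝ → ℝ) (S : Set ℝ), IsRadialSolution n k v S →
      ∃ (w : ℝ → ℝ) (T : Set ℝ), IsMaximalRadialSolution n k w T ∧ S ⊆ T ∧ EqOn v w S ∧
        ∀ (w' : ℝ → ℝ) (T' : Set ℝ), IsRadialSolution n k w' T' → S ⊆ T' → EqOn v w' S →
          T' ⊆ T ∧ EqOn w' w T') ∧
    -- the threshold `h*`
    (n < 2 * k → 0 < hStar n k ∧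
      ∃ M : ℝ → ℝ,
        (∀ h : ℝ, 0 < h →
          IsGreatest (range fun x : ℝ =>
            Real.exp (((n : ℝ) - 2 * k) * x) * h - Real.exp (-(2 * (k : ℝ)) * x)) (M h)) ∧
        StrictMonoOn M (Ioi 0) ∧ ∀ h : ℝ, 0 < h → (M h = 1 ↔ h = hStar n k)) ∧
    -- the catalog of maximal solutions
    ∀ (v : ℝ → ℝ) (S : Set ℝ), IsMaximalRadialSolution n k v S →
      ((∀ t, Real.exp t ∈ S → 0 < 1 - xit v t ^ 2) ∨
        (∀ t, Real.exp t ∈ S → 1 - xit v t ^ 2 < 0)) ∧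
      ∃ h : ℝ, (∀ t, Real.exp t ∈ S → firstIntegral n k v t = h) ∧
        ((∀ t, Real.exp t ∈ S → 0 < 1 - xit v t ^ 2) →
          0 < h ∧
          (2 * k < n → AnnulusBlowUp v S) ∧
          (2 * k = n → UpToInversion (CaseIEq n k h) v S) ∧
          (n < 2 * k → UpToInversion (CaseIGt n k h) v S)) ∧
        (Odd k → (∀ t, Real.exp t ∈ S → 1 - xit v t ^ 2 < 0) →
          InGammaMinus n k v S ∧ UpToInversion (CaseII n k h) v S) ∧
        (Even k → (∀ t, Real.exp t ∈ S → 1 - xit v t ^ 2 < 0) →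
          0 < h ∧ UpToInversion (CaseIII n k h) v S) := by
  refine ⟨fun v S hv => exists_greatest_radialSolution hn hk hkn hv,
    fun hnk => ⟨hStar_pos hn hnk, threshold hn hnk⟩, fun v S hv => ?_⟩
  have hmax := isMaximalPhaseCurve_of_isMaximalRadialSolution hn hk hkn hv
  obtain ⟨h, hh⟩ := hmax.1.exists_firstIntegral hk
  have henergy := fun t ht => one_sub_sq_pow_eq_potential (hh t ht)
  have hneg : (∀ t, Real.exp t ∈ S → 1 - xit v t ^ 2 < 0) → RadialTrajectory n k h (-1) v S :=
    fun hs => ⟨hv, hmax, henergy, Or.inr rfl, fun t ht => by linarith [hs t ht]⟩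
  refine ⟨hmax.1.sign_dichotomy, h, hh, fun hs => ?_, fun hodd hs => ?_, fun heven hs => ?_⟩
  · have rt : RadialTrajectory n k h 1 v S :=
      ⟨hv, hmax, henergy, Or.inl rfl, fun t ht => by linarith [hs t ht]⟩
    exact ⟨rt.h_pos, fun hnk => rt.annulusBlowUp_of_lt hn hk hnk,
      fun hnk => rt.caseIEq hn hk hkn hnk, fun hnk => rt.caseIGt hn hk hkn hnk⟩
  · exact ⟨(hneg hs).inGammaMinus hn hk hkn hodd, (hneg hs).caseII hn hk hkn hodd⟩
  · exact ⟨(hneg hs).h_pos_of_even heven, (hneg hs).caseIII hn hk hkn heven⟩
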